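/- **Setting.** An arena consists of a finite nonempty directed graph $(V,E)$ in which every vertex has an outgoing edge, and a partition $V=V_0\cup V_1$ into the vertices of Player 0 and of Player 1. A play is an infinite path $\rho=\rho_0\rho_1\cdots$; strategies may depend on the whole history, and the winning region $W_i$ is the set of vertices from which Player $i$ has a winning strategy. Let $(Q_c,P_c)_{c<d}$ be $d$ pairs of vertex sets (requests and responses), and for each $c<d$ let $\mathrm{Cst}_c$ label every edge as an increment-edge or an $\varepsilon$-edge. The cost of a path under $\mathrm{Cst}_c$ is its number of increment-edges. For $\rho_k\in Q_c$ let $\mathrm{StCor}_c(\rho,k)$ be the minimal cost under $\mathrm{Cst}_c$ of an infix $\rho_k\cdots\rho_l$ with $l\ge k$ and $\rho_l\in P_c$ (it is $\infty$ if there is none); for $\rho_k\notin Q_c$ it is $0$. Let $\mathrm{StCor}(\rho,k)=\max_c\mathrm{StCor}_c(\rho,k)$. Player 0 wins $\rho$ * in the *Streett game* if, for every $c$, $P_c$ is visited infinitely often whenever $Q_c$ is; * in the *Streett game with costs* if $\limsup_{k\to\infty}\mathrm{StCor}(\rho,k)<\infty$; * in the *bounded Streett game with costs* if, moreover, there are no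 $c$ and $k$ such that $\mathrm{StCor}_c(\rho,k)=\infty$ and $\rho$ traverses infinitely many increment-edges of $\mathrm{Cst}_c$. Let $n=|V|$ and $m=|E|$. Call a vertex *mixed* if, for some $c$, it has both an incoming increment-edge and an incoming $\varepsilon$-edge with respect to $\mathrm{Cst}_c$. Let $s$ be the number of edges that lead into a mixed vertex and are increment-edges with respect to some $\mathrm{Cst}_{c'}$. Thus $n+s$ and $m+s$ are the numbers of vertices and edges after these $s$ edges have been subdivided, and $s=0$ if no vertex is mixed. An algorithm is a program for a random access machine with addition and subtraction at unit cost. It *solves* a class of games if, for every game of the class given explicitly as input, it outputs for each vertex the player in whose winning region the vertex lies. **Theorem.** Let $T:\mathbb N^3\to\mathbb N$ and suppose that there is an algorithm that solves every Streett game with $n$ vertices, $m$ edges and $d$ pairs in at most $T(n,m,d)$ steps. Then 1. there is an algorithm that solves bounded Streett games with costs in time $O\big(T(2^d(n+s),\,2^d(m+s),\,2d)\big)$; 2. there is an algorithm that solves Streett games with costs in time $O\big(n\cdot T(2^d(n+s),\,2^d(m+s),\,2d)\big)$. The constants in $O(\cdot)$ do not depend on the game. In particular, for games without mixed vertices the bounds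 are $O(T(2^dn,2^dm,2d))$ and $O(n\cdot T(2^dn,2^dm,2d))$. -/

import Mathlib

open Filter

/-! ### Infinite games on finite graphs -/

/-- An arena `(V, V₀, V₁, E)`; `owner v = i` means `v ∈ Vᵢ`, and every vertex has an outgoing
edge.  (Finiteness of `V` is imposed where arenas are used: there `V = Fin n`.) -/
structure Arena (V : Type) where
  owner : V → Fin 2
  Edge : V → V → Prop
  exists_edge : ∀ v, ∃ w, Edge v w

namespace Arena

variable {V : Type}

/-- `ρ` is an infinite path through the arena. -/
def IsPlay (A : Arena V) (ρ : ℕ → V) : Prop :=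
  ∀ k, A.Edge (ρ k) (ρ (k + 1))

/-- A strategy of Player `i`, a map `V* Vᵢ → V` that follows edges: `move w v` is its value on the
history `w v` (the values at vertices `v ∉ Vᵢ` are irrelevant). -/
structure Strategy (A : Arena V) (i : Fin 2) where
  move : List V → V → V
  edge_move : ∀ w v, A.owner v = i → A.Edge v (move w v)

/-- `ρ` is consistent with `σ`: `ρ (k+1) = σ (ρ 0 ⋯ ρ k)` whenever `ρ k ∈ Vᵢ`. -/
def Strategy.Consistent {A : Arena V} {i : Fin 2} (σ : A.Strategy i) (ρ : ℕ → V) : Prop :=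
  ∀ k, A.owner (ρ k) = i → ρ (k + 1) = σ.move ((List.range k).map ρ) (ρ k)

/-- Player `0` wins the plays in `Win`, Player `1` all others. -/
def WonBy (Win : Set (ℕ → V)) (i : Fin 2) (ρ : ℕ → V) : Prop :=
  if i = 0 then ρ ∈ Win else ρ ∉ Win

/-- The winning region `Wᵢ` of Player `i` in the game `(A, Win)`. -/
def winningRegion (A : Arena V) (Win : Set (ℕ → V)) (i : Fin 2) : Set V :=
  {v | ∃ σ : A.Strategy i, ∀ ρ, A.IsPlay ρ → ρ 0 = v → σ.Consistent ρ → WonBy Win i ρ}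

end Arena

/-! ### Streett conditions and their variants with costs -/

/-- A collection of `d` Streett pairs `(Q_c, P_c)` (requests and responses). -/
structure StreettPairs (d : ℕ) (V : Type) where
  Q : Fin d → Set V
  P : Fin d → Set V

/-- The labels of edges: `ε` and increment. -/
inductive CostLabel where
  | eps
  | inc

/-- `d` cost functions; `Cst c v w` is the label of the edge `(v, w)` under the `c`-th one (the
values at pairs that are not edges are irrelevant). -/
abbrev CostFunctions (d : ℕ) (V : Type) : Type := Fin d → V → V → CostLabel

namespace StreettPairs

variable {V : Type} {d : ℕ}

/-- The cost of the infix `ρ k ⋯ ρ l`: its number of increment-edges with respect to `Cst c`. -/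
noncomputable def infixCost (Cst : CostFunctions d V) (c : Fin d) (ρ : ℕ → V) (k l : ℕ) : ℕ :=
  {j | k ≤ j ∧ j < l ∧ Cst c (ρ j) (ρ (j + 1)) = CostLabel.inc}.ncard

open Classical in
/-- The cost-of-response at position `k` for pair `c` (`⊤` if a request is not answered). -/
noncomputable def stCorAt (Γ : StreettPairs d V) (Cst : CostFunctions d V) (c : Fin d)
    (ρ : ℕ → V) (k : ℕ) : ℕ∞ :=
  if ρ k ∈ Γ.Q c then ⨅ l, ⨅ (_ : k ≤ l ∧ ρ l ∈ Γ.P c), (infixCost Cst c ρ k l : ℕ∞) else 0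

/-- The cost-of-response at position `k`, the maximum over all pairs. -/
noncomputable def stCor (Γ : StreettPairs d V) (Cst : CostFunctions d V)
    (ρ : ℕ → V) (k : ℕ) : ℕ∞ :=
  ⨆ c, Γ.stCorAt Cst c ρ k

/-- At position `k` there is a request of pair `c` that is unanswered with cost `∞`: it is never
answered although infinitely many increment-edges with respect to `Cst c` follow. -/
def UnansweredInf (Γ : StreettPairs d V) (Cst : CostFunctions d V) (c : Fin d)
    (ρ : ℕ → V) (k : ℕ) : Prop :=
  Γ.stCorAt Cst c ρ k = ⊤ ∧ ∃ᶠ j in atTop, Cst c (ρ j) (ρ (j + 1)) = CostLabel.inc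

/-- The classical Streett condition. -/
def streett (Γ : StreettPairs d V) : Set (ℕ → V) :=
  {ρ | ∀ c, (∃ᶠ k in atTop, ρ k ∈ Γ.Q c) → ∃ᶠ k in atTop, ρ k ∈ Γ.P c}

/-- The cost-Streett condition. -/
def costStreett (Γ : StreettPairs d V) (Cst : CostFunctions d V) : Set (ℕ → V) :=
  {ρ | limsup (fun k => Γ.stCor Cst ρ k) atTop < ⊤}

/-- The bounded cost-Streett condition. -/
def bndCostStreett (Γ : StreettPairs d V) (Cst : CostFunctions d V) : Set (ℕ → V) :=
  {ρ | limsup (fun k => Γ.stCor Cst ρ k) atTop < ⊤ ∧ ∀ c k, ¬ Γ.UnansweredInf Cst c ρ k}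

end StreettPairs

namespace Arena

variable {V : Type}

/-- `v` has both an incoming increment-edge and an incoming `ε`-edge with respect to one and the
same cost function. -/
def Mixed {d : ℕ} (A : Arena V) (Cst : CostFunctions d V) (v : V) : Prop :=
  ∃ c, (∃ u, A.Edge u v ∧ Cst c u v = CostLabel.inc) ∧
    ∃ u, A.Edge u v ∧ Cst c u v = CostLabel.eps

/-- The number of edges that have to be subdivided (each by one new vertex) so that no vertex is
mixed any more: the edges into mixed vertices that are increment-edges with respect to some cost
function.  Subdividing them adds this number both to the vertices and to the edges. -/
noncomputable def subdivisions {d : ℕ} (A : Arena V) (Cst : CostFunctions d V) : ℕ :=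
  {e : V × V | A.Edge e.1 e.2 ∧ (∃ c, Cst c e.1 e.2 = CostLabel.inc) ∧ A.Mixed Cst e.2}.ncard

end Arena

/-! ### Algorithms: random access programs with a step count -/

namespace RAM

/-- The memory: arrays of natural numbers, `σ a i` is cell `i` of array `a`.  A program names only
finitely many arrays. -/
abbrev Mem : Type := ℕ → ℕ → ℕ

/-- Expressions: constants, (indirect) reading of a cell, addition, truncated subtraction. -/
inductive Exp where
  | lit (k : ℕ)
  | read (a : ℕ) (i : Exp)
  | add (x y : Exp)
  | sub (x y : Exp)

/-- The value of an expression. -/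
def Exp.val (σ : Mem) : Exp → ℕ
  | .lit k => k
  | .read a i => σ a (i.val σ)
  | .add x y => x.val σ + y.val σ
  | .sub x y => x.val σ - y.val σ

/-- Evaluating an expression takes one step for each constant, read, addition, subtraction. -/
def Exp.cost : Exp → ℕ
  | .lit _ => 1
  | .read _ i => i.cost + 1
  | .add x y => x.cost + y.cost + 1
  | .sub x y => x.cost + y.cost + 1

/-- Programs.  `write a i x` stores the value of `x` in cell `i` of array `a`; a condition holds if
its value is not `0`. -/
inductive Prog where
  | skip
  | write (a : ℕ) (i x : Exp)
  | seq (p q : Prog)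
  | ite (b : Exp) (p q : Prog)
  | loop (b : Exp) (p : Prog)

/-- The memory `σ` with cell `i` of array `a` overwritten by `x`. -/
def Mem.write (σ : Mem) (a i x : ℕ) : Mem :=
  Function.update σ a (Function.update (σ a) i x)

/-- `Run p σ t τ`: started in `σ`, the program `p` halts after exactly `t` steps in `τ`. -/
inductive Run : Prog → Mem → ℕ → Mem → Prop where
  | skip (σ : Mem) : Run .skip σ 1 σ
  | write (a : ℕ) (i x : Exp) (σ : Mem) :
      Run (.write a i x) σ (i.cost + x.cost + 1) (σ.write a (i.val σ) (x.val σ))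
  | seq {p q : Prog} {σ τ υ : Mem} {s t : ℕ} :
      Run p σ s τ → Run q τ t υ → Run (.seq p q) σ (s + t) υ
  | ite_pos {b : Exp} {p q : Prog} {σ τ : Mem} {t : ℕ} :
      b.val σ ≠ 0 → Run p σ t τ → Run (.ite b p q) σ (b.cost + 1 + t) τ
  | ite_neg {b : Exp} {p q : Prog} {σ τ : Mem} {t : ℕ} :
      b.val σ = 0 → Run q σ t τ → Run (.ite b p q) σ (b.cost + 1 + t) τ
  | loop_exit {b : Exp} {p : Prog} {σ : Mem} :
      b.val σ = 0 → Run (.loop b p) σ (b.cost + 1) σ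
  | loop_step {b : Exp} {p : Prog} {σ τ υ : Mem} {s t : ℕ} :
      b.val σ ≠ 0 → Run p σ s τ → Run (.loop b p) τ t υ →
        Run (.loop b p) σ (b.cost + 1 + s + t) υ

end RAM

/-! ### Games as inputs, winning regions as outputs -/

namespace GameIO

variable {n m d : ℕ}

/-- `e` lists the edges of `A`, each exactly once and in any order; so `m` is their number. -/
def IsEdgeList (A : Arena (Fin n)) (e : Fin m → Fin n × Fin n) : Prop :=
  Function.Injective e ∧ ∀ v w, A.Edge v w ↔ ∃ j, e j = (v, w)

/-- The array with entries `f 0, …, f (k-1)`, and `0` beyond them. -/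
def table {k : ℕ} (f : Fin k → ℕ) (i : ℕ) : ℕ :=
  if h : i < k then f ⟨i, h⟩ else 0

open Classical in
/-- The input for a Streett game.  Array `0` holds `n, m, d`; array `1` the owners of the vertices;
arrays `2` and `3` the tails and heads of the edges; arrays `4` and `5` the sets `Q_c` and `P_c`
(entry `c * n + v` is `1` if `v` is in the set and `0` if not).  All other cells are `0`. -/
noncomputable def streettInput (A : Arena (Fin n)) (e : Fin m → Fin n × Fin n)
    (Γ : StreettPairs d (Fin n)) : RAM.Mem
  | 0 => table ![n, m, d]
  | 1 => table fun v => (A.owner v : ℕ)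
  | 2 => table fun j => ((e j).1 : ℕ)
  | 3 => table fun j => ((e j).2 : ℕ)
  | 4 => fun i => if ∃ (c : Fin d) (v : Fin n), i = c * n + v ∧ v ∈ Γ.Q c then 1 else 0
  | 5 => fun i => if ∃ (c : Fin d) (v : Fin n), i = c * n + v ∧ v ∈ Γ.P c then 1 else 0
  | _ => fun _ => 0

open Classical in
/-- The input for a (bounded) Streett game with costs: in addition, array `6` holds the cost
functions (entry `c * m + j` is `1` if edge `j` is an increment-edge for `Cst c`, else `0`). -/
noncomputable def costInput (A : Arena (Fin n)) (e : Fin m → Fin n × Fin n)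
    (Γ : StreettPairs d (Fin n)) (Cst : CostFunctions d (Fin n)) : RAM.Mem :=
  Function.update (streettInput A e Γ) 6 fun i =>
    if ∃ (c : Fin d) (j : Fin m), i = c * m + j ∧ Cst c (e j).1 (e j).2 = CostLabel.inc
    then 1 else 0

/-- In the memory `τ`, array `7` tells for every vertex which player wins from it, that is, it
holds the two winning regions. -/
def IsSolution (A : Arena (Fin n)) (Win : Set (ℕ → Fin n)) (τ : RAM.Mem) : Prop :=
  ∀ v : Fin n, ∃ i : Fin 2, τ 7 v = i ∧ v ∈ A.winningRegion Win i

/-- `p` solves all Streett games in time `T n m d`, where `n` is the number of vertices, `m` the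
number of edges, and `d` the number of pairs. -/
def SolvesStreett (p : RAM.Prog) (T : ℕ → ℕ → ℕ → ℕ) : Prop :=
  ∀ (n m d : ℕ), 0 < n →
    ∀ (A : Arena (Fin n)) (e : Fin m → Fin n × Fin n) (Γ : StreettPairs d (Fin n)),
      IsEdgeList A e →
        ∃ t τ, RAM.Run p (streettInput A e Γ) t τ ∧ t ≤ T n m d ∧ IsSolution A Γ.streett τ

/-- `p` solves all bounded Streett games with costs in time `T n m d s`, where `s` is the number of
edges to be subdivided. -/
def SolvesBndCostStreett (p : RAM.Prog) (T : ℕ → ℕ → ℕ → ℕ → ℕ) : Prop :=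
  ∀ (n m d : ℕ), 0 < n →
    ∀ (A : Arena (Fin n)) (e : Fin m → Fin n × Fin n) (Γ : StreettPairs d (Fin n))
      (Cst : CostFunctions d (Fin n)), IsEdgeList A e →
        ∃ t τ, RAM.Run p (costInput A e Γ Cst) t τ ∧ t ≤ T n m d (A.subdivisions Cst) ∧
          IsSolution A (Γ.bndCostStreett Cst) τ

/-- `p` solves all Streett games with costs in time `T n m d s`, where `s` is the number of edges
to be subdivided. -/
def SolvesCostStreett (p : RAM.Prog) (T : ℕ → ℕ → ℕ → ℕ → ℕ) : Prop :=
  ∀ (n m d : ℕ), 0 < n →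
    ∀ (A : Arena (Fin n)) (e : Fin m → Fin n × Fin n) (Γ : StreettPairs d (Fin n))
      (Cst : CostFunctions d (Fin n)), IsEdgeList A e →
        ∃ t τ, RAM.Run p (costInput A e Γ Cst) t τ ∧ t ≤ T n m d (A.subdivisions Cst) ∧
          IsSolution A (Γ.costStreett Cst) τ

end GameIO

/-! Record along a play the set of pairs that have an open request. This yields `2 ^ d` copies of
the arena, in which the increment-edges into mixed vertices are subdivided, so that the label just
traversed can be read off the vertex just entered. On this product keep the `d` original pairs, and
add for every `c` a pair that is requested when an increment-edge of `Cst c` has just been traversed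
and answered when no request of `c` is open. The resulting Streett condition expresses `relaxed`:
the Streett condition without unanswered requests of infinite cost, but with no bound on costs.

Dropping the bound does not change the winner. The bounded condition implies `relaxed`, so Player
`1` wins the bounded game wherever he wins the product (`Simulates.mem_winningRegion_one`).
Conversely, from her winning region in a finite Streett game Player `0` can play such that the
number of requests between two responses is uniformly bounded (`exists_boundedInv`); in the product
this bounds the increments that occur while a request is open, that is, the costs
(`Simulates.mem_winningRegion_zero`). Determinacy needs no separate proof: the assumed solver
certifies a winner at every vertex of a Streett game.

For the unbounded game, iterate: replace `D`, initially empty, by the set of vertices from which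
Player `0` wins the bounded game or reaches `D`. The sets increase and are stable after `n` rounds
(`won_stable`). Finite prefixes do not matter for the limit superior, so Player `0` wins from all
these sets. Outside of the stable set Player `1` can refute `relaxed` while avoiding `D`; he
restarts such a strategy whenever an open request of the current attempt costs at least the number
of restarts so far (`mem_winningRegion_one_costStreett`). Infinitely many restarts make the costs
unbounded; otherwise the last attempt refutes the condition. Reaching `D` is encoded without new
vertices or edges: the vertices of `D` go to Player `0`, lose their requests, and get one edge
redirected to a copy with a self-loop.

For the running time, the product is written down with additions, subtractions and tables only. The
given solver is run in arrays of its own and logs its writes, so that resetting its memory costs no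
more than the run, up to a constant. Everything else is linear in the size of the product, and this
is `O(T)` by `le_time_of_solvesStreett`: an adversary argument shows that a solver must read almost
the whole description of some game of the given dimensions. -/

theorem frequently_add_left_iff (p : ℕ → Prop) (k : ℕ) :
    (∃ᶠ n in atTop, p (k + n)) ↔ ∃ᶠ n in atTop, p n := by
  have h := Filter.map_add_atTop_eq_nat k
  conv_rhs => rw [← h, Filter.frequently_map]
  simp only [Nat.add_comm k]

/-! ### Plays, strategies with memory, and winning regions -/

namespace Arena

variable {V : Type}

theorem map_range_succ {α : Type} (ρ : ℕ → α) (k : ℕ) :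
    (List.range (k + 1)).map ρ = (List.range k).map ρ ++ [ρ k] := by
  simp [List.range_succ]

/-- The sequence of (history, current vertex) obtained by applying a move function. -/
def unroll (move : List V → V → V) (h : List V × V) : ℕ → List V × V
  | 0 => h
  | k + 1 => ((unroll move h k).1 ++ [(unroll move h k).2],
      move (unroll move h k).1 (unroll move h k).2)

/-- Every finite path can be continued by a given move function. -/
theorem exists_continuation (move : List V → V → V) (ρ : ℕ → V) (k : ℕ) :
    ∃ ρ' : ℕ → V, (∀ j ≤ k, ρ' j = ρ j) ∧
      ∀ j, k ≤ j → ρ' (j + 1) = move ((List.range j).map ρ') (ρ' j) := by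
  set u := unroll move ((List.range k).map ρ, ρ k) with hu
  let ρ' : ℕ → V := fun j => if j < k then ρ j else (u (j - k)).2
  have h1 : ∀ j ≤ k, ρ' j = ρ j := by
    intro j hj
    rcases hj.lt_or_eq with h | h
    · simp [ρ', h]
    · subst h; simp [ρ', hu, unroll]
  have h2 : ∀ i, (List.range (k + i)).map ρ' = (u i).1 := by
    intro i
    induction i with
    | zero =>
      simp only [hu, unroll, Nat.add_zero]
      apply List.map_congr_left
      intro a ha
      exact h1 a (List.mem_range.1 ha).le
    | succ i ih =>
      rw [← Nat.add_assoc, map_range_succ, ih]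
      simp [hu, unroll, ρ']
  refine ⟨ρ', h1, fun j hj => ?_⟩
  obtain ⟨i, rfl⟩ := Nat.exists_eq_add_of_le hj
  rw [h2]
  have e1 : ρ' (k + i + 1) = (u (i + 1)).2 := by
    have : k + i + 1 - k = i + 1 := by omega
    simp [ρ', this]; intro h; omega
  have e2 : ρ' (k + i) = (u i).2 := by simp [ρ']
  rw [e1, e2]; rfl

/-- A consistent finite path extends to a consistent play. -/
theorem Strategy.exists_consistent_extension {A : Arena V} {i : Fin 2} (σ : A.Strategy i)
    (ρ : ℕ → V) (k : ℕ) (hplay : ∀ j < k, A.Edge (ρ j) (ρ (j + 1)))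
    (hcons : ∀ j < k, A.owner (ρ j) = i → ρ (j + 1) = σ.move ((List.range j).map ρ) (ρ j)) :
    ∃ ρ', (∀ j ≤ k, ρ' j = ρ j) ∧ A.IsPlay ρ' ∧ σ.Consistent ρ' := by
  classical
  choose nx hnx using A.exists_edge
  obtain ⟨ρ', h1, h2⟩ := exists_continuation
    (fun h u => if A.owner u = i then σ.move h u else nx u) ρ k
  refine ⟨ρ', h1, fun j => ?_, fun j hj => ?_⟩
  · rcases lt_or_ge j k with h | h
    · rw [h1 j h.le, h1 (j + 1) h]; exact hplay j h
    · rw [h2 j h]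
      split_ifs with ho
      · exact σ.edge_move _ _ ho
      · exact hnx _
  · rcases lt_or_ge j k with h | h
    · rw [h1 j h.le] at hj ⊢
      rw [h1 (j + 1) h, hcons j h hj]
      congr 1
      apply List.map_congr_left
      intro a ha
      exact (h1 a ((List.mem_range.1 ha).le.trans h.le)).symm
    · rw [h2 j h, if_pos hj]

/-- Two winning strategies played against each other produce one play that both players would win.
-/
theorem winningRegion_disjoint (A : Arena V) (Win : Set (ℕ → V)) (v : V)
    (h0 : v ∈ A.winningRegion Win 0) (h1 : v ∈ A.winningRegion Win 1) : False := by
  classical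
  obtain ⟨σ, hσ⟩ := h0
  obtain ⟨τ, hτ⟩ := h1
  have ho : ∀ u, A.owner u ≠ 0 → A.owner u = 1 := fun u h => by omega
  obtain ⟨ρ, h1, h2⟩ := exists_continuation
    (fun h u => if A.owner u = 0 then σ.move h u else τ.move h u) (fun _ => v) 0
  have hp : A.IsPlay ρ := by
    intro j
    rw [h2 j (Nat.zero_le _)]
    split_ifs with h
    · exact σ.edge_move _ _ h
    · exact τ.edge_move _ _ (ho _ h)
  have a := hσ ρ hp (h1 0 le_rfl) (fun j hj => by rw [h2 j (Nat.zero_le _), if_pos hj])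
  have b := hτ ρ hp (h1 0 le_rfl) (fun j hj => by
    rw [h2 j (Nat.zero_le _), if_neg (by rw [hj]; decide)])
  simp only [WonBy] at a b
  simp at a b
  exact b a

theorem nonempty_strategy (A : Arena V) (i : Fin 2) : Nonempty (A.Strategy i) := by
  choose nx hnx using A.exists_edge
  exact ⟨⟨fun _ v => nx v, fun _ v _ => hnx v⟩⟩

theorem winningRegion_zero_mono (A : Arena V) {W W' : Set (ℕ → V)} (h : W ⊆ W') :
    A.winningRegion W 0 ⊆ A.winningRegion W' 0 := by
  rintro v ⟨σ, hσ⟩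
  exact ⟨σ, fun ρ a b c => by simpa [WonBy] using h (by simpa [WonBy] using hσ ρ a b c)⟩

theorem winningRegion_one_anti (A : Arena V) {W W' : Set (ℕ → V)} (h : W ⊆ W') :
    A.winningRegion W' 1 ⊆ A.winningRegion W 1 := by
  rintro v ⟨σ, hσ⟩
  refine ⟨σ, fun ρ a b c => ?_⟩
  have := hσ ρ a b c
  simp only [WonBy, one_ne_zero, if_false] at this ⊢
  exact fun h' => this (h h')

/-! ### Strategies with memory -/

/-- The memory state after reading a history and arriving at a vertex. -/
def memAfter {μ : Type} (init : μ) (step : μ → V → V → μ) : List V → V → μ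
  | [], _ => init
  | u :: l, v => memAfterAux step init u l v
where
  memAfterAux {μ : Type} (step : μ → V → V → μ) (m : μ) (u : V) : List V → V → μ
  | [], v => step m u v
  | w :: l, v => memAfterAux step (step m u w) w l v

/-- The sequence of memory states along a play. -/
def memSeq {μ : Type} (init : μ) (step : μ → V → V → μ) (ρ : ℕ → V) : ℕ → μ
  | 0 => init
  | k + 1 => step (memSeq init step ρ k) (ρ k) (ρ (k + 1))

theorem memAfterAux_append {μ : Type} (step : μ → V → V → μ) (m : μ) (u : V) (l : List V)
    (w v : V) : memAfter.memAfterAux step m u (l ++ [w]) v =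
      step (memAfter.memAfterAux step m u l w) w v := by
  induction l generalizing m u with
  | nil => rfl
  | cons a l ih => simp [memAfter.memAfterAux, ih]

theorem memAfter_append {μ : Type} (init : μ) (step : μ → V → V → μ) (l : List V) (w v : V) :
    memAfter init step (l ++ [w]) v = step (memAfter init step l w) w v := by
  cases l with
  | nil => rfl
  | cons a l => simp [memAfter, memAfterAux_append]

theorem memAfter_map_range {μ : Type} (init : μ) (step : μ → V → V → μ) (ρ : ℕ → V) (k : ℕ) :
    memAfter init step ((List.range k).map ρ) (ρ k) = memSeq init step ρ k := by
  induction k with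
  | zero => rfl
  | succ k ih => rw [map_range_succ, memAfter_append, ih]; rfl

/-- A strategy that depends on a memory state and the current vertex only. -/
theorem exists_memory_strategy (A : Arena V) (i : Fin 2) {μ : Type} (init : μ)
    (step : μ → V → V → μ) (good : μ → V → V → Prop)  :
    ∃ σ : A.Strategy i, ∀ ρ, σ.Consistent ρ → ∀ k, A.owner (ρ k) = i →
      (∃ w, A.Edge (ρ k) w ∧ good (memSeq init step ρ k) (ρ k) w) →
      good (memSeq init step ρ k) (ρ k) (ρ (k + 1)) := by
  classical
  choose nx hnx using A.exists_edge
  refine ⟨⟨fun h v => if hw : ∃ w, A.Edge v w ∧ good (memAfter init step h v) v w then hw.choose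
    else nx v, fun h v _ => ?_⟩, fun ρ hc k ho hw => ?_⟩
  · split_ifs with hw
    · exact hw.choose_spec.1
    · exact hnx v
  · have h := hc k ho
    simp only [memAfter_map_range] at h
    rw [dif_pos hw] at h
    rw [h]
    exact hw.choose_spec.2

/-- Reaching a set of vertices. -/
def reach (D : Set V) : Set (ℕ → V) := {ρ | ∃ k, ρ k ∈ D}

/-- Cutting a history at the first visit of a set leaves the history of the tail that starts there;
a strategy for the tail can be fed with it. -/
theorem dropWhile_map_range (p : V → Bool) (ρ : ℕ → V) (k₀ : ℕ) (h0 : ∀ j < k₀, p (ρ j) = true)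
    (h1 : p (ρ k₀) = false) (i : ℕ) :
    ((List.range (k₀ + i + 1)).map ρ).dropWhile p =
      (List.range (i + 1)).map (fun j => ρ (k₀ + j)) := by
  have e : (List.range (k₀ + i + 1)).map ρ =
      (List.range k₀).map ρ ++ (List.range (i + 1)).map (fun j => ρ (k₀ + j)) := by
    rw [Nat.add_assoc, List.range_add, List.map_append, List.map_map]; rfl
  rw [e, List.dropWhile_append_of_pos]
  · rw [List.range_succ_eq_map]
    simp [h1]
  · intro a ha
    simp only [List.mem_map, List.mem_range] at ha
    obtain ⟨j, hj, rfl⟩ := ha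
    exact h0 j hj

/-- If the condition depends on tails only, it suffices to reach the winning region. -/
theorem winningRegion_of_reach (A : Arena V) (Win : Set (ℕ → V)) (D : Set V)
    (htail : ∀ (ρ : ℕ → V) (k : ℕ), (fun j => ρ (k + j)) ∈ Win → ρ ∈ Win)
    (hD : D ⊆ A.winningRegion Win 0) :
    A.winningRegion (Win ∪ reach D) 0 ⊆ A.winningRegion Win 0 := by
  classical
  rintro v ⟨σ, hσ⟩
  have hD' : ∀ u, ∃ τ : A.Strategy 0, u ∈ D → ∀ ρ, A.IsPlay ρ → ρ 0 = u → τ.Consistent ρ →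
      WonBy Win 0 ρ := by
    intro u
    by_cases hu : u ∈ D
    · obtain ⟨τ, hτ⟩ := hD hu
      exact ⟨τ, fun _ => hτ⟩
    · exact ⟨(nonempty_strategy A 0).some, fun h => absurd h hu⟩
  choose τ hτ using hD'
  -- The history from its first vertex in `D` on; it is empty as long as `D` has not been visited,
  -- and its head tells which strategy to use afterwards.
  let suff : List V → V → List V := fun h v => (h ++ [v]).dropWhile (fun u => decide (u ∉ D))
  let mv : List V → V → V := fun h v =>
    match suff h v with
    | [] => σ.move h v
    | x :: l => (τ x).move (x :: l).dropLast v
  refine ⟨⟨mv, fun h v ho => ?_⟩, fun ρ hp h0 hc => ?_⟩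
  · simp only [mv]
    split
    · exact σ.edge_move _ _ ho
    · exact (τ _).edge_move _ _ ho
  · simp only [WonBy, if_true]
    have hc' : ∀ k, A.owner (ρ k) = 0 → ρ (k + 1) = mv ((List.range k).map ρ) (ρ k) := hc
    have hs : ∀ k, suff ((List.range k).map ρ) (ρ k) =
        ((List.range (k + 1)).map ρ).dropWhile (fun u => decide (u ∉ D)) := by
      intro k; simp only [suff]; rw [map_range_succ]
    by_cases hr : ∃ k, ρ k ∈ D
    · set k₀ := Nat.find hr with hk₀
      have hk1 : ρ k₀ ∈ D := Nat.find_spec hr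
      have hk2 : ∀ j < k₀, ρ j ∉ D := fun j hj => Nat.find_min hr hj
      apply htail ρ k₀
      have := hτ (ρ k₀) hk1 (fun j => ρ (k₀ + j)) (fun j => hp (k₀ + j)) rfl (fun j hj => ?_)
      · simpa [WonBy] using this
      have h3 := hc' (k₀ + j) hj
      have h4 : suff ((List.range (k₀ + j)).map ρ) (ρ (k₀ + j)) =
          (List.range (j + 1)).map (fun j => ρ (k₀ + j)) := by
        rw [hs]
        exact dropWhile_map_range _ ρ k₀ (fun i hi => by simpa using hk2 i hi)
          (by simpa using hk1) j
      have h5 : (List.range (j + 1)).map (fun j => ρ (k₀ + j)) =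
          ρ k₀ :: (List.range j).map (fun i => ρ (k₀ + (i + 1))) := by
        rw [List.range_succ_eq_map]; simp [Function.comp_def]
      have h6 : mv ((List.range (k₀ + j)).map ρ) (ρ (k₀ + j)) =
          (τ (ρ k₀)).move ((List.range j).map (fun j => ρ (k₀ + j))) (ρ (k₀ + j)) := by
        have h7 := h4.trans h5
        simp only [mv]
        rw [h7]
        dsimp only
        rw [← h5, map_range_succ, List.dropLast_concat]
      rw [← h6, ← h3]; rfl
    · push Not at hr
      have := hσ ρ hp h0 (fun k ho => ?_)
      · simp only [WonBy, if_true] at this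
        rcases this with h | ⟨k, hk⟩
        · exact h
        · exact absurd hk (hr k)
      rw [hc' k ho]
      have : suff ((List.range k).map ρ) (ρ k) = [] := by
        rw [hs, List.dropWhile_eq_nil_iff]
        intro x hx
        simp only [List.mem_map] at hx
        obtain ⟨j, -, rfl⟩ := hx
        simpa using hr j
      simp only [mv]
      rw [this]

end Arena

/-- A sequence along a relation that visits `p` infinitely often. -/
theorem exists_seq_frequently {α : Type} (r : α → α → Prop) (p : α → Prop)
    (h : ∀ a, ∃ b, Relation.TransGen r a b ∧ p b) (a₀ : α) :
    ∃ s : ℕ → α, s 0 = a₀ ∧ (∀ n, r (s n) (s (n + 1))) ∧ ∃ᶠ n in atTop, p (s n) := by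
  classical
  -- `steps n a` says that `p` holds at some element reachable from `a` in exactly `n + 1` steps.
  let steps : ℕ → α → Prop := fun n =>
    Nat.rec (motive := fun _ => α → Prop) (fun a => ∃ b, r a b ∧ p b)
      (fun _ q a => ∃ b, r a b ∧ q b) n
  have hs : ∀ a, ∃ n, steps n a := by
    intro a
    obtain ⟨b, hb, pb⟩ := h a
    induction hb using Relation.TransGen.head_induction_on with
    | single hab => exact ⟨0, b, hab, pb⟩
    | head hab _ ih =>
      obtain ⟨n, hn⟩ := ih
      exact ⟨n + 1, _, hab, hn⟩
  -- Each move either hits `p` or decreases the distance to `p`, so `p` is hit again and again.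
  have hx : ∀ a : α, ∃ x : α, r a x ∧ (p x ∨ Nat.find (hs x) < Nat.find (hs a)) := by
    intro a
    have h1 := Nat.find_spec (hs a)
    rcases h2 : Nat.find (hs a) with _ | n
    · rw [h2] at h1
      obtain ⟨b, hb, pb⟩ := h1
      exact ⟨b, hb, Or.inl pb⟩
    · rw [h2] at h1
      obtain ⟨b, hb, hn⟩ := h1
      exact ⟨b, hb, Or.inr (Nat.lt_succ_of_le (Nat.find_min' _ hn))⟩
  choose g hg using hx
  refine ⟨fun n => g^[n] a₀, rfl, fun n => ?_, ?_⟩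
  · change r (g^[n] a₀) (g^[n + 1] a₀)
    rw [Function.iterate_succ_apply']
    exact (hg _).1
  · rw [frequently_atTop]
    have key : ∀ m N, Nat.find (hs (g^[N] a₀)) = m → ∃ b ≥ N, p (g^[b] a₀) := by
      intro m
      induction m using Nat.strong_induction_on with
      | _ m ih =>
        intro N hN
        rcases (hg (g^[N] a₀)).2 with h1 | h1
        · exact ⟨N + 1, by omega, by rw [Function.iterate_succ_apply']; exact h1⟩
        · obtain ⟨b, hb, pb⟩ := ih _ (hN ▸ h1) (N + 1) (by rw [Function.iterate_succ_apply'])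
          exact ⟨b, by omega, pb⟩
    exact fun N => key _ N rfl

/-! ### Streett games: bounding the number of requests between responses -/

namespace Arena

variable {V : Type} {d : ℕ}

/-- In the subarena `X`, Player `0` can force the next vertex to satisfy `G`. -/
def Force (A : Arena V) (X : Set V) (v : V) (G : V → Prop) : Prop :=
  (A.owner v = 0 → ∃ w ∈ X, A.Edge v w ∧ G w) ∧ (A.owner v ≠ 0 → ∀ w ∈ X, A.Edge v w → G w)

theorem Force.mono {A : Arena V} {X : Set V} {v : V} {G G' : V → Prop} (h : A.Force X v G)
    (hG : ∀ w ∈ X, G w → G' w) : A.Force X v G' :=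
  ⟨fun h0 => let ⟨w, hw, he, hg⟩ := h.1 h0; ⟨w, hw, he, hG w hw hg⟩,
    fun h0 w hw he => hG w hw (h.2 h0 w hw he)⟩

/-- Every vertex of `X` has a successor in `X`. -/
def IsSubarena (A : Arena V) (X : Set V) : Prop := ∀ v ∈ X, ∃ w ∈ X, A.Edge v w

end Arena

namespace StreettPairs

variable {V : Type} {d : ℕ}

open Classical in
/-- Counters of the requests since the last response, updated by a visit of `v`. -/
noncomputable def bump (Γ : StreettPairs d V) (v : V) (f : Fin d → ℕ) : Fin d → ℕ := fun c =>
  if v ∈ Γ.P c then 0 else if v ∈ Γ.Q c then f c + 1 else f c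

/-- A visit never increases the excess of one counter over another, and a response cancels it,
however large it was. -/
theorem bump_le_add (Γ : StreettPairs d V) {v : V} {f g : Fin d → ℕ} {c : Fin d} {b : ℕ}
    (h : v ∈ Γ.P c ∨ f c ≤ g c + b) : Γ.bump v f c ≤ Γ.bump v g c + b := by
  unfold bump; split_ifs with h1 h2
  · simp
  · have := h.resolve_left h1; omega
  · exact h.resolve_left h1

open Classical in
theorem bump_of_notMem (Γ : StreettPairs d V) {v : V} {f : Fin d → ℕ} {c : Fin d}
    (h : v ∉ Γ.P c) : Γ.bump v f c = if v ∈ Γ.Q c then f c + 1 else f c :=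
  if_neg h

theorem bump_zero_le (Γ : StreettPairs d V) (v : V) (c : Fin d) : Γ.bump v 0 c ≤ 1 := by
  unfold bump; split_ifs <;> simp

/-- A set of positions with counters in which Player `0` can stay, with all counters of pairs in
`S` bounded by `N`, until the play exits to `E`. -/
def IsBoundedInv (A : Arena V) (Γ : StreettPairs d V) (X : Set V) (S : Finset (Fin d)) (N : ℕ)
    (I E : Set (V × (Fin d → ℕ))) : Prop :=
  ∀ v f, (v, f) ∈ I → v ∈ X ∧ (∀ c ∈ S, Γ.bump v f c ≤ N) ∧
    A.Force X v (fun w => (w, Γ.bump v f) ∈ I ∪ E)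

/-- Positions in `T` with counters bounded by `N`. -/
def exits (Γ : StreettPairs d V) (S : Finset (Fin d)) (T : Set V) (N : ℕ) :
    Set (V × (Fin d → ℕ)) :=
  {x | x.1 ∈ T ∧ ∀ c ∈ S, x.1 ∈ Γ.P c ∨ x.2 c ≤ N}

/-- Player `0` can stay in `X` with bounded counters forever or until `T` is reached. -/
def BoundedWin (A : Arena V) (Γ : StreettPairs d V) (X : Set V) (S : Finset (Fin d)) (T : Set V)
    (v : V) : Prop :=
  ∃ N I, IsBoundedInv A Γ X S N I (exits Γ S T N) ∧ (v, 0) ∈ I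

/-- `I` with counters increased by at most `b`. -/
def slack (Γ : StreettPairs d V) (S : Finset (Fin d)) (b : ℕ) (I : Set (V × (Fin d → ℕ))) :
    Set (V × (Fin d → ℕ)) :=
  {x | ∃ f, (x.1, f) ∈ I ∧ ∀ c ∈ S, x.1 ∈ Γ.P c ∨ x.2 c ≤ f c + b}

variable {A : Arena V} {Γ : StreettPairs d V} {X : Set V} {S : Finset (Fin d)} {T : Set V}

theorem exits_mono {N N' : ℕ} (h : N ≤ N') : exits Γ S T N ⊆ exits Γ S T N' :=
  fun _ hx => ⟨hx.1, fun c hc => (hx.2 c hc).imp_right (·.trans h)⟩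

theorem slack_exits (N b : ℕ) : slack Γ S b (exits Γ S T N) ⊆ exits Γ S T (N + b) := by
  rintro ⟨v, f⟩ ⟨g, ⟨h1, h2⟩, h3⟩
  refine ⟨h1, fun c hc => ?_⟩
  rcases h2 c hc with h | h
  · exact Or.inl h
  · refine (h3 c hc).imp_right fun h' => h'.trans ?_
    simp only at h; omega

/-- Counters do not restrict the moves, so the moves for `g` also serve counters that exceed `g` by
at most `b`, and by `bump_le_add` the excess never grows. -/
theorem IsBoundedInv.slack {N : ℕ} {I E : Set (V × (Fin d → ℕ))}
    (h : IsBoundedInv A Γ X S N I E) (b : ℕ) :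
    IsBoundedInv A Γ X S (N + b) (slack Γ S b I) (slack Γ S b E) := by
  rintro v f ⟨g, hg, hfg⟩
  obtain ⟨h1, h2, h3⟩ := h v g hg
  have hb : ∀ c ∈ S, Γ.bump v f c ≤ Γ.bump v g c + b := fun c hc => bump_le_add Γ (hfg c hc)
  refine ⟨h1, fun c hc => (hb c hc).trans (Nat.add_le_add_right (h2 c hc) b), ?_⟩
  refine h3.mono fun w _ hw => ?_
  rcases hw with hw | hw
  · exact Or.inl ⟨_, hw, fun c hc => Or.inr (hb c hc)⟩
  · exact Or.inr ⟨_, hw, fun c hc => Or.inr (hb c hc)⟩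

/-- Player `0` follows `J` until the play enters a vertex with an invariant of its own and continues
with that one. She arrives there with counters up to `N₀` instead of `0`, hence the slack. As `V` is
finite, the sum of the individual bounds serves for all vertices. -/
theorem BoundedWin.combine [Finite V] (J : Set (V × (Fin d → ℕ))) (N₀ : ℕ)
    (hJ : ∀ v f, (v, f) ∈ J → v ∈ X ∧ (∀ c ∈ S, Γ.bump v f c ≤ N₀) ∧
      A.Force X v (fun w => (w, Γ.bump v f) ∈ J ∨ BoundedWin A Γ X S T w ∨ w ∈ T))
    (v : V) (hv : (v, 0) ∈ J) : BoundedWin A Γ X S T v := by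
  classical
  have := Fintype.ofFinite V
  have hc : ∀ w, ∃ N I, BoundedWin A Γ X S T w →
      IsBoundedInv A Γ X S N I (exits Γ S T N) ∧ (w, 0) ∈ I := by
    intro w
    by_cases hw : BoundedWin A Γ X S T w
    · obtain ⟨N, I, h⟩ := hw; exact ⟨N, I, fun _ => h⟩
    · exact ⟨0, ∅, fun h => absurd h hw⟩
  choose N I hI using hc
  have hN : ∀ w, N w ≤ ∑ w, N w := fun w =>
    Finset.single_le_sum (f := N) (fun _ _ => Nat.zero_le _) (Finset.mem_univ w)
  refine ⟨N₀ + ∑ w, N w,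
    J ∪ ⋃ w, ⋃ (_ : BoundedWin A Γ X S T w), StreettPairs.slack Γ S N₀ (I w), ?_, Or.inl hv⟩
  rintro u f (hu | hu)
  · obtain ⟨h1, h2, h3⟩ := hJ u f hu
    refine ⟨h1, fun c hc => (h2 c hc).trans (Nat.le_add_right _ _), h3.mono fun w hw hg => ?_⟩
    rcases hg with h | h | h
    · exact Or.inl (Or.inl h)
    · refine Or.inl (Or.inr (Set.mem_iUnion₂.2 ⟨w, h, 0, (hI w h).2, fun c hc => Or.inr ?_⟩))
      simpa using h2 c hc
    · exact Or.inr ⟨h, fun c hc => Or.inr ((h2 c hc).trans (Nat.le_add_right _ _))⟩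
  · obtain ⟨w, hw, hu⟩ := Set.mem_iUnion₂.1 hu
    obtain ⟨h1, h2, h3⟩ := (hI w hw).1.slack N₀ u f hu
    refine ⟨h1, fun c hc => (h2 c hc).trans (by have := hN w; omega), h3.mono fun x _ hx => ?_⟩
    rcases hx with h | h
    · exact Or.inl (Or.inr (Set.mem_iUnion₂.2 ⟨w, hw, h⟩))
    · exact Or.inr (exits_mono (by have := hN w; omega) (slack_exits _ _ h))

/-- The good vertices absorb every vertex from which Player `0` can force the next move into them; a
single visit raises a counter to at most `1`. -/
theorem BoundedWin.step [Finite V] {v : V} (hv : v ∈ X)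
    (h : A.Force X v (fun w => BoundedWin A Γ X S T w ∨ w ∈ T)) : BoundedWin A Γ X S T v := by
  refine BoundedWin.combine {(v, 0)} 1 ?_ v rfl
  rintro u f hu
  obtain ⟨rfl, rfl⟩ := Prod.mk.inj (Set.mem_singleton_iff.1 hu)
  exact ⟨hv, fun c _ => bump_zero_le Γ u c, h.mono fun w _ hw => Or.inr hw⟩

/-- A strategy given as a set of positions with histories. -/
def IsStrategyTree (A : Arena V) (Γ : StreettPairs d V) (X : Set V) (S : Finset (Fin d))
    (H : Set (V × List V)) : Prop :=
  (∀ a ∈ H, a.1 ∈ X ∧ A.Force X a.1 (fun w => (w, a.1 :: a.2) ∈ H)) ∧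
  ∀ s : ℕ → V × List V, (∀ n, s n ∈ H) →
    (∀ n, A.Edge (s n).1 (s (n + 1)).1 ∧ (s (n + 1)).2 = (s n).1 :: (s n).2) →
    ∀ c ∈ S, (∃ᶠ n in atTop, (s n).1 ∈ Γ.Q c) → ∃ᶠ n in atTop, (s n).1 ∈ Γ.P c

/-- Player `0` wins from `v` in the subarena `X` with respect to the pairs in `S`. -/
def TreeWin (A : Arena V) (Γ : StreettPairs d V) (X : Set V) (S : Finset (Fin d)) (v : V) :
    Prop :=
  ∃ H, IsStrategyTree A Γ X S H ∧ ∃ l, (v, l) ∈ H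

/-- If Player `0` can win with bounded counters wherever she wins in the rest, there is no rest. -/
theorem boundedWin_or_mem [Finite V] (hX : A.IsSubarena X) (hW : ∀ v ∈ X, TreeWin A Γ X S v)
    (ih : ∀ Y ⊆ X, Y = {v ∈ X | ¬ (BoundedWin A Γ X S T v ∨ v ∈ T)} → A.IsSubarena Y →
      (∀ v ∈ Y, TreeWin A Γ Y S v) → ∀ v ∈ Y, BoundedWin A Γ Y S ∅ v) :
    ∀ v ∈ X, BoundedWin A Γ X S T v ∨ v ∈ T := by
  classical
  have := Fintype.ofFinite V
  set Y := {v ∈ X | ¬ (BoundedWin A Γ X S T v ∨ v ∈ T)} with hY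
  -- A vertex of Player `0` with an edge into the good set is good itself. So she cannot leave `Y`,
  -- and her strategies restrict to it.
  have h0 : ∀ v ∈ Y, A.owner v = 0 → ∀ w ∈ X, A.Edge v w → w ∈ Y := by
    intro v hv ho w hw he
    refine ⟨hw, fun h => hv.2 (Or.inl (BoundedWin.step hv.1
      ⟨fun _ => ⟨w, hw, he, h⟩, fun h => absurd ho h⟩))⟩
  have h1 : A.IsSubarena Y := by
    intro v hv
    by_cases ho : A.owner v = 0
    · obtain ⟨w, hw, he⟩ := hX v hv.1
      exact ⟨w, h0 v hv ho w hw he, he⟩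
    · by_contra hcon
      push Not at hcon
      refine hv.2 (Or.inl (BoundedWin.step hv.1 ⟨fun h => absurd h ho, fun _ w hw he => ?_⟩))
      by_contra h
      exact hcon w ⟨hw, h⟩ he
  have h2 : ∀ v ∈ Y, TreeWin A Γ Y S v := by
    intro v hv
    obtain ⟨H, ⟨hH1, hH2⟩, l, hl⟩ := hW v hv.1
    refine ⟨{a ∈ H | a.1 ∈ Y}, ⟨?_, fun s hs => hH2 s fun n => (hs n).1⟩, l, hl, hv⟩
    rintro a ⟨ha, haY⟩
    refine ⟨haY, fun ho => ?_, fun ho w hw he => ⟨(hH1 a ha).2.2 ho w hw.1 he, hw⟩⟩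
    obtain ⟨w, hw, he, hg⟩ := (hH1 a ha).2.1 ho
    have := h0 _ haY ho w hw he
    exact ⟨w, this, he, hg, this⟩
  have h3 := ih Y (fun v hv => hv.1) rfl h1 h2
  intro v hv
  by_contra hcon
  have hvY : v ∈ Y := ⟨hv, hcon⟩
  obtain ⟨N, I, hI, hv0⟩ := h3 v hvY
  -- Only Player `1` can leave `Y`, and then the play is in a good vertex or in `T`.
  refine hcon (Or.inl (BoundedWin.combine I N ?_ v hv0))
  intro u f hu
  obtain ⟨a1, a2, a3⟩ := hI u f hu
  have nE : ∀ x, x ∉ exits Γ S (∅ : Set V) N := fun x hx => hx.1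
  refine ⟨a1.1, a2, fun ho => ?_, fun ho w hw he => ?_⟩
  · obtain ⟨w, hw, he, hg⟩ := a3.1 ho
    exact ⟨w, hw.1, he, Or.inl (hg.resolve_right (nE _))⟩
  · by_cases hwY : w ∈ Y
    · exact Or.inl ((a3.2 ho w hwY he).resolve_right (nE _))
    · refine Or.inr ?_
      by_contra h
      exact hwY ⟨hw, h⟩

/-- If the responses of a pair are missing, some vertices admit winning without its requests. -/
theorem exists_boundedWin_of_no_response [Finite V] (hX : A.IsSubarena X) {x : V}
    (hW : TreeWin A Γ X S x) {c : Fin d} (hc : c ∈ S) (hP : ∀ v ∈ X, v ∉ Γ.P c)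
    (ih : ∀ U ⊆ X, A.IsSubarena U → (∀ v ∈ U, TreeWin A Γ U (S.erase c) v) →
      ∀ v ∈ U, BoundedWin A Γ U (S.erase c) ∅ v) :
    ∃ v ∈ X, BoundedWin A Γ X S ∅ v := by
  classical
  obtain ⟨H, ⟨hH1, hH2⟩, l, hl⟩ := hW
  let r : H → H → Prop := fun a b => A.Edge a.1.1 b.1.1 ∧ b.1.2 = a.1.1 :: a.1.2
  have hstep : ∀ a : H, ∃ b, r a b := by
    rintro ⟨a, ha⟩
    obtain ⟨h1, h2, h3⟩ := hH1 a ha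
    by_cases ho : A.owner a.1 = 0
    · obtain ⟨w, hw, he, hg⟩ := h2 ho
      exact ⟨⟨_, hg⟩, he, rfl⟩
    · obtain ⟨w, hw, he⟩ := hX a.1 h1
      exact ⟨⟨_, h3 ho w hw he⟩, he, rfl⟩
  -- Otherwise a later request of `c` could be reached from every node of the strategy tree. This
  -- would give a branch with infinitely many requests of `c`, and `X` contains no response.
  have hex : ∃ a : H, ∀ b, Relation.TransGen r a b → b.1.1 ∉ Γ.Q c := by
    by_contra hcon
    push Not at hcon
    obtain ⟨s, -, hs, hf⟩ := exists_seq_frequently r (fun b => b.1.1 ∈ Γ.Q c) hcon ⟨_, hl⟩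
    have := hH2 (fun n => (s n).1) (fun n => (s n).2) (fun n => hs n) c hc hf
    obtain ⟨n, hn⟩ := this.exists
    exact hP _ (hH1 _ (s n).2).1 hn
  obtain ⟨a, ha⟩ := hex
  -- The vertices strictly below such a node: they make no request of `c`, and Player `1` cannot
  -- leave them. So `c` may be dropped there.
  set U : Set V := {v | ∃ b : H, Relation.TransGen r a b ∧ b.1.1 = v} with hU
  have hUX : U ⊆ X := by
    rintro v ⟨b, -, rfl⟩
    exact (hH1 _ b.2).1
  have hUQ : ∀ v ∈ U, v ∉ Γ.Q c := by
    rintro v ⟨b, hb, rfl⟩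
    exact ha b hb
  have hU1 : A.IsSubarena U := by
    rintro v ⟨b, hb, rfl⟩
    obtain ⟨b', hb'⟩ := hstep b
    exact ⟨b'.1.1, ⟨b', hb.tail hb', rfl⟩, hb'.1⟩
  have hU2 : ∀ v ∈ U, A.owner v ≠ 0 → ∀ w ∈ X, A.Edge v w → w ∈ U := by
    rintro v ⟨b, hb, rfl⟩ ho w hw he
    have := (hH1 _ b.2).2.2 ho w hw he
    exact ⟨⟨_, this⟩, hb.tail ⟨he, rfl⟩, rfl⟩
  have hU3 : ∀ v ∈ U, TreeWin A Γ U (S.erase c) v := by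
    rintro v ⟨b, hb, rfl⟩
    refine ⟨{y | ∃ b : H, Relation.TransGen r a b ∧ b.1 = y}, ⟨?_, ?_⟩, b.1.2, b, hb, rfl⟩
    · rintro _ ⟨b, hb, rfl⟩
      refine ⟨⟨b, hb, rfl⟩, fun ho => ?_, fun ho w hw he => ?_⟩
      · obtain ⟨w, hw, he, hg⟩ := (hH1 _ b.2).2.1 ho
        exact ⟨w, ⟨⟨_, hg⟩, hb.tail ⟨he, rfl⟩, rfl⟩, he, ⟨_, hg⟩, hb.tail ⟨he, rfl⟩, rfl⟩
      · exact ⟨⟨_, (hH1 _ b.2).2.2 ho w (hUX hw) he⟩, hb.tail ⟨he, rfl⟩, rfl⟩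
    · intro s hs hr c' hc'
      refine hH2 s (fun n => ?_) hr c' (Finset.mem_of_mem_erase hc')
      obtain ⟨b, -, hb⟩ := hs n
      exact hb ▸ b.2
  have hne : ∃ u, u ∈ U := by
    obtain ⟨b, hb⟩ := hstep a
    exact ⟨_, b, Relation.TransGen.single hb, rfl⟩
  obtain ⟨u, hu⟩ := hne
  obtain ⟨N, I, hI, hu0⟩ := ih U hUX hU1 hU3 u hu
  -- Without requests of `c`, the counter of `c` stays `0` if it starts there.
  refine ⟨u, hUX hu, N, {y ∈ I | y.2 c = 0}, ?_, hu0, rfl⟩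
  rintro v f ⟨hvI, hf⟩
  obtain ⟨h1, h2, h3⟩ := hI v f hvI
  have hb : Γ.bump v f c = 0 := by
    unfold bump
    rw [if_neg (hUQ v h1)]; split_ifs; exacts [rfl, hf]
  refine ⟨hUX h1, fun c' hc' => ?_, fun ho => ?_, fun ho w hw he => ?_⟩
  · by_cases h : c' = c
    · subst h; rw [hb]; exact Nat.zero_le _
    · exact h2 c' (Finset.mem_erase.2 ⟨h, hc'⟩)
  · obtain ⟨w, hw, he, hg⟩ := h3.1 ho
    exact ⟨w, hUX hw, he, Or.inl ⟨hg.resolve_right (fun h => h.1), hb⟩⟩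
  · exact Or.inl ⟨(h3.2 ho w (hU2 v h1 ho w hw he) he).resolve_right (fun h => h.1), hb⟩

/-- Cycling through the responses keeps all counters bounded. -/
theorem boundedWin_of_cycle [Finite V] (hX : A.IsSubarena X)
    (h : ∀ c ∈ S, ∀ v ∈ X, BoundedWin A Γ X S (Γ.P c) v) :
    ∀ v ∈ X, BoundedWin A Γ X S ∅ v := by
  classical
  have := Fintype.ofFinite V
  choose! N I hI using h
  have hfull : ∀ v ∈ X, ∀ G : V → Prop, (∀ w ∈ X, G w) → A.Force X v G := by
    intro v hv G hG
    refine ⟨fun _ => ?_, fun _ w hw _ => hG w hw⟩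
    obtain ⟨w, hw, he⟩ := hX v hv
    exact ⟨w, hw, he, hG w hw⟩
  rcases S.eq_empty_or_nonempty with rfl | hS
  · intro v hv
    refine ⟨0, {y | y.1 ∈ X}, ?_, hv⟩
    intro u f hu
    exact ⟨hu, by simp, hfull u hu _ fun w hw => Or.inl hw⟩
  set M : ℕ := ∑ c ∈ S, ∑ w, N c w with hM
  have hNM : ∀ c ∈ S, ∀ w, N c w ≤ M := fun c hc w =>
    (Finset.single_le_sum (f := N c) (fun _ _ => Nat.zero_le _) (Finset.mem_univ w)).trans
      (Finset.single_le_sum (f := fun c => ∑ w, N c w) (fun _ _ => Nat.zero_le _) hc)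
  set k := S.card with hk
  have hk0 : 0 < k := Finset.card_pos.2 hS
  let e := S.equivFin
  let ix : Fin d → ℕ := fun c => if hc : c ∈ S then (e ⟨c, hc⟩ : ℕ) else 0
  have hix : ∀ c (hc : c ∈ S), ix c = e ⟨c, hc⟩ := fun c hc => dif_pos hc
  have hinj : ∀ c ∈ S, ∀ c' ∈ S, ix c = ix c' → c = c' := by
    intro c hc c' hc' hh
    rw [hix c hc, hix c' hc'] at hh
    have := e.injective (Fin.ext hh)
    exact congrArg Subtype.val this
  have hlt : ∀ c ∈ S, ix c < k := fun c hc => by rw [hix c hc]; exact (e ⟨c, hc⟩).2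
  have hsurj : ∀ j < k, ∃ c ∈ S, ix c = j := by
    intro j hj
    refine ⟨(e.symm ⟨j, hj⟩).1, (e.symm ⟨j, hj⟩).2, ?_⟩
    rw [hix _ (e.symm ⟨j, hj⟩).2]; simp
  -- The pairs are numbered `0, …, k - 1`, and stage `j` aims at a response of pair `j`; a stage
  -- adds at most `M` to any counter. During stage `j`, counter `i` was reset in the current round
  -- if `i < j`, and otherwise at the latest in the previous one; `B i j` bounds what accumulated in
  -- earlier stages.
  let B : ℕ → ℕ → ℕ := fun i j => if i < j then M * j else M * (j + k)
  have hBk : ∀ i j, j < k → B i j ≤ M * (2 * k) := by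
    intro i j hj
    simp only [B]; split_ifs <;> exact Nat.mul_le_mul_left _ (by omega)
  have hB1 : ∀ i j, i ≠ j → M + B i j ≤ B i (j + 1) := by
    intro i j hij
    simp only [B]; split_ifs <;> first | omega | nlinarith
  have hB2 : ∀ i, i < k → i ≠ k - 1 → M + B i (k - 1) ≤ B i 0 := by
    intro i hi hij
    have hi' : i < k - 1 := by omega
    have e1 : M * k = M * (k - 1) + M := by
      conv_lhs => rw [show k = (k - 1) + 1 by omega]
      ring
    simp only [B, if_pos hi', Nat.not_lt_zero, if_false, Nat.zero_add]
    omega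
  -- The stage that belongs to `c` is being played with the invariant `I c w`, and the true counters
  -- exceed those of the invariant by at most `B`.
  let J : Set (V × (Fin d → ℕ)) := {y | y.1 ∈ X ∧ ∃ c ∈ S, ∃ w ∈ X, ∃ f, (y.1, f) ∈ I c w ∧
    ∀ c' ∈ S, y.1 ∈ Γ.P c' ∨ y.2 c' ≤ f c' + B (ix c') (ix c)}
  intro v hv
  refine ⟨M + M * (2 * k), J, ?_, hv, ?_⟩
  · rintro u f ⟨hu, c, hc, w, hw, g, hg, hfg⟩
    obtain ⟨a1, a2, a3⟩ := (hI c hc w hw).1 u g hg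
    have hb : ∀ c' ∈ S, Γ.bump u f c' ≤ Γ.bump u g c' + B (ix c') (ix c) :=
      fun c' hc' => bump_le_add Γ (hfg c' hc')
    refine ⟨hu, fun c' hc' => ?_, a3.mono fun x hx hxg => Or.inl ⟨hx, ?_⟩⟩
    · have := hb c' hc'
      have := a2 c' hc'
      have := hNM c hc w
      have := hBk (ix c') (ix c) (hlt c hc)
      omega
    · rcases hxg with hxg | ⟨hxP, hxg⟩
      · exact ⟨c, hc, w, hw, _, hxg, fun c' hc' => Or.inr (hb c' hc')⟩
      · have key : ∀ c₁ ∈ S, (∀ i < k, i ≠ ix c → M + B i (ix c) ≤ B i (ix c₁)) →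
            ∃ c ∈ S, ∃ w ∈ X, ∃ f', (x, f') ∈ I c w ∧
              ∀ c' ∈ S, x ∈ Γ.P c' ∨ Γ.bump u f c' ≤ f' c' + B (ix c') (ix c) := by
          intro c₁ hc₁ hB
          refine ⟨c₁, hc₁, x, hx, 0, (hI c₁ hc₁ x hx).2, fun c' hc' => ?_⟩
          rcases hxg c' hc' with h' | h'
          · exact Or.inl h'
          · by_cases hcc : ix c' = ix c
            · rw [hinj c' hc' c hc hcc]; exact Or.inl hxP
            · right
              have h1 := hb c' hc'
              have h2 := hNM c hc w
              have h3 := hB (ix c') (hlt c' hc') hcc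
              simp only at h'
              simp only [Pi.zero_apply]
              omega
        by_cases hlast : ix c = k - 1
        · obtain ⟨c₁, hc₁, hi⟩ := hsurj 0 hk0
          refine key c₁ hc₁ fun i hi' hne => ?_
          rw [hi, hlast]; exact hB2 i hi' (hlast ▸ hne)
        · obtain ⟨c₁, hc₁, hi⟩ := hsurj (ix c + 1) (by have := hlt c hc; omega)
          refine key c₁ hc₁ fun i hi' hne => ?_
          rw [hi]; exact hB1 i _ hne
  · obtain ⟨c, hc⟩ := hS
    exact ⟨c, hc, v, hv, 0, (hI c hc v hv).2, fun c' _ => Or.inr (by simp)⟩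

/-- Induction on the number of vertices plus the number of pairs. If some vertex is good, that is,
admits play with bounded counters, removing all good vertices leaves a smaller arena that is good by
induction, so everything is good. If some pair has no response in `X`, it can be dropped in a part
of `X`, which yields a good vertex. Otherwise, the first argument with the responses of `c` as
target shows that from everywhere Player `0` can force a response of `c`, or stay bounded forever;
she cycles through the pairs. -/
theorem boundedWin_of_treeWin [Finite V] (A : Arena V) (Γ : StreettPairs d V) (k : ℕ) :
    ∀ (X : Set V) (S : Finset (Fin d)), X.ncard + S.card ≤ k → A.IsSubarena X →
      (∀ v ∈ X, TreeWin A Γ X S v) → ∀ v ∈ X, BoundedWin A Γ X S ∅ v := by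
  induction k with
  | zero =>
    intro X S hk _ _ v hv
    have : X = ∅ := (Set.ncard_eq_zero (Set.toFinite X)).1 (by omega)
    exact absurd hv (this ▸ Set.notMem_empty v)
  | succ k ih =>
    intro X S hk hX hW
    have small : ∀ T : Set V, (∃ v ∈ X, BoundedWin A Γ X S T v ∨ v ∈ T) →
        ∀ v ∈ X, BoundedWin A Γ X S T v ∨ v ∈ T := by
      rintro T ⟨v, hv, hvT⟩
      refine boundedWin_or_mem hX hW fun Y hYX hY hY1 hY2 => ih Y S ?_ hY1 hY2
      have : Y ⊂ X := by
        refine ⟨hYX, fun h => ?_⟩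
        have := h hv
        rw [hY] at this
        exact this.2 hvT
      have := Set.ncard_lt_ncard this (Set.toFinite X)
      omega
    by_cases hg : ∃ v ∈ X, BoundedWin A Γ X S ∅ v
    · obtain ⟨v, hv, hvg⟩ := hg
      intro u hu
      exact (small ∅ ⟨v, hv, Or.inl hvg⟩ u hu).resolve_right (fun h => h)
    · by_cases hP : ∃ c ∈ S, ∀ v ∈ X, v ∉ Γ.P c
      · obtain ⟨c, hc, hcP⟩ := hP
        intro v hv
        refine absurd (exists_boundedWin_of_no_response hX (hW v hv) hc hcP ?_) hg
        intro U hU hU1 hU2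
        refine ih U (S.erase c) ?_ hU1 hU2
        have h1 := Finset.card_erase_lt_of_mem hc
        have h2 := Set.ncard_le_ncard hU (Set.toFinite X)
        omega
      · push Not at hP
        refine boundedWin_of_cycle hX fun c hc v hv => ?_
        obtain ⟨x, hx, hxP⟩ := hP c hc
        have h1 := small (Γ.P c) ⟨x, hx, Or.inr hxP⟩
        refine BoundedWin.step hv ⟨fun _ => ?_, fun _ w hw _ => h1 w hw⟩
        obtain ⟨w, hw, he⟩ := hX v hv
        exact ⟨w, hw, he, h1 w hw⟩

/-- From the winning region of a Streett game, Player `0` can bound the number of requests between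
responses. -/
theorem exists_boundedInv [Finite V] (A : Arena V) (Γ : StreettPairs d V) (v : V)
    (hv : v ∈ A.winningRegion Γ.streett 0) :
    ∃ N I, IsBoundedInv A Γ Set.univ Finset.univ N I ∅ ∧ (v, 0) ∈ I := by
  classical
  obtain ⟨σ, hσ⟩ := hv
  -- One move consistent with `σ`; histories are stored in reverse.
  let r : V × List V → V × List V → Prop := fun a b => A.Edge a.1 b.1 ∧ b.2 = a.1 :: a.2 ∧
    (A.owner a.1 = 0 → b.1 = σ.move a.2.reverse a.1)
  set H : Set (V × List V) := {a | Relation.ReflTransGen r (v, []) a} with hH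
  set X : Set V := Prod.fst '' H with hXdef
  have htree : IsStrategyTree A Γ X Finset.univ H := by
    constructor
    · intro a ha
      refine ⟨⟨a, ha, rfl⟩, fun ho => ?_, fun ho w _ he => ?_⟩
      · have he := σ.edge_move a.2.reverse a.1 ho
        have h1 : (σ.move a.2.reverse a.1, a.1 :: a.2) ∈ H :=
          Relation.ReflTransGen.tail ha ⟨he, rfl, fun _ => rfl⟩
        exact ⟨_, ⟨_, h1, rfl⟩, he, h1⟩
      · exact Relation.ReflTransGen.tail ha ⟨he, rfl, fun h => absurd h ho⟩
    · intro s hs hr c _ hq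
      have hrs : ∀ n, r (s n) (s (n + 1)) := by
        intro n
        refine ⟨(hr n).1, (hr n).2, ?_⟩
        -- The history of a node determines its predecessor, so every branch of the tree consists of
        -- moves consistent with `σ`.
        rcases Relation.ReflTransGen.cases_tail (hs (n + 1)) with h | ⟨b, -, hb⟩
        · have := (hr n).2
          rw [h] at this
          simp at this
        · have h1 := hb.2.1.symm.trans (hr n).2
          obtain ⟨h2, h3⟩ := List.cons.inj h1
          have h4 : b = s n := Prod.ext h2 h3
          exact h4 ▸ hb.2.2
      -- A branch may start anywhere in the tree, whereas `σ` speaks of plays from `v`; the path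
      -- from the root is prepended.
      have hpre : ∀ a, Relation.ReflTransGen r a (s 0) →
          ∃ (s' : ℕ → V × List V) (k : ℕ), s' 0 = a ∧ (∀ n, r (s' n) (s' (n + 1))) ∧
            ∀ n, s' (k + n) = s n := by
        intro a ha
        induction ha using Relation.ReflTransGen.head_induction_on with
        | refl => exact ⟨s, 0, rfl, hrs, fun n => by rw [Nat.zero_add]⟩
        | @head a b hab _ ih =>
          obtain ⟨s', k, h0, h1, h2⟩ := ih
          refine ⟨fun n => Nat.casesOn n a s', k + 1, rfl, fun n => ?_, fun n => ?_⟩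
          · cases n with
            | zero => simpa [h0] using hab
            | succ n => exact h1 n
          · rw [Nat.add_right_comm]; exact h2 n
      obtain ⟨s', k, h0, h1, h2⟩ := hpre _ (hs 0)
      have hhist : ∀ n, (s' n).2.reverse = (List.range n).map (fun n => (s' n).1) := by
        intro n
        induction n with
        | zero => simp [h0]
        | succ n ih => rw [(h1 n).2.1, List.reverse_cons, ih, Arena.map_range_succ]
      have hwin := hσ (fun n => (s' n).1) (fun n => (h1 n).1) (by simp [h0]) (fun n hn => by
        have := (h1 n).2.2 hn
        rw [hhist] at this
        exact this)
      simp only [Arena.WonBy, if_true] at hwin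
      have h3 := hwin c
      rw [← frequently_add_left_iff _ k, ← frequently_add_left_iff (fun n => (s' n).1 ∈ Γ.P c) k]
        at h3
      simp only [h2] at h3
      exact h3 hq
  have hsub : A.IsSubarena X := by
    rintro _ ⟨a, ha, rfl⟩
    by_cases ho : A.owner a.1 = 0
    · have he := σ.edge_move a.2.reverse a.1 ho
      exact ⟨_, ⟨(_, a.1 :: a.2), Relation.ReflTransGen.tail ha ⟨he, rfl, fun _ => rfl⟩, rfl⟩, he⟩
    · obtain ⟨w, he⟩ := A.exists_edge a.1
      exact ⟨w, ⟨(_, a.1 :: a.2),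
        Relation.ReflTransGen.tail ha ⟨he, rfl, fun h => absurd h ho⟩, rfl⟩, he⟩
  have htrap : ∀ x ∈ X, A.owner x ≠ 0 → ∀ w, A.Edge x w → w ∈ X := by
    rintro _ ⟨a, ha, rfl⟩ ho w he
    exact ⟨(_, a.1 :: a.2), Relation.ReflTransGen.tail ha ⟨he, rfl, fun h => absurd h ho⟩, rfl⟩
  have hvX : v ∈ X := ⟨_, Relation.ReflTransGen.refl, rfl⟩
  obtain ⟨N, I, hI, hv0⟩ := boundedWin_of_treeWin A Γ _ X Finset.univ le_rfl hsub
    (by rintro _ ⟨a, ha, rfl⟩; exact ⟨H, htree, a.2, ha⟩) v hvX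
  refine ⟨N, I, fun u f hu => ?_, hv0⟩
  obtain ⟨a1, a2, a3⟩ := hI u f hu
  refine ⟨trivial, a2, fun ho => ?_, fun ho w _ he => ?_⟩
  · obtain ⟨w, -, he, hg⟩ := a3.1 ho
    exact ⟨w, trivial, he, Or.inl (hg.resolve_right fun h => h.1)⟩
  · exact Or.inl ((a3.2 ho w (htrap u a1 ho w he) he).resolve_right fun h => h.1)

end StreettPairs

namespace StreettPairs

variable {V : Type} {d : ℕ}

/-! ### Costs of infixes -/

section Costs

variable (Γ : StreettPairs d V) (Cst : CostFunctions d V) (c : Fin d) (ρ : ℕ → V)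

theorem infixCost_self (k : ℕ) : infixCost Cst c ρ k k = 0 := by
  have : {j | k ≤ j ∧ j < k ∧ Cst c (ρ j) (ρ (j + 1)) = CostLabel.inc} = ∅ := by
    ext j; simp only [Set.mem_ofPred_eq, Set.mem_empty_iff_false, iff_false]; omega
  rw [infixCost, this, Set.ncard_empty]

open Classical in
theorem infixCost_succ {k l : ℕ} (h : k ≤ l) : infixCost Cst c ρ k (l + 1) =
    infixCost Cst c ρ k l + if Cst c (ρ l) (ρ (l + 1)) = CostLabel.inc then 1 else 0 := by
  have hfin : {j | k ≤ j ∧ j < l ∧ Cst c (ρ j) (ρ (j + 1)) = CostLabel.inc}.Finite :=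
    (Set.finite_lt_nat l).subset fun j hj => hj.2.1
  unfold infixCost
  split_ifs with hi
  · rw [← Set.ncard_insert_of_notMem (a := l) (fun h => lt_irrefl _ h.2.1) hfin]
    congr 1; ext j
    simp only [Set.mem_ofPred_eq, Set.mem_insert_iff]
    constructor
    · rintro ⟨h1, h2, h3⟩
      rcases Nat.lt_succ_iff_lt_or_eq.1 h2 with h4 | h4
      · exact Or.inr ⟨h1, h4, h3⟩
      · exact Or.inl h4
    · rintro (rfl | ⟨h1, h2, h3⟩)
      · exact ⟨h, by omega, hi⟩
      · exact ⟨h1, by omega, h3⟩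
  · rw [Nat.add_zero]
    congr 1; ext j
    simp only [Set.mem_ofPred_eq]
    constructor
    · rintro ⟨h1, h2, h3⟩
      rcases Nat.lt_succ_iff_lt_or_eq.1 h2 with h4 | h4
      · exact ⟨h1, h4, h3⟩
      · exact absurd (h4 ▸ h3) hi
    · rintro ⟨h1, h2, h3⟩
      exact ⟨h1, by omega, h3⟩

theorem infixCost_mono {k l l' : ℕ} (h : k ≤ l) (h' : l ≤ l') :
    infixCost Cst c ρ k l ≤ infixCost Cst c ρ k l' := by
  induction l', h' using Nat.le_induction with
  | base => exact le_rfl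
  | succ n hn ih => rw [infixCost_succ Cst c ρ (h.trans hn)]; omega

theorem infixCost_shift (r k l : ℕ) :
    infixCost Cst c (fun j => ρ (r + j)) k l = infixCost Cst c ρ (r + k) (r + l) := by
  unfold infixCost
  rw [← Set.ncard_image_of_injective _ (add_right_injective r)]
  congr 1; ext j
  simp only [Set.mem_image, Set.mem_ofPred_eq]
  constructor
  · rintro ⟨i, ⟨h1, h2, h3⟩, rfl⟩
    exact ⟨by omega, by omega, h3⟩
  · rintro ⟨h1, h2, h3⟩
    obtain ⟨i, rfl⟩ := Nat.exists_eq_add_of_le (show r ≤ j by omega)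
    exact ⟨i, ⟨by omega, by omega, h3⟩, rfl⟩

theorem infixCost_congr {ρ' : ℕ → V} {k l : ℕ} (h : ∀ j, k ≤ j → j ≤ l → ρ j = ρ' j) :
    infixCost Cst c ρ k l = infixCost Cst c ρ' k l := by
  unfold infixCost
  congr 1; ext j
  simp only [Set.mem_ofPred_eq]
  constructor <;> rintro ⟨h1, h2, h3⟩ <;> refine ⟨h1, h2, ?_⟩
  · rw [← h j h1 h2.le, ← h (j + 1) (by omega) h2]; exact h3
  · rw [h j h1 h2.le, h (j + 1) (by omega) h2]; exact h3

theorem exists_le_infixCost (h : ∃ᶠ j in atTop, Cst c (ρ j) (ρ (j + 1)) = CostLabel.inc)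
    (k b : ℕ) : ∃ l ≥ k, b ≤ infixCost Cst c ρ k l := by
  induction b with
  | zero => exact ⟨k, le_rfl, Nat.zero_le _⟩
  | succ b ih =>
    obtain ⟨l, hl, hb⟩ := ih
    obtain ⟨j, hj, hi⟩ := (frequently_atTop.1 h) l
    refine ⟨j + 1, by omega, ?_⟩
    rw [infixCost_succ Cst c ρ (hl.trans hj), if_pos hi]
    have := infixCost_mono Cst c ρ hl hj
    omega

variable {Γ Cst c ρ}

theorem stCorAt_eq_top_iff {k : ℕ} :
    Γ.stCorAt Cst c ρ k = ⊤ ↔ ρ k ∈ Γ.Q c ∧ ∀ l ≥ k, ρ l ∉ Γ.P c := by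
  unfold stCorAt
  split_ifs with h
  · simp only [iInf_eq_top, ENat.natCast_ne_top, imp_false, h, true_and]
    exact ⟨fun h l hl hP => h l ⟨hl, hP⟩, fun h l hl => h l hl.1 hl.2⟩
  · simp [h]

/-- An open request has already incurred the cost of the infix up to the present position, whether
or not it will be answered. -/
theorem le_stCorAt {k l : ℕ} (hk : k ≤ l) (hQ : ρ k ∈ Γ.Q c)
    (hP : ∀ i, k ≤ i → i < l → ρ i ∉ Γ.P c) :
    (infixCost Cst c ρ k l : ℕ∞) ≤ Γ.stCorAt Cst c ρ k := by
  unfold stCorAt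
  rw [if_pos hQ]
  refine le_iInf₂ fun j hj => ?_
  have : l ≤ j := by
    by_contra h
    exact hP j hj.1 (by omega) hj.2
  exact_mod_cast infixCost_mono Cst c ρ hk this

theorem stCorAt_le {k : ℕ} {N : ℕ} (hex : ρ k ∈ Γ.Q c → ∃ l ≥ k, ρ l ∈ Γ.P c)
    (hN : ∀ l ≥ k, ρ k ∈ Γ.Q c → (∀ i, k ≤ i → i < l → ρ i ∉ Γ.P c) →
      infixCost Cst c ρ k l ≤ N) : Γ.stCorAt Cst c ρ k ≤ N := by
  classical
  unfold stCorAt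
  split_ifs with h
  · have hl := Nat.find_spec (hex h)
    refine (iInf₂_le (Nat.find (hex h)) hl).trans ?_
    exact_mod_cast hN _ hl.1 h fun i hi hil hP => Nat.find_min (hex h) hil ⟨hi, hP⟩
  · simp

theorem stCorAt_shift (r k : ℕ) :
    Γ.stCorAt Cst c (fun j => ρ (r + j)) k = Γ.stCorAt Cst c ρ (r + k) := by
  unfold stCorAt
  split_ifs with h
  · apply le_antisymm
    · refine le_iInf₂ fun l hl => ?_
      obtain ⟨i, rfl⟩ := Nat.exists_eq_add_of_le (show r ≤ l by omega)
      rw [← infixCost_shift]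
      exact iInf₂_le i ⟨by omega, hl.2⟩
    · refine le_iInf₂ fun l hl => ?_
      rw [infixCost_shift]
      exact iInf₂_le (r + l) ⟨by omega, hl.2⟩
  · rfl

/-- A limit superior ignores finitely many positions. The bounded condition has no such invariance,
as an unanswered request in a prefix can spoil it; this is why only the game with costs calls for an
iteration. -/
theorem costStreett_tail_iff (ρ : ℕ → V) (k : ℕ) :
    (fun j => ρ (k + j)) ∈ Γ.costStreett Cst ↔ ρ ∈ Γ.costStreett Cst := by
  simp only [costStreett, Set.mem_ofPred_eq]
  have e : (fun j => Γ.stCor Cst (fun j => ρ (k + j)) j) = fun j => Γ.stCor Cst ρ (j + k) := by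
    funext j
    rw [stCor, stCor, Nat.add_comm j]
    simp only [stCorAt_shift]
  rw [e, limsup_nat_add]

variable (Γ Cst)

/-- The relaxation of the bounded cost-Streett condition without a bound on the costs. -/
def relaxed : Set (ℕ → V) := {ρ | ρ ∈ Γ.streett ∧ ∀ c k, ¬ Γ.UnansweredInf Cst c ρ k}

variable {Γ Cst}

theorem limsup_eq_top_of_frequently {f : ℕ → ℕ∞} (h : ∀ b : ℕ, ∃ᶠ k in atTop, (b : ℕ∞) ≤ f k) :
    limsup f atTop = ⊤ := by
  rw [ENat.eq_top_iff_forall_ge]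
  exact fun b => le_limsup_of_frequently_le (h b)

/-- After the last response, each of infinitely many requests has cost `⊤`. -/
theorem streett_of_costStreett (h : ρ ∈ Γ.costStreett Cst) : ρ ∈ Γ.streett := by
  by_contra hcon
  simp only [streett, Set.mem_ofPred_eq, not_forall] at hcon
  obtain ⟨c, hQ, hP⟩ := hcon
  rw [not_frequently] at hP
  obtain ⟨K, hK⟩ := eventually_atTop.1 hP
  have : limsup (fun k => Γ.stCor Cst ρ k) atTop = ⊤ := by
    refine limsup_eq_top_of_frequently fun b => ?_
    refine (hQ.and_eventually (eventually_ge_atTop K)).mono fun k hk => ?_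
    have h1 : Γ.stCorAt Cst c ρ k = ⊤ :=
      stCorAt_eq_top_iff.2 ⟨hk.1, fun l hl => hK l (hk.2.trans hl)⟩
    have h2 := le_iSup (fun c => Γ.stCorAt Cst c ρ k) c
    simp only [h1, top_le_iff] at h2
    simp only [stCor, h2]
    exact le_top
  exact absurd this (ne_of_lt h)

theorem bndCostStreett_subset_relaxed : Γ.bndCostStreett Cst ⊆ Γ.relaxed Cst :=
  fun _ h => ⟨streett_of_costStreett h.1, h.2⟩

theorem bndCostStreett_subset_costStreett : Γ.bndCostStreett Cst ⊆ Γ.costStreett Cst :=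
  fun _ h => h.1

end Costs

/-! ### Simulation of a game with costs by a Streett game -/

/-- The Streett game `(A', Γ')` simulates the game with costs `(A, Γ, Cst)`, up to the point where
`D` is reached: it keeps track of the open requests in a memory, some edges `(u, w)` are subdivided
by vertices `mid u w O`, and the pair `ch c` asks to answer requests of pair `c` if their costs
increase. -/
structure Simulates (A : Arena V) (Γ : StreettPairs d V) (Cst : CostFunctions d V) (D : Set V)
    {V' : Type} {d' : ℕ} (A' : Arena V') (Γ' : StreettPairs d' V') where
  M : Type
  bit : M → Fin d → Prop
  nxt : M → V → M
  start : M
  real : V → M → V'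
  mid : V → V → M → V'
  Sub : V → V → Prop
  cl : Fin d → Fin d'
  ch : Fin d → Fin d'
  surj : ∀ c', ∃ c, c' = cl c ∨ c' = ch c
  not_bit_start : ∀ c, ¬ bit start c
  bit_nxt : ∀ {u} O c, u ∉ D → (bit (nxt O u) c ↔ u ∉ Γ.P c ∧ (bit O c ∨ u ∈ Γ.Q c))
  edge_real : ∀ {u} O y, u ∉ D → (A'.Edge (real u O) y ↔ ∃ w, A.Edge u w ∧
    ((Sub u w ∧ y = mid u w (nxt O u)) ∨ (¬ Sub u w ∧ y = real w (nxt O u))))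
  edge_mid : ∀ {u w} O y, A.Edge u w → Sub u w → (A'.Edge (mid u w O) y ↔ y = real w O)
  owner_real : ∀ {u} O, u ∉ D → A'.owner (real u O) = A.owner u
  owner_mid : ∀ {u w} O, A.Edge u w → Sub u w → A'.owner (mid u w O) = 0
  real_mem_Q_cl : ∀ {u} O c, u ∉ D → (real u O ∈ Γ'.Q (cl c) ↔ u ∈ Γ.Q c)
  real_mem_P_cl : ∀ {u} O c, u ∉ D → (real u O ∈ Γ'.P (cl c) ↔ u ∈ Γ.P c)
  mid_notMem_Q_cl : ∀ {u w} O c, A.Edge u w → Sub u w → mid u w O ∉ Γ'.Q (cl c)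
  mid_notMem_P_cl : ∀ {u w} O c, A.Edge u w → Sub u w → mid u w O ∉ Γ'.P (cl c)
  real_mem_P_ch : ∀ {u} O c, u ∉ D → (real u O ∈ Γ'.P (ch c) ↔ ¬ bit O c)
  mid_mem_P_ch : ∀ {u w} O c, A.Edge u w → Sub u w → (mid u w O ∈ Γ'.P (ch c) ↔ ¬ bit O c)
  real_mem_Q_ch : ∀ {u w} O c, A.Edge u w → ¬ Sub u w → w ∉ D →
    (real w O ∈ Γ'.Q (ch c) ↔ Cst c u w = CostLabel.inc)
  mid_mem_Q_ch : ∀ {u w} O c, A.Edge u w → Sub u w →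
    (mid u w O ∈ Γ'.Q (ch c) ↔ Cst c u w = CostLabel.inc)
  -- The cost of a subdivided edge has already been charged at its midpoint.
  real_notMem_Q_ch : ∀ {u w} O c, A.Edge u w → Sub u w → w ∉ D → real w O ∉ Γ'.Q (ch c)
  sink : ∀ {u} O, u ∈ D → ∃ y, A'.owner (real u O) = 0 ∧ A'.Edge (real u O) y ∧ A'.owner y = 0 ∧
    A'.Edge y y ∧ ∀ c', y ∉ Γ'.Q c'

namespace Simulates

variable {A : Arena V} {Γ : StreettPairs d V} {Cst : CostFunctions d V} {D : Set V}
  {V' : Type} {d' : ℕ} {A' : Arena V'} {Γ' : StreettPairs d' V'}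

/-- The memory along a play. -/
def memory (G : Simulates A Γ Cst D A' Γ') (ρ : ℕ → V) : ℕ → G.M
  | 0 => G.start
  | k + 1 => G.nxt (memory G ρ k) (ρ k)

/-- The request sets the bit, and only a response clears it. -/
theorem bit_of_open (G : Simulates A Γ Cst D A' Γ') {ρ : ℕ → V} (hD : ∀ k, ρ k ∉ D) {c : Fin d}
    {k l : ℕ} (hQ : ρ k ∈ Γ.Q c) (hP : ∀ i, k ≤ i → i < l → ρ i ∉ Γ.P c) (hkl : k < l) :
    G.bit (G.memory ρ l) c := by
  induction l, hkl using Nat.le_induction with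
  | base => exact (G.bit_nxt _ c (hD k)).2 ⟨hP k le_rfl (by omega), Or.inr hQ⟩
  | succ l hl ih =>
    exact (G.bit_nxt _ c (hD l)).2 ⟨hP l (by omega) (by omega),
      Or.inl (ih fun i h1 h2 => hP i h1 (by omega))⟩

/-- If the open requests increase the counters `g`, then bounded counters bound the costs. -/
theorem bndCostStreett_of_counters (G : Simulates A Γ Cst D A' Γ') {ρ : ℕ → V}
    (hD : ∀ k, ρ k ∉ D) (N : ℕ) (g : ℕ → Fin d' → ℕ) (hg : ∀ k c, g k c ≤ N)
    (hl : ∀ k c, ρ (k + 1) ∉ Γ.P c → g k (G.cl c) ≤ g (k + 1) (G.cl c) ∧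
      (ρ (k + 1) ∈ Γ.Q c → g k (G.cl c) + 1 ≤ g (k + 1) (G.cl c)))
    (hh : ∀ k c, G.bit (G.memory ρ (k + 1)) c → g k (G.ch c) ≤ g (k + 1) (G.ch c) ∧
      (Cst c (ρ k) (ρ (k + 1)) = CostLabel.inc → g k (G.ch c) + 1 ≤ g (k + 1) (G.ch c))) :
    ρ ∈ Γ.bndCostStreett Cst := by
  classical
  have hcost : ∀ c k l, k ≤ l → ρ k ∈ Γ.Q c → (∀ i, k ≤ i → i < l → ρ i ∉ Γ.P c) →
      infixCost Cst c ρ k l ≤ g l (G.ch c) := by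
    intro c k l hkl hQ hP
    induction l, hkl using Nat.le_induction with
    | base => rw [infixCost_self]; exact Nat.zero_le _
    | succ l hkl ih =>
      have h1 := ih fun i h1 h2 => hP i h1 (by omega)
      have h2 := hh l c (G.bit_of_open hD hQ hP (by omega))
      rw [infixCost_succ _ _ _ hkl]
      split_ifs with hi
      · have := h2.2 hi; omega
      · have := h2.1; omega
  have hstreett : ρ ∈ Γ.streett := by
    intro c hQ
    by_contra hP
    rw [not_frequently] at hP
    obtain ⟨K, hK⟩ := eventually_atTop.1 hP
    -- After the last response the counter of `cl c` never decreases and grows with every request,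
    -- so infinitely many requests would exceed `N`.
    have hmono : ∀ k l, K ≤ k → k ≤ l → g k (G.cl c) ≤ g l (G.cl c) := by
      intro k l hk hkl
      induction l, hkl using Nat.le_induction with
      | base => exact le_rfl
      | succ l hkl ih => exact ih.trans (hl l c (hK _ (by omega))).1
    have : ∀ n, ∃ k ≥ K, n ≤ g k (G.cl c) := by
      intro n
      induction n with
      | zero => exact ⟨K, le_rfl, Nat.zero_le _⟩
      | succ n ih =>
        obtain ⟨k, hk, hn⟩ := ih
        obtain ⟨j, hj, hjQ⟩ := (frequently_atTop.1 hQ) (k + 1)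
        obtain ⟨i, rfl⟩ := Nat.exists_eq_add_of_le' (show 1 ≤ j by omega)
        have h1 := (hl i c (hK _ (by omega))).2 hjQ
        have h2 := hmono k i hk (by omega)
        exact ⟨i + 1, by omega, by omega⟩
    obtain ⟨k, -, hk⟩ := this (N + 1)
    have := hg k (G.cl c)
    omega
  refine ⟨?_, ?_⟩
  · have hev : ∀ᶠ k in atTop, Γ.stCor Cst ρ k ≤ (N : ℕ∞) := by
      have : ∀ c, ∀ᶠ k in atTop, Γ.stCorAt Cst c ρ k ≤ (N : ℕ∞) := by
        intro c
        -- If `Q c` is visited finitely often, the costs are eventually `0` by convention, even if a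
        -- request remains unanswered. Otherwise every request is answered.
        by_cases hQ : ∃ᶠ k in atTop, ρ k ∈ Γ.Q c
        · refine Eventually.of_forall fun k => stCorAt_le (fun _ => ?_) fun l hl h1 h2 => ?_
          · exact frequently_atTop.1 (hstreett c hQ) k
          · exact (hcost c k l hl h1 h2).trans (hg _ _)
        · rw [not_frequently] at hQ
          refine hQ.mono fun k hk => ?_
          rw [stCorAt, if_neg hk]; exact zero_le
      refine (eventually_all.2 this).mono fun k hk => iSup_le hk
    exact (limsup_le_of_le (by isBoundedDefault) hev).trans_lt (ENat.natCast_lt_top N)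
  · rintro c k ⟨htop, hinc⟩
    obtain ⟨hQ, hP⟩ := stCorAt_eq_top_iff.1 htop
    obtain ⟨l, hl, hb⟩ := exists_le_infixCost Cst c ρ hinc k (N + 1)
    have h1 := hcost c k l hl hQ fun i hi _ => hP i hi
    have h2 := hg l (G.ch c)
    omega

/-- Winning vertices of Player `0` in the simulating game. -/
theorem mem_winningRegion_zero [Finite V'] (G : Simulates A Γ Cst D A' Γ') {v : V}
    (hv : G.real v G.start ∈ A'.winningRegion Γ'.streett 0) :
    v ∈ A.winningRegion (Γ.bndCostStreett Cst ∪ Arena.reach D) 0 := by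
  classical
  obtain ⟨N, I, hI, hv0⟩ := exists_boundedInv A' Γ' _ hv
  -- The memory holds the open requests and the counters before the visit of the current vertex. A
  -- subdivided edge also visits its midpoint, hence the second `bump`.
  let step : G.M × (Fin d' → ℕ) → V → V → G.M × (Fin d' → ℕ) := fun x u w =>
    (G.nxt x.1 u, if G.Sub u w then Γ'.bump (G.mid u w (G.nxt x.1 u)) (Γ'.bump (G.real u x.1) x.2)
      else Γ'.bump (G.real u x.1) x.2)
  let J : V → G.M × (Fin d' → ℕ) → Prop := fun u x => (G.real u x.1, x.2) ∈ I
  have hstep : ∀ u x w y, A.Edge u w →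
      ((G.Sub u w ∧ y = G.mid u w (G.nxt x.1 u)) ∨ (¬ G.Sub u w ∧ y = G.real w (G.nxt x.1 u))) →
      (y, Γ'.bump (G.real u x.1) x.2) ∈ I → J w (step x u w) := by
    rintro u x w y he (⟨hs, rfl⟩ | ⟨hs, rfl⟩) hy
    · simp only [J, step, if_pos hs]
      -- The midpoint has a single outgoing edge, so being able to force its successor means that
      -- this successor lies in the invariant.
      obtain ⟨-, -, h3⟩ := hI _ _ hy
      obtain ⟨z, -, hz, hzI⟩ := h3.1 (G.owner_mid _ he hs)
      rw [G.edge_mid _ _ he hs] at hz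
      subst hz
      exact hzI.resolve_right fun h => h
    · simp only [J, step, if_neg hs]; exact hy
  obtain ⟨σ, hσ⟩ := A.exists_memory_strategy 0 (G.start, (0 : Fin d' → ℕ)) step
    (fun x u w => J w (step x u w))
  refine ⟨σ, fun ρ hp h0 hc => ?_⟩
  simp only [Arena.WonBy, if_true]
  by_cases hr : ∃ k, ρ k ∈ D
  · exact Or.inr hr
  left
  push Not at hr
  set x := Arena.memSeq (G.start, (0 : Fin d' → ℕ)) step ρ with hx
  have hx1 : ∀ k, (x k).1 = G.memory ρ k := by
    intro k
    induction k with
    | zero => rfl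
    | succ k ih => change G.nxt (x k).1 (ρ k) = G.nxt _ _; rw [ih]
  have hJ : ∀ k, J (ρ k) (x k) := by
    intro k
    induction k with
    | zero => simp only [hx, Arena.memSeq, J, h0]; exact hv0
    | succ k ih =>
      obtain ⟨-, -, h3⟩ := hI _ _ ih
      have hforce := h3
      rw [Arena.Force, G.owner_real _ (hr k)] at hforce
      by_cases ho : A.owner (ρ k) = 0
      · obtain ⟨y, -, he, hy⟩ := hforce.1 ho
        obtain ⟨w, hw, hyw⟩ := (G.edge_real _ _ (hr k)).1 he
        exact hσ ρ hc k ho ⟨w, hw, hstep _ _ _ y hw hyw (hy.resolve_right fun h => h)⟩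
      · by_cases hs : G.Sub (ρ k) (ρ (k + 1))
        · have hyw : (G.Sub (ρ k) (ρ (k + 1)) ∧ G.mid (ρ k) (ρ (k + 1)) (G.nxt (x k).1 (ρ k)) =
            G.mid (ρ k) (ρ (k + 1)) (G.nxt (x k).1 (ρ k))) := ⟨hs, rfl⟩
          exact hstep _ _ _ _ (hp k) (Or.inl hyw) ((hforce.2 ho _ trivial
            ((G.edge_real _ _ (hr k)).2 ⟨_, hp k, Or.inl hyw⟩)).resolve_right fun h => h)
        · have hyw : (¬ G.Sub (ρ k) (ρ (k + 1)) ∧ G.real (ρ (k + 1)) (G.nxt (x k).1 (ρ k)) =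
            G.real (ρ (k + 1)) (G.nxt (x k).1 (ρ k))) := ⟨hs, rfl⟩
          exact hstep _ _ _ _ (hp k) (Or.inr hyw) ((hforce.2 ho _ trivial
            ((G.edge_real _ _ (hr k)).2 ⟨_, hp k, Or.inr hyw⟩)).resolve_right fun h => h)
  have hx2 : ∀ k, (x (k + 1)).2 = if G.Sub (ρ k) (ρ (k + 1)) then
      Γ'.bump (G.mid (ρ k) (ρ (k + 1)) (x (k + 1)).1) (Γ'.bump (G.real (ρ k) (x k).1) (x k).2)
      else Γ'.bump (G.real (ρ k) (x k).1) (x k).2 := fun k => rfl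
  refine G.bndCostStreett_of_counters hr N (fun k => Γ'.bump (G.real (ρ k) (x k).1) (x k).2)
    (fun k c => (hI _ _ (hJ k)).2.1 c (Finset.mem_univ c)) (fun k c hP => ?_) (fun k c hb => ?_)
  · have h1 : (x (k + 1)).2 (G.cl c) = Γ'.bump (G.real (ρ k) (x k).1) (x k).2 (G.cl c) := by
      rw [hx2]
      split_ifs with hs
      · conv_lhs => rw [bump]
        rw [if_neg (G.mid_notMem_P_cl _ _ (hp k) hs), if_neg (G.mid_notMem_Q_cl _ _ (hp k) hs)]
      · rfl
    have h2 := G.real_mem_P_cl (x (k + 1)).1 c (hr (k + 1))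
    have h3 := G.real_mem_Q_cl (x (k + 1)).1 c (hr (k + 1))
    rw [← h1]
    generalize (x (k + 1)).2 = f
    rw [bump_of_notMem Γ' (fun h => hP (h2.1 h)), h3]
    split_ifs with hq
    · exact ⟨by omega, fun _ => le_rfl⟩
    · exact ⟨le_rfl, fun h => absurd h hq⟩
  · rw [← hx1] at hb
    have h2 : G.real (ρ (k + 1)) (x (k + 1)).1 ∉ Γ'.P (G.ch c) := fun h =>
      (G.real_mem_P_ch _ c (hr (k + 1))).1 h hb
    rw [bump_of_notMem Γ' h2, hx2]
    by_cases hs : G.Sub (ρ k) (ρ (k + 1))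
    · rw [if_pos hs, if_neg (G.real_notMem_Q_ch _ c (hp k) hs (hr (k + 1)))]
      generalize Γ'.bump (G.real (ρ k) (x k).1) (x k).2 = f
      rw [bump_of_notMem Γ' (fun h => (G.mid_mem_P_ch _ c (hp k) hs).1 h hb),
        G.mid_mem_Q_ch _ c (hp k) hs]
      split_ifs with hq
      · exact ⟨by omega, fun _ => le_rfl⟩
      · exact ⟨le_rfl, fun h => absurd h hq⟩
    · rw [if_neg hs, G.real_mem_Q_ch _ c (hp k) hs (hr (k + 1))]
      split_ifs with hq
      · exact ⟨by omega, fun _ => le_rfl⟩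
      · exact ⟨le_rfl, fun h => absurd h hq⟩

end Simulates

end StreettPairs

/-! ### Player `1` in the simulating game and in the game with costs -/

namespace StreettPairs

variable {V : Type} {d : ℕ}

namespace Simulates

variable {A : Arena V} {Γ : StreettPairs d V} {Cst : CostFunctions d V} {D : Set V}
  {V' : Type} {d' : ℕ} {A' : Arena V'} {Γ' : StreettPairs d' V'}

/-- If `c` were open from some point on, consider the least such point, which is not the start. The
vertex just before it makes a request, and this request is never answered although infinitely many
increments follow. -/
theorem frequently_not_bit (G : Simulates A Γ Cst D A' Γ') {ρ : ℕ → V} (hD : ∀ k, ρ k ∉ D)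
    {c : Fin d} (hi : ∃ᶠ k in atTop, Cst c (ρ k) (ρ (k + 1)) = CostLabel.inc)
    (hu : ∀ k, ¬ Γ.UnansweredInf Cst c ρ k) :
    ∃ᶠ k in atTop, ¬ G.bit (G.memory ρ k) c := by
  classical
  by_contra hcon
  rw [not_frequently] at hcon
  have hex := eventually_atTop.1 hcon
  simp only [not_not] at hex
  have hK := Nat.find_spec hex
  have h0 : Nat.find hex ≠ 0 := by
    intro h
    rw [h] at hK
    exact G.not_bit_start c (hK 0 le_rfl)
  obtain ⟨K, hK'⟩ := Nat.exists_eq_succ_of_ne_zero h0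
  have hmin := Nat.find_min hex (m := K) (by omega)
  push Not at hmin
  obtain ⟨i, hi1, hi2⟩ := hmin
  rw [hK'] at hK
  have hiK : i = K := by
    by_contra h
    exact hi2 (hK i (by omega))
  subst hiK
  have h1 := (G.bit_nxt _ c (hD i)).1 (hK (i + 1) le_rfl)
  refine hu i ⟨stCorAt_eq_top_iff.2 ⟨h1.2.resolve_left hi2, fun l hl => ?_⟩, hi⟩
  exact ((G.bit_nxt _ c (hD l)).1 (hK (l + 1) (by omega))).1

/-- Winning vertices of Player `1` in the simulating game. -/
theorem mem_winningRegion_one (G : Simulates A Γ Cst D A' Γ') {v : V}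
    (hv : G.real v G.start ∈ A'.winningRegion Γ'.streett 1) :
    v ∈ A.winningRegion (Γ.relaxed Cst ∪ Arena.reach D) 1 := by
  classical
  obtain ⟨τ, hτ⟩ := hv
  -- The memory is the history of the lifted play, with midpoints, to which `τ` is applied.
  let step : List V' × G.M → V → V → List V' × G.M := fun x u w =>
    (x.1 ++ [G.real u x.2] ++ if G.Sub u w then [G.mid u w (G.nxt x.2 u)] else [], G.nxt x.2 u)
  obtain ⟨σ, hσ⟩ := A.exists_memory_strategy 1 (([] : List V'), G.start) step
    (fun x u w => (G.Sub u w ∧ τ.move x.1 (G.real u x.2) = G.mid u w (G.nxt x.2 u)) ∨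
      (¬ G.Sub u w ∧ τ.move x.1 (G.real u x.2) = G.real w (G.nxt x.2 u)))
  refine ⟨σ, fun ρ hp h0 hc => ?_⟩
  simp only [Arena.WonBy, one_ne_zero, if_false]
  intro hρ
  set x := Arena.memSeq (([] : List V'), G.start) step ρ with hx
  have hx1 : ∀ k, (x k).2 = G.memory ρ k := by
    intro k
    induction k with
    | zero => rfl
    | succ k ih => change G.nxt (x k).2 (ρ k) = G.nxt _ _; rw [ih]
  have hx2 : ∀ k, (x (k + 1)).1 = (x k).1 ++ [G.real (ρ k) (x k).2] ++
      if G.Sub (ρ k) (ρ (k + 1)) then [G.mid (ρ k) (ρ (k + 1)) (x (k + 1)).2] else [] :=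
    fun k => rfl
  have hx3 : ∀ k, (x (k + 1)).2 = G.nxt (x k).2 (ρ k) := fun k => rfl
  have hsink : ∀ k, ∃ y, ρ k ∈ D → A'.owner (G.real (ρ k) (x k).2) = 0 ∧
      A'.Edge (G.real (ρ k) (x k).2) y ∧ A'.owner y = 0 ∧ A'.Edge y y ∧ ∀ c', y ∉ Γ'.Q c' := by
    intro k
    by_cases h : ρ k ∈ D
    · obtain ⟨y, hy⟩ := G.sink (x k).2 h
      exact ⟨y, fun _ => hy⟩
    · exact ⟨G.real (ρ k) (x k).2, fun h' => absurd h' h⟩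
  choose snk hsnk using hsink
  -- The positions of the lifted play: at the `k`-th vertex, at the midpoint of the `k`-th edge, or
  -- at rest in the sink after the `k`-th vertex, which lies in `D`.
  let nx : ℕ ⊕ ℕ ⊕ ℕ → ℕ ⊕ ℕ ⊕ ℕ
    | .inl k => if ρ k ∈ D then .inr (.inr k) else
        if G.Sub (ρ k) (ρ (k + 1)) then .inr (.inl k) else .inl (k + 1)
    | .inr (.inl k) => .inl (k + 1)
    | .inr (.inr k) => .inr (.inr k)
  let vx : ℕ ⊕ ℕ ⊕ ℕ → V'
    | .inl k => G.real (ρ k) (x k).2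
    | .inr (.inl k) => G.mid (ρ k) (ρ (k + 1)) (x (k + 1)).2
    | .inr (.inr k) => snk k
  let legit : ℕ ⊕ ℕ ⊕ ℕ → Prop
    | .inl _ => True
    | .inr (.inl k) => ρ k ∉ D ∧ G.Sub (ρ k) (ρ (k + 1))
    | .inr (.inr k) => ρ k ∈ D
  let s : ℕ → ℕ ⊕ ℕ ⊕ ℕ := fun i => nx^[i] (.inl 0)
  have hs0 : s 0 = .inl 0 := rfl
  have hs1 : ∀ i, s (i + 1) = nx (s i) := fun i => Function.iterate_succ_apply' nx i _
  have hnD : ∀ k, ρ k ∈ D → nx (.inl k) = .inr (.inr k) := fun k h => if_pos h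
  have hnS : ∀ k, ρ k ∉ D → G.Sub (ρ k) (ρ (k + 1)) → nx (.inl k) = .inr (.inl k) :=
    fun k h h' => (if_neg h).trans (if_pos h')
  have hnN : ∀ k, ρ k ∉ D → ¬ G.Sub (ρ k) (ρ (k + 1)) → nx (.inl k) = .inl (k + 1) :=
    fun k h h' => (if_neg h).trans (if_neg h')
  have hlegit : ∀ i, legit (s i) := by
    intro i
    induction i with
    | zero => trivial
    | succ i ih =>
      rw [hs1]
      rcases hsi : s i with k | k | k <;> rw [hsi] at ih
      · by_cases h : ρ k ∈ D
        · rw [hnD k h]; exact h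
        · by_cases h' : G.Sub (ρ k) (ρ (k + 1))
          · rw [hnS k h h']; exact ⟨h, h'⟩
          · rw [hnN k h h']; trivial
      · trivial
      · exact ih
  set ρ' : ℕ → V' := fun i => vx (s i) with hρ'
  have hρ'1 : ∀ i, ρ' (i + 1) = vx (nx (s i)) := fun i => by rw [hρ', ← hs1]
  have hplay : A'.IsPlay ρ' := by
    intro i
    rw [hρ'1]
    change A'.Edge (vx (s i)) _
    have hl := hlegit i
    rcases hsi : s i with k | k | k <;> rw [hsi] at hl
    · by_cases h : ρ k ∈ D
      · rw [hnD k h]; exact (hsnk k h).2.1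
      · by_cases h' : G.Sub (ρ k) (ρ (k + 1))
        · rw [hnS k h h']; exact (G.edge_real _ _ h).2 ⟨_, hp k, Or.inl ⟨h', rfl⟩⟩
        · rw [hnN k h h']; exact (G.edge_real _ _ h).2 ⟨_, hp k, Or.inr ⟨h', rfl⟩⟩
    · exact (G.edge_mid _ _ (hp k) hl.2).2 rfl
    · exact (hsnk k hl).2.2.2.1
  have hhist : ∀ i, (∀ k, s i = .inl k → (List.range i).map ρ' = (x k).1) ∧
      (∀ k, s i = .inr (.inl k) → (List.range i).map ρ' = (x k).1 ++ [G.real (ρ k) (x k).2]) := by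
    intro i
    induction i with
    | zero =>
      refine ⟨fun k hk => ?_, fun k hk => ?_⟩
      · rw [hs0] at hk
        obtain rfl := Sum.inl.inj hk
        rfl
      · rw [hs0] at hk; cases hk
    | succ i ih =>
      rw [Arena.map_range_succ, hs1]
      have e : ρ' i = vx (s i) := rfl
      rw [e]
      have hl := hlegit i
      rcases hsi : s i with k | k | k <;> rw [hsi] at ih hl
      · rw [ih.1 k rfl]
        by_cases h : ρ k ∈ D
        · rw [hnD k h]
          exact ⟨fun k hk => (by cases hk), fun k hk => by cases hk⟩
        · by_cases h' : G.Sub (ρ k) (ρ (k + 1))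
          · rw [hnS k h h']
            refine ⟨fun k hk => (by cases hk), fun k' hk => ?_⟩
            obtain rfl := Sum.inl.inj (Sum.inr.inj hk)
            rfl
          · rw [hnN k h h']
            refine ⟨fun k' hk => ?_, fun k' hk => by cases hk⟩
            obtain rfl := Sum.inl.inj hk
            rw [hx2, if_neg h', List.append_nil]
      · rw [ih.2 k rfl]
        refine ⟨fun k' hk => ?_, fun k' hk => by cases hk⟩
        obtain rfl := Sum.inl.inj hk
        rw [hx2, if_pos hl.2]
      · exact ⟨fun k hk => (by cases hk), fun k hk => by cases hk⟩
  have hcons : τ.Consistent ρ' := by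
    intro i ho
    rw [hρ'1]
    have ho' : A'.owner (vx (s i)) = 1 := ho
    change _ = τ.move _ (vx (s i))
    have hl := hlegit i
    have hh := hhist i
    rcases hsi : s i with k | k | k <;> rw [hsi] at hl hh ho'
    · by_cases h : ρ k ∈ D
      · have := (hsnk k h).1
        have ho'' : A'.owner (G.real (ρ k) (x k).2) = 1 := ho'
        rw [this] at ho''
        cases ho''
      · have ho'' : A.owner (ρ k) = 1 := (G.owner_real _ h).symm.trans ho'
        have hm := (G.edge_real _ _ h).1
          (τ.edge_move (x k).1 (G.real (ρ k) (x k).2) ho')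
        have := hσ ρ hc k ho'' hm
        rw [hh.1 k rfl]
        rcases this with ⟨h', h2⟩ | ⟨h', h2⟩
        · rw [hnS k h h']; exact h2.symm
        · rw [hnN k h h']; exact h2.symm
    · have := G.owner_mid (x (k + 1)).2 (hp k) hl.2
      have ho'' : A'.owner (G.mid (ρ k) (ρ (k + 1)) (x (k + 1)).2) = 1 := ho'
      rw [this] at ho''
      cases ho''
    · have := (hsnk k hl).2.2.1
      have ho'' : A'.owner (snk k) = 1 := ho'
      rw [this] at ho''
      cases ho''
  have hlose := hτ ρ' hplay (by change G.real (ρ 0) _ = _; rw [h0]; rfl) hcons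
  simp only [Arena.WonBy, one_ne_zero, if_false] at hlose
  have hreal : ∀ k, (∀ j < k, ρ j ∉ D) → ∃ i ≥ k, s i = .inl k := by
    intro k hk
    induction k with
    | zero => exact ⟨0, le_rfl, hs0⟩
    | succ k ih =>
      obtain ⟨i, hi, hsi⟩ := ih fun j hj => hk j (by omega)
      by_cases h' : G.Sub (ρ k) (ρ (k + 1))
      · refine ⟨i + 2, by omega, ?_⟩
        rw [hs1, hs1, hsi, hnS k (hk k (by omega)) h']
      · exact ⟨i + 1, by omega, by rw [hs1, hsi, hnN k (hk k (by omega)) h']⟩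
  apply hlose
  by_cases hr : ∃ k, ρ k ∈ D
  -- Once `D` is reached, the lifted play rests in a vertex without requests, so Player `0` wins it,
  -- contrary to the choice of `τ`.
  · obtain ⟨i, -, hi⟩ := hreal (Nat.find hr) fun j hj => Nat.find_min hr hj
    have hk := Nat.find_spec hr
    have hforever : ∀ j, s (i + 1 + j) = .inr (.inr (Nat.find hr)) := by
      intro j
      induction j with
      | zero => rw [Nat.add_zero, hs1, hi, hnD _ hk]
      | succ j ih => rw [← Nat.add_assoc, hs1, ih]
    intro c' hQ
    obtain ⟨j, hj, hjQ⟩ := (frequently_atTop.1 hQ) (i + 1)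
    obtain ⟨j, rfl⟩ := Nat.exists_eq_add_of_le hj
    have : ρ' (i + 1 + j) = snk (Nat.find hr) := by
      change vx (s (i + 1 + j)) = _; rw [hforever]
    rw [this] at hjQ
    exact absurd hjQ ((hsnk _ hk).2.2.2.2 c')
  push Not at hr
  have hrel : ρ ∈ Γ.relaxed Cst := hρ.resolve_right fun ⟨k, hk⟩ => hr k hk
  let ix : ℕ ⊕ ℕ ⊕ ℕ → ℕ := fun y => Sum.elim id (Sum.elim id id) y
  have hix : ∀ i, ix (s i) ≤ ix (s (i + 1)) := by
    intro i
    rw [hs1]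
    rcases s i with k | k | k
    · by_cases h' : G.Sub (ρ k) (ρ (k + 1))
      · rw [hnS k (hr k) h']; exact le_rfl
      · rw [hnN k (hr k) h']; exact Nat.le_succ k
    · exact Nat.le_succ k
    · exact le_rfl
  have hix' : Monotone fun i => ix (s i) := monotone_nat_of_le_succ hix
  have hixt : ∀ K, ∀ᶠ i in atTop, K ≤ ix (s i) := by
    intro K
    obtain ⟨i, -, hi⟩ := hreal K fun j _ => hr j
    refine eventually_atTop.2 ⟨i, fun j hj => ?_⟩
    have := hix' hj
    simp only [hi] at this
    exact this
  -- The `k`-th vertex occurs in the lifted play at time `k` or later, so what happens infinitely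
  -- often along `ρ` also does so in the lifted play.
  have back : ∀ (p : ℕ → Prop) (q : V' → Prop), (∀ k, p k → q (G.real (ρ k) (x k).2)) →
      (∃ᶠ k in atTop, p k) → ∃ᶠ i in atTop, q (ρ' i) := by
    intro p q hpq hp
    rw [frequently_atTop] at hp ⊢
    intro K
    obtain ⟨k, hk, hpk⟩ := hp K
    obtain ⟨i, hi, hsi⟩ := hreal k fun j _ => hr j
    refine ⟨i, by omega, ?_⟩
    change q (vx (s i))
    rw [hsi]
    exact hpq k hpk
  intro c' hQ
  obtain ⟨c, rfl | rfl⟩ := G.surj c'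
  · refine back (fun k => ρ k ∈ Γ.P c) (fun y => y ∈ Γ'.P (G.cl c))
      (fun k hk => (G.real_mem_P_cl _ c (hr k)).2 hk) (hrel.1 c ?_)
    rw [frequently_atTop]
    intro K
    obtain ⟨i, hi, hK⟩ := (hQ.and_eventually (hixt K)).exists
    have hi' : vx (s i) ∈ Γ'.Q (G.cl c) := hi
    have hl := hlegit i
    rcases hsi : s i with k | k | k <;> rw [hsi] at hl hi' hK
    · exact ⟨k, hK, (G.real_mem_Q_cl _ c (hr k)).1 hi'⟩
    · exact absurd hi' (G.mid_notMem_Q_cl _ c (hp k) hl.2)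
    · exact absurd hl (hr k)
  · refine back (fun k => ¬ G.bit (G.memory ρ k) c) (fun y => y ∈ Γ'.P (G.ch c))
      (fun k hk => (G.real_mem_P_ch _ c (hr k)).2 (by rw [hx1]; exact hk))
      (G.frequently_not_bit hr ?_ (hrel.2 c))
    rw [frequently_atTop]
    intro K
    -- A request of `ch c` at the `k`-th vertex concerns the edge that leads to it, the one with
    -- index `k - 1`; hence `K + 1`.
    obtain ⟨i, hi, hK⟩ := (hQ.and_eventually (hixt (K + 1))).exists
    have hi' : vx (s i) ∈ Γ'.Q (G.ch c) := hi
    have hl := hlegit i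
    rcases hsi : s i with k | k | k <;> rw [hsi] at hl hi' hK
    · have hK' : K + 1 ≤ k := hK
      obtain ⟨j, rfl⟩ := Nat.exists_eq_add_of_le' (show 1 ≤ k by omega)
      refine ⟨j, by omega, ?_⟩
      by_cases h' : G.Sub (ρ j) (ρ (j + 1))
      · exact absurd hi' (G.real_notMem_Q_ch _ c (hp j) h' (hr _))
      · exact (G.real_mem_Q_ch _ c (hp j) h' (hr _)).1 hi'
    · exact ⟨k, (Nat.le_succ K).trans hK, (G.mid_mem_Q_ch _ c (hp k) hl.2).1 hi'⟩
    · exact absurd hl (hr k)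

end Simulates

/-! ### Restarting strategies of Player `1` -/

/-- The finite path `l` has a request that is open at the end and has cost at least `j`. -/
def ExpensiveOpen (Γ : StreettPairs d V) (Cst : CostFunctions d V) (l : List V) (j : ℕ) : Prop :=
  ∃ ρ : ℕ → V, l = (List.range l.length).map ρ ∧ ∃ c a, a < l.length ∧ ρ a ∈ Γ.Q c ∧
    (∀ i, a ≤ i → i < l.length → ρ i ∉ Γ.P c) ∧ j ≤ infixCost Cst c ρ a (l.length - 1)

/-- If Player `1` wins the relaxed game from everywhere outside of `D` without reaching `D`, he
wins the game with costs: he restarts his strategy whenever an open request gets too expensive. -/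
theorem mem_winningRegion_one_costStreett (A : Arena V) (Γ : StreettPairs d V)
    (Cst : CostFunctions d V) (D : Set V)
    (h : ∀ v ∉ D, v ∈ A.winningRegion (Γ.relaxed Cst ∪ Arena.reach D) 1) (v : V) (hv : v ∉ D) :
    v ∈ A.winningRegion (Γ.costStreett Cst) 1 := by
  classical
  have hex : ∀ u, ∃ τ : A.Strategy 1, u ∉ D → ∀ ρ, A.IsPlay ρ → ρ 0 = u → τ.Consistent ρ →
      Arena.WonBy (Γ.relaxed Cst ∪ Arena.reach D) 1 ρ := by
    intro u
    by_cases hu : u ∈ D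
    · exact ⟨(A.nonempty_strategy 1).some, fun h => absurd hu h⟩
    · obtain ⟨τ, hτ⟩ := h u hu
      exact ⟨τ, fun _ => hτ⟩
  choose τ hτ using hex
  simp only [Arena.WonBy, one_ne_zero, if_false] at hτ
  -- The memory holds the history since the last restart and the number of restarts, which is also
  -- the cost that triggers the next restart.
  let step : List V × ℕ → V → V → List V × ℕ := fun x u w =>
    if ExpensiveOpen Γ Cst (x.1 ++ [u] ++ [w]) x.2 then ([], x.2 + 1) else (x.1 ++ [u], x.2)
  let first : List V → V → V := fun l u => (l ++ [u]).headD u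
  obtain ⟨σ, hσ⟩ := A.exists_memory_strategy 1 (([] : List V), 0) step
    (fun x u w => w = (τ (first x.1 u)).move x.1 u)
  refine ⟨σ, fun ρ hp h0 hc => ?_⟩
  simp only [Arena.WonBy, one_ne_zero, if_false]
  intro hcost
  set x := Arena.memSeq (([] : List V), 0) step ρ with hx
  have hmv : ∀ k, A.owner (ρ k) = 1 → ρ (k + 1) = (τ (first (x k).1 (ρ k))).move (x k).1 (ρ k) :=
    fun k ho => hσ ρ hc k ho ⟨_, (τ _).edge_move _ _ ho, rfl⟩
  let restart : ℕ → Prop := fun k => ExpensiveOpen Γ Cst ((x k).1 ++ [ρ k] ++ [ρ (k + 1)]) (x k).2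
  have hx1 : ∀ k, restart k → x (k + 1) = ([], (x k).2 + 1) := fun k hk => if_pos hk
  have hx2 : ∀ k, ¬ restart k → x (k + 1) = ((x k).1 ++ [ρ k], (x k).2) := fun k hk => if_neg hk
  let seg : ℕ → ℕ → List V := fun r i => (List.range (i - r)).map fun j => ρ (r + j)
  have hseg : ∀ r i, r ≤ i → seg r i ++ [ρ i] = seg r (i + 1) := by
    intro r i hi
    simp only [seg]
    rw [show i + 1 - r = (i - r) + 1 by omega, Arena.map_range_succ, show r + (i - r) = i by omega]
  have hfirst : ∀ r i, r ≤ i → first (seg r i) (ρ i) = ρ r := by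
    intro r i hi
    simp only [first, hseg r i hi]
    simp only [seg]
    rw [show i + 1 - r = (i - r) + 1 by omega, List.range_succ_eq_map]
    simp
  -- `r` is the position at which the attempt running at `k` began.
  have hinv : ∀ k, ∃ r ≤ k, (∀ i, r ≤ i → i ≤ k → x i = (seg r i, (x k).2)) ∧
      ∀ i < k, restart i → i + 1 ≤ r := by
    intro k
    induction k with
    | zero => 
      refine ⟨0, le_rfl, fun i _ hi => ?_, fun i hi => absurd hi (Nat.not_lt_zero i)⟩
      obtain rfl := Nat.le_zero.1 hi
      rfl
    | succ k ih =>
      obtain ⟨r, hr, h1, h2⟩ := ih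
      by_cases hk : restart k
      · refine ⟨k + 1, le_rfl, fun i hi hi' => ?_, fun i hi _ => hi⟩
        obtain rfl := le_antisymm hi' hi
        rw [hx1 k hk]
        simp [seg]
      · refine ⟨r, by omega, fun i hi hi' => ?_, fun i hi hri => ?_⟩
        · rw [hx2 k hk]
          rcases Nat.le_succ_iff.1 hi' with h3 | h3
          · exact h1 i hi h3
          · subst h3
            rw [hx2 k hk, h1 k hr le_rfl]
            simp only [hseg r k hr]
        · rcases Nat.lt_succ_iff_lt_or_eq.1 hi with h3 | h3
          · exact h2 i h3 hri
          · exact absurd (h3 ▸ hri) hk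
  have hcons : ∀ r k, (∀ i, r ≤ i → i ≤ k → (x i).1 = seg r i) → ∀ j, r + j ≤ k →
      A.owner (ρ (r + j)) = 1 →
      ρ (r + (j + 1)) = (τ (ρ r)).move ((List.range j).map fun j => ρ (r + j)) (ρ (r + j)) := by
    intro r k hk j hj ho
    have h1 := hmv (r + j) ho
    rw [hk (r + j) (by omega) hj, hfirst r (r + j) (by omega)] at h1
    simp only [seg, Nat.add_sub_cancel_left] at h1
    exact h1
  -- Every attempt begins outside of `D`, and its finite paths extend to plays consistent with a
  -- strategy that avoids `D`. Moves up to the restart still follow the strategy, so the next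
  -- attempt begins outside of `D` too.
  have hD : ∀ k, ρ k ∉ D := by
    intro k
    induction k using Nat.strong_induction_on with
    | _ k ih =>
      rcases k with _ | k
      · rw [h0]; exact hv
      · obtain ⟨r, hr, h1, -⟩ := hinv k
        have hc' := hcons r k fun i hi hi' => by rw [h1 i hi hi']
        obtain ⟨ρ', e1, e2, e3⟩ := (τ (ρ r)).exists_consistent_extension (fun j => ρ (r + j))
          (k + 1 - r) (fun j _ => hp (r + j)) (fun j hj => hc' j (by omega))
        have h2 := hτ (ρ r) (ih r (by omega)) ρ' e2 (e1 0 (Nat.zero_le _)) e3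
        intro hkD
        refine h2 (Or.inr ⟨k + 1 - r, ?_⟩)
        rw [e1 _ le_rfl, show r + (k + 1 - r) = k + 1 by omega]
        exact hkD
  have hjmono : Monotone fun k => (x k).2 := by
    refine monotone_nat_of_le_succ fun k => ?_
    by_cases hk : restart k
    · rw [hx1 k hk]; exact Nat.le_succ _
    · rw [hx2 k hk]
  by_cases hinf : ∀ K, ∃ k ≥ K, restart k
  · have hj : ∀ b, ∃ k, b ≤ (x k).2 := by
      intro b
      induction b with
      | zero => exact ⟨0, Nat.zero_le _⟩
      | succ b ih =>
        obtain ⟨k, hk⟩ := ih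
        obtain ⟨k', hk', hr⟩ := hinf k
        refine ⟨k' + 1, ?_⟩
        rw [hx1 k' hr]
        have := hjmono hk'
        simp only at this ⊢
        omega
    -- A late restart ends an attempt that began after position `K`, so the expensive open request
    -- lies beyond `K` and its cost is at least the number of restarts made before.
    have htop : limsup (fun k => Γ.stCor Cst ρ k) atTop = ⊤ := by
      refine limsup_eq_top_of_frequently fun b => ?_
      rw [frequently_atTop]
      intro K
      obtain ⟨k₁, hk₁, hr₁⟩ := hinf K
      obtain ⟨k₀, hk₀⟩ := hj b
      obtain ⟨k, hk, hrk⟩ := hinf (max (k₁ + 1) k₀)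
      obtain ⟨r, hr, h1, h2⟩ := hinv k
      have h3 := h2 k₁ (by omega) hr₁
      obtain ⟨ρ', e1, c, a, ha, hQ, hP, hb⟩ := hrk
      rw [h1 k hr le_rfl, hseg r k hr, hseg r (k + 1) (by omega)] at e1 ha hP hb
      have hlen : (seg r (k + 1 + 1)).length = k + 2 - r := by simp [seg]
      rw [hlen] at e1 ha hP hb
      have e2 : ∀ i < k + 2 - r, ρ (r + i) = ρ' i := by
        intro i hi
        have := List.map_inj_left.1 e1 i (List.mem_range.2 hi)
        exact this
      refine ⟨r + a, by omega, ?_⟩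
      have h4 : (infixCost Cst c ρ (r + a) (k + 1) : ℕ∞) ≤ Γ.stCorAt Cst c ρ (r + a) := by
        refine le_stCorAt (by omega) (by rw [e2 a ha]; exact hQ) fun i hi hi' => ?_
        obtain ⟨i, rfl⟩ := Nat.exists_eq_add_of_le (show r ≤ i by omega)
        rw [e2 i (by omega)]
        exact hP i (by omega) (by omega)
      have h5 : infixCost Cst c ρ (r + a) (k + 1) = infixCost Cst c ρ' a (k + 2 - r - 1) := by
        rw [show k + 1 = r + (k + 2 - r - 1) by omega, ← infixCost_shift]
        exact infixCost_congr _ _ _ fun j _ hj' => e2 j (by omega)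
      have h6 : b ≤ infixCost Cst c ρ (r + a) (k + 1) := by
        rw [h5]
        refine hk₀.trans (le_trans ?_ hb)
        exact hjmono (show k₀ ≤ k by omega)
      calc (b : ℕ∞) ≤ infixCost Cst c ρ (r + a) (k + 1) := by exact_mod_cast h6
        _ ≤ _ := h4
        _ ≤ _ := le_iSup (fun c => Γ.stCorAt Cst c ρ (r + a)) c
    exact absurd htop (ne_of_lt hcost)
  · push Not at hinf
    obtain ⟨K, hK⟩ := hinf
    obtain ⟨r, hr, h1, -⟩ := hinv K
    have h2 : ∀ i, r ≤ i → x i = (seg r i, (x K).2) := by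
      intro i hi
      rcases le_total i K with h3 | h3
      · exact h1 i hi h3
      · induction i, h3 using Nat.le_induction with
        | base => exact h1 K hr le_rfl
        | succ i hKi ih => rw [hx2 i (hK i hKi), ih (by omega), ← hseg r i (by omega)]
    have h3 := hτ (ρ r) (hD r) (fun j => ρ (r + j)) (fun j => hp (r + j)) rfl
      (fun j ho => hcons r (r + j) (fun i hi _ => by rw [h2 i hi]) j le_rfl ho)
    -- The last attempt refutes `relaxed`. Given bounded costs, the Streett condition holds on the
    -- tail, so an unanswered request of infinite cost would remain; but it would have caused
    -- another restart.
    apply h3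
    have hcost' := (costStreett_tail_iff ρ r).2 hcost
    refine Or.inl ⟨streett_of_costStreett hcost', ?_⟩
    rintro c a ⟨htop, hinc⟩
    obtain ⟨hQ, hP⟩ := stCorAt_eq_top_iff.1 htop
    obtain ⟨l, hl, hb⟩ := exists_le_infixCost Cst c _ hinc a (x K).2
    have hb' := hb.trans (infixCost_mono Cst c _ hl (Nat.le_add_right l (K + 1)))
    refine hK (r + (l + K)) (by omega) ?_
    have h4 : (x (r + (l + K))).1 ++ [ρ (r + (l + K))] ++ [ρ (r + (l + K) + 1)] =
        (List.range (l + K + 2)).map fun j => ρ (r + j) := by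
      rw [h2 _ (by omega), hseg r _ (by omega), hseg r _ (by omega)]
      simp only [seg]
      rw [show r + (l + K) + 1 + 1 - r = l + K + 2 by omega]
    change ExpensiveOpen Γ Cst _ _
    rw [h4, h2 _ (by omega)]
    refine ⟨fun j => ρ (r + j), by simp, c, a, ?_, hQ, fun i hi _ => hP i hi, ?_⟩
    · simp only [List.length_map, List.length_range]; omega
    · simp only [List.length_map, List.length_range]
      exact hb'

end StreettPairs

namespace RAM

/-! ### Determinism and locality of runs -/

/-- The lower bound needs this to identify the run on a modified input, obtained from locality, with
the run promised by the solver. -/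
theorem Run.deterministic {p : Prog} {σ : Mem} {t : ℕ} {τ : Mem} (h : Run p σ t τ) :
    ∀ {t' τ'}, Run p σ t' τ' → t = t' ∧ τ = τ' := by
  induction h with
  | skip σ => rintro _ _ ⟨⟩; exact ⟨rfl, rfl⟩
  | write a i x σ => rintro _ _ ⟨⟩; exact ⟨rfl, rfl⟩
  | seq _ _ ih₁ ih₂ =>
    rintro _ _ (_ | _ | ⟨h₁, h₂⟩)
    obtain ⟨rfl, rfl⟩ := ih₁ h₁
    obtain ⟨rfl, rfl⟩ := ih₂ h₂
    exact ⟨rfl, rfl⟩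
  | ite_pos hb _ ih =>
    intro _ _ h
    cases h with
    | ite_pos _ h => obtain ⟨rfl, rfl⟩ := ih h; exact ⟨rfl, rfl⟩
    | ite_neg hb' _ => exact absurd hb' hb
  | ite_neg hb _ ih =>
    intro _ _ h
    cases h with
    | ite_pos hb' _ => exact absurd hb hb'
    | ite_neg _ h => obtain ⟨rfl, rfl⟩ := ih h; exact ⟨rfl, rfl⟩
  | loop_exit hb =>
    intro _ _ h
    cases h with
    | loop_exit _ => exact ⟨rfl, rfl⟩
    | loop_step hb' _ _ => exact absurd hb hb'
  | loop_step hb _ _ ih₁ ih₂ =>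
    intro _ _ h
    cases h with
    | loop_exit hb' => exact absurd hb' hb
    | loop_step _ h₁ h₂ =>
      obtain ⟨rfl, rfl⟩ := ih₁ h₁
      obtain ⟨rfl, rfl⟩ := ih₂ h₂
      exact ⟨rfl, rfl⟩

/-- The cells read when an expression is evaluated. -/
def Exp.reads (σ : Mem) : Exp → Finset (ℕ × ℕ)
  | .lit _ => ∅
  | .read a i => insert (a, i.val σ) (i.reads σ)
  | .add x y => x.reads σ ∪ y.reads σ
  | .sub x y => x.reads σ ∪ y.reads σ

theorem Exp.card_reads_le (σ : Mem) (x : Exp) : (x.reads σ).card ≤ x.cost := by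
  induction x with
  | lit k => simp [reads]
  | read a i ih => exact (Finset.card_insert_le _ _).trans (Nat.succ_le_succ ih)
  | add x y hx hy => exact (Finset.card_union_le _ _).trans (by simp only [cost]; omega)
  | sub x y hx hy => exact (Finset.card_union_le _ _).trans (by simp only [cost]; omega)

theorem Exp.val_congr {σ σ' : Mem} (x : Exp) (h : ∀ c ∈ x.reads σ, σ' c.1 c.2 = σ c.1 c.2) :
    x.val σ' = x.val σ := by
  induction x with
  | lit k => rfl
  | read a i ih =>
    simp only [reads, Finset.mem_insert, forall_eq_or_imp] at h
    simp only [val, ih h.2, h.1]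
  | add x y hx hy =>
    simp only [reads, Finset.mem_union] at h
    simp only [val, hx fun c hc => h c (Or.inl hc), hy fun c hc => h c (Or.inr hc)]
  | sub x y hx hy =>
    simp only [reads, Finset.mem_union] at h
    simp only [val, hx fun c hc => h c (Or.inl hc), hy fun c hc => h c (Or.inr hc)]

theorem Mem.write_apply (σ : Mem) (a i x b j : ℕ) :
    σ.write a i x b j = if b = a ∧ j = i then x else σ b j := by
  unfold Mem.write
  by_cases hb : b = a
  · subst hb
    by_cases hj : j = i <;> simp [hj]
  · simp [hb]

/-- A run reads at most as many cells as it has steps, and depends on these only. -/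
theorem Run.exists_support {p : Prog} {σ : Mem} {t : ℕ} {τ : Mem} (h : Run p σ t τ) :
    ∃ R : Finset (ℕ × ℕ), R.card ≤ t ∧ ∀ σ' : Mem, (∀ c ∈ R, σ' c.1 c.2 = σ c.1 c.2) →
      ∃ τ', Run p σ' t τ' ∧ ∀ a i, σ' a i = σ a i → τ' a i = τ a i := by
  classical
  induction h with
  | skip σ => exact ⟨∅, by simp, fun σ' _ => ⟨σ', Run.skip σ', fun _ _ h => h⟩⟩
  | write a i x σ =>
    refine ⟨i.reads σ ∪ x.reads σ, ?_, fun σ' h => ?_⟩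
    · have h1 := Finset.card_union_le (i.reads σ) (x.reads σ)
      have := i.card_reads_le σ
      have := x.card_reads_le σ
      omega
    · have hi := i.val_congr fun c hc => h c (Finset.mem_union_left _ hc)
      have hx := x.val_congr fun c hc => h c (Finset.mem_union_right _ hc)
      refine ⟨_, Run.write a i x σ', fun b j hbj => ?_⟩
      simp only [Mem.write_apply, hi, hx, hbj]
  | seq _ _ ih₁ ih₂ =>
    obtain ⟨R₁, c₁, h₁⟩ := ih₁
    obtain ⟨R₂, c₂, h₂⟩ := ih₂
    refine ⟨R₁ ∪ R₂, (Finset.card_union_le _ _).trans (by omega), fun σ' h => ?_⟩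
    obtain ⟨τ', r₁, e₁⟩ := h₁ σ' fun c hc => h c (Finset.mem_union_left _ hc)
    obtain ⟨υ', r₂, e₂⟩ := h₂ τ' fun c hc => e₁ _ _ (h c (Finset.mem_union_right _ hc))
    exact ⟨υ', r₁.seq r₂, fun a i hai => e₂ _ _ (e₁ _ _ hai)⟩
  | @ite_pos b p q σ τ t hb _ ih =>
    obtain ⟨R, c, h⟩ := ih
    refine ⟨b.reads σ ∪ R, ?_, fun σ' h' => ?_⟩
    · have h1 := Finset.card_union_le (b.reads σ) R
      have := b.card_reads_le σ
      omega
    · have hv := b.val_congr fun c hc => h' c (Finset.mem_union_left _ hc)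
      obtain ⟨τ', r, e⟩ := h σ' fun c hc => h' c (Finset.mem_union_right _ hc)
      exact ⟨τ', Run.ite_pos (hv ▸ hb) r, e⟩
  | @ite_neg b p q σ τ t hb _ ih =>
    obtain ⟨R, c, h⟩ := ih
    refine ⟨b.reads σ ∪ R, ?_, fun σ' h' => ?_⟩
    · have h1 := Finset.card_union_le (b.reads σ) R
      have := b.card_reads_le σ
      omega
    · have hv := b.val_congr fun c hc => h' c (Finset.mem_union_left _ hc)
      obtain ⟨τ', r, e⟩ := h σ' fun c hc => h' c (Finset.mem_union_right _ hc)
      exact ⟨τ', Run.ite_neg (hv.trans hb) r, e⟩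
  | @loop_exit b p σ hb =>
    refine ⟨b.reads σ, (b.card_reads_le σ).trans (Nat.le_succ _), fun σ' h' => ?_⟩
    exact ⟨σ', Run.loop_exit ((b.val_congr h').trans hb), fun _ _ h => h⟩
  | @loop_step b p σ τ υ s t hb _ _ ih₁ ih₂ =>
    obtain ⟨R₁, c₁, h₁⟩ := ih₁
    obtain ⟨R₂, c₂, h₂⟩ := ih₂
    refine ⟨b.reads σ ∪ (R₁ ∪ R₂), ?_, fun σ' h => ?_⟩
    · have h1 := Finset.card_union_le (b.reads σ) (R₁ ∪ R₂)
      have h2 := Finset.card_union_le R₁ R₂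
      have := b.card_reads_le σ
      omega
    · have hv := b.val_congr fun c hc => h c (Finset.mem_union_left _ hc)
      obtain ⟨τ', r₁, e₁⟩ := h₁ σ' fun c hc =>
        h c (Finset.mem_union_right _ (Finset.mem_union_left _ hc))
      obtain ⟨υ', r₂, e₂⟩ := h₂ τ' fun c hc =>
        e₁ _ _ (h c (Finset.mem_union_right _ (Finset.mem_union_right _ hc)))
      exact ⟨υ', Run.loop_step (hv ▸ hb) r₁ r₂, fun a i hai => e₂ _ _ (e₁ _ _ hai)⟩

theorem Run.one_le {p : Prog} {σ : Mem} {t : ℕ} {τ : Mem} (h : Run p σ t τ) : 1 ≤ t := by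
  induction h <;> omega

/-! ### Weighted execution times -/

/-- The total cost of all instructions of a program, each counted once. -/
def Prog.weight : Prog → ℕ
  | .skip => 1
  | .write _ i x => i.cost + x.cost + 1
  | .seq p q => p.weight + q.weight
  | .ite b p q => b.cost + 1 + p.weight + q.weight
  | .loop b p => b.cost + 1 + p.weight

/-- Started in `σ`, the program halts in `τ`, after at most `S` times its weight steps. -/
def Exec (p : Prog) (σ τ : Mem) (S : ℕ) : Prop :=
  ∃ t, Run p σ t τ ∧ t ≤ p.weight * S

theorem Prog.one_le_weight (p : Prog) : 1 ≤ p.weight := by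
  induction p <;> simp only [weight] <;> omega

theorem Exec.seq {p q : Prog} {σ τ υ : Mem} {S : ℕ} (h₁ : Exec p σ τ S) (h₂ : Exec q τ υ S) :
    Exec (.seq p q) σ υ S := by
  obtain ⟨s, r₁, b₁⟩ := h₁
  obtain ⟨t, r₂, b₂⟩ := h₂
  exact ⟨s + t, r₁.seq r₂, by rw [Prog.weight, Nat.add_mul]; omega⟩

theorem Exec.write {a : ℕ} {i x : Exp} {σ : Mem} {S : ℕ} (hS : 1 ≤ S) :
    Exec (.write a i x) σ (σ.write a (i.val σ) (x.val σ)) S :=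
  ⟨_, Run.write a i x σ, Nat.le_mul_of_pos_right _ hS⟩

theorem Exec.of_run {p : Prog} {σ τ : Mem} {t S : ℕ} (h : Run p σ t τ) (hS : t ≤ S) :
    Exec p σ τ S :=
  ⟨t, h, hS.trans (Nat.le_mul_of_pos_left _ p.one_le_weight)⟩

/-- A loop with an invariant that counts the iterations. -/
theorem exists_run_loop (b : Exp) (p : Prog) (w : ℕ) (n : ℕ) : ∀ (P : ℕ → Mem → Prop),
    (∀ k < n, ∀ σ, P k σ → b.val σ ≠ 0) → (∀ σ, P n σ → b.val σ = 0) →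
    (∀ k < n, ∀ σ, P k σ → ∃ t τ, Run p σ t τ ∧ t ≤ w ∧ P (k + 1) τ) → ∀ σ, P 0 σ →
    ∃ t τ, Run (.loop b p) σ t τ ∧ t ≤ n * (b.cost + 1 + w) + (b.cost + 1) ∧ P n τ := by
  induction n with
  | zero =>
    intro P _ hn _ σ h
    exact ⟨_, σ, Run.loop_exit (hn σ h), by omega, h⟩
  | succ n ih =>
    intro P hb hn hstep σ h
    obtain ⟨s, τ, r₁, hs, h₁⟩ := hstep 0 (Nat.succ_pos n) σ h
    obtain ⟨t, υ, r₂, ht, h₂⟩ := ih (fun k => P (k + 1)) (fun k hk => hb (k + 1) (by omega)) hn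
      (fun k hk => hstep (k + 1) (by omega)) τ h₁
    refine ⟨_, υ, Run.loop_step (hb 0 (Nat.succ_pos n) σ h) r₁ r₂, ?_, h₂⟩
    rw [Nat.succ_mul]
    omega

/-! ### Nested loops that fill an array -/

/-- The loop counters: `0` and `1` for the outer and the inner loop, `2` for the total. -/
def reg (r : ℕ) : Exp := .read 8 (.lit r)

/-- `reg r := reg r + 1`. -/
def incReg (r : ℕ) : Prog := .write 8 (.lit r) (.add (reg r) (.lit 1))

/-- The program that executes `a[idx] := val` for all `i < I` and `j < J`. -/
def fill (a : ℕ) (I J idx val : Exp) : Prog :=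
  .seq (.write 8 (.lit 2) (.lit 0)) <| .seq (.write 8 (.lit 0) (.lit 0)) <|
    .loop (.sub I (reg 0)) <| .seq (.write 8 (.lit 1) (.lit 0)) <|
      .seq (.loop (.sub J (reg 1)) (.seq (.write a idx val) (.seq (incReg 1) (incReg 2))))
        (incReg 0)

theorem Mem.write_of_ne (σ : Mem) {a b : ℕ} (i x : ℕ) (h : b ≠ a) : σ.write a i x b = σ b :=
  Function.update_of_ne h _ _

theorem Mem.write_same (σ : Mem) (a i x : ℕ) :
    σ.write a i x a = Function.update (σ a) i x :=
  Function.update_self _ _ _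

/-- The invariant `P` is indexed by the number of cells treated so far, so the end of a row needs no
case of its own. The bounds `I` and `J` are evaluated again in every round; hence they must not
depend on array `a` or on the counters. -/
theorem exists_exec_fill {a : ℕ} {I J idx val : Exp} {σ : Mem} {S : ℕ} (nI nJ : ℕ)
    (P : ℕ → (ℕ → ℕ) → Prop) (ha : a ≠ 8)
    (hI : ∀ μ : Mem, (∀ b, b ≠ a → b ≠ 8 → μ b = σ b) → I.val μ = nI)
    (hJ : ∀ μ : Mem, (∀ b, b ≠ a → b ≠ 8 → μ b = σ b) → J.val μ = nJ)
    (hS : nI * nJ + nI + 1 ≤ S) (h0 : P 0 (σ a))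
    (hstep : ∀ i < nI, ∀ j < nJ, ∀ μ : Mem, (∀ b, b ≠ a → b ≠ 8 → μ b = σ b) → μ 8 0 = i →
      μ 8 1 = j → μ 8 2 = i * nJ + j → P (i * nJ + j) (μ a) →
      P (i * nJ + j + 1) (Function.update (μ a) (idx.val μ) (val.val μ))) :
    ∃ τ, Exec (fill a I J idx val) σ τ S ∧ (∀ b, b ≠ a → b ≠ 8 → τ b = σ b) ∧
      P (nI * nJ) (τ a) := by
  have ha' : 8 ≠ a := ha.symm
  set wb := (Prog.seq (.write a idx val) (.seq (incReg 1) (incReg 2))).weight with hwb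
  have inner : ∀ i < nI, ∀ μ : Mem, (∀ b, b ≠ a → b ≠ 8 → μ b = σ b) → μ 8 0 = i →
      μ 8 1 = 0 → μ 8 2 = i * nJ → P (i * nJ) (μ a) →
      ∃ t τ, Run (.loop (.sub J (reg 1)) (.seq (.write a idx val) (.seq (incReg 1) (incReg 2))))
        μ t τ ∧ t ≤ nJ * ((Exp.sub J (reg 1)).cost + 1 + wb) + ((Exp.sub J (reg 1)).cost + 1) ∧
        ((∀ b, b ≠ a → b ≠ 8 → τ b = σ b) ∧ τ 8 0 = i ∧ τ 8 1 = nJ ∧ τ 8 2 = i * nJ + nJ ∧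
          P (i * nJ + nJ) (τ a)) := by
    intro i hi μ h1 h2 h3 h4 h5
    refine exists_run_loop _ _ wb nJ (fun j τ => (∀ b, b ≠ a → b ≠ 8 → τ b = σ b) ∧ τ 8 0 = i ∧
      τ 8 1 = j ∧ τ 8 2 = i * nJ + j ∧ P (i * nJ + j) (τ a)) ?_ ?_ ?_ μ ⟨h1, h2, h3, h4, h5⟩
    · rintro j hj τ ⟨e1, -, e3, -⟩
      simp only [Exp.val, reg, hJ τ e1, e3]; omega
    · rintro τ ⟨e1, -, e3, -⟩
      simp only [Exp.val, reg, hJ τ e1, e3]; omega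
    · rintro j hj τ ⟨e1, e2, e3, e4, e5⟩
      refine ⟨_, _, (Run.write a idx val τ).seq ((Run.write _ _ _ _).seq (Run.write _ _ _ _)),
        le_rfl, ?_, ?_, ?_, ?_, ?_⟩
      · intro b hb hb'
        rw [Mem.write_of_ne _ _ _ hb', Mem.write_of_ne _ _ _ hb', Mem.write_of_ne _ _ _ hb]
        exact e1 b hb hb'
      · simp [Mem.write_apply, Exp.val, reg, ha', e2]
      · simp [Mem.write_apply, Exp.val, reg, ha', e3]
      · simp [Mem.write_apply, Exp.val, reg, ha', e4, Nat.add_assoc]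
      · rw [Mem.write_of_ne _ _ _ ha, Mem.write_of_ne _ _ _ ha, Mem.write_same]
        exact hstep i hi j hj τ e1 e2 e3 e4 e5
  set w := 3 + (nJ * ((Exp.sub J (reg 1)).cost + 1 + wb) + ((Exp.sub J (reg 1)).cost + 1)) +
    (incReg 0).weight with hw
  obtain ⟨t, τ, r, ht, e1, -, e3⟩ := exists_run_loop (.sub I (reg 0))
    (.seq (.write 8 (.lit 1) (.lit 0)) <|
      .seq (.loop (.sub J (reg 1)) (.seq (.write a idx val) (.seq (incReg 1) (incReg 2))))
        (incReg 0)) w nI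
    (fun i τ => (∀ b, b ≠ a → b ≠ 8 → τ b = σ b) ∧ (τ 8 0 = i ∧ τ 8 2 = i * nJ) ∧
      P (i * nJ) (τ a)) (by
        rintro i hi τ ⟨e1, ⟨e2, -⟩, -⟩
        simp only [Exp.val, reg, hI τ e1, e2]; omega) (by
        rintro τ ⟨e1, ⟨e2, -⟩, -⟩
        simp only [Exp.val, reg, hI τ e1, e2]; omega) (by
        rintro i hi τ ⟨e1, ⟨e2, e3⟩, e4⟩
        obtain ⟨t, υ, r, ht, f1, f2, f3, f4, f5⟩ := inner i hi (τ.write 8 1 0)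
          (fun b hb hb' => by rw [Mem.write_of_ne _ _ _ hb']; exact e1 b hb hb')
          (by simp [Mem.write_apply, e2]) (by simp [Mem.write_apply])
          (by simp [Mem.write_apply, e3]) (by rw [Mem.write_of_ne _ _ _ ha]; exact e4)
        refine ⟨_, _, (Run.write 8 (.lit 1) (.lit 0) τ).seq (r.seq (Run.write _ _ _ _)), ?_,
          ?_, ⟨?_, ?_⟩, ?_⟩
        · have e : (incReg 0).weight = (Exp.lit 0).cost + ((reg 0).add (.lit 1)).cost + 1 := rfl
          have e' : ∀ k, (Exp.lit k).cost = 1 := fun _ => rfl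
          rw [hw, e]
          simp only [e']
          omega
        · intro b hb hb'
          rw [Mem.write_of_ne _ _ _ hb']; exact f1 b hb hb'
        · simp [Mem.write_apply, Exp.val, reg, f2]
        · simp [Mem.write_apply, f4, Nat.succ_mul, Exp.val]
        · rw [Mem.write_of_ne _ _ _ ha, Nat.succ_mul]; exact f5)
    ((σ.write 8 2 0).write 8 0 0) ⟨fun b hb hb' => by
      rw [Mem.write_of_ne _ _ _ hb', Mem.write_of_ne _ _ _ hb'], by simp [Mem.write_apply], by
      rw [Mem.write_of_ne _ _ _ ha, Mem.write_of_ne _ _ _ ha, Nat.zero_mul]; exact h0⟩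
  refine ⟨τ, ⟨_, (Run.write 8 (.lit 2) (.lit 0) σ).seq ((Run.write 8 (.lit 0) (.lit 0) _).seq r),
    ?_⟩, e1, e3⟩
  simp only [fill, Prog.weight] at *
  generalize (Exp.sub I (reg 0)).cost = cI at *
  generalize (Exp.sub J (reg 1)).cost = cJ at *
  generalize (incReg 0).weight = w0 at *
  have hwb' : idx.cost + val.cost + 1 + ((incReg 1).weight + (incReg 2).weight) = wb := by
    simp [hwb]
  rw [hwb']
  simp only [Exp.cost]
  -- No instruction or test is executed more than `nI * nJ + nI + 1` times, so each contributes at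
  -- most `S` times its own cost.
  calc 1 + 1 + 1 + (1 + 1 + 1 + t) ≤ 6 + (nI * (cI + 1 + w) + (cI + 1)) := by omega
    _ = 6 + (cI + 1) * (nI + 1) + (cJ + 1) * (nI * nJ + nI) + wb * (nI * nJ) + (3 + w0) * nI := by
      rw [hw]; ring
    _ ≤ 6 * S + (cI + 1) * S + (cJ + 1) * S + wb * S + (3 + w0) * S := by
      gcongr <;> omega
    _ = _ := by ring

end RAM

namespace GameIO

/-! ### A lower bound for solving Streett games -/

/-- The arena with a given list of edges. -/
def arenaOf {n m : ℕ} (own : Fin n → Fin 2) (e : Fin m → Fin n × Fin n)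
    (h : ∀ v, ∃ j, (e j).1 = v) : Arena (Fin n) where
  owner := own
  Edge v w := ∃ j, e j = (v, w)
  exists_edge v := by
    obtain ⟨j, hj⟩ := h v
    exact ⟨(e j).2, j, by rw [← hj]⟩

theorem isEdgeList_arenaOf {n m : ℕ} (own : Fin n → Fin 2) (e : Fin m → Fin n × Fin n)
    (h : ∀ v, ∃ j, (e j).1 = v) (he : Function.Injective e) : IsEdgeList (arenaOf own e h) e :=
  ⟨he, fun _ _ => Iff.rfl⟩

theorem mul_add_inj {n c c' v v' : ℕ} (hv : v < n) (hv' : v' < n) (h : c * n + v = c' * n + v') :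
    c = c' ∧ v = v' := by
  have h1 : (c * n + v) / n = c := by
    rw [Nat.add_comm, Nat.add_mul_div_right _ _ (by omega), Nat.div_eq_of_lt hv, Nat.zero_add]
  have h2 : (c' * n + v') / n = c' := by
    rw [Nat.add_comm, Nat.add_mul_div_right _ _ (by omega), Nat.div_eq_of_lt hv', Nat.zero_add]
  have : c = c' := by rw [← h1, ← h2, h]
  subst this
  exact ⟨rfl, by omega⟩

/-- Adversary argument. All vertices belong to Player `1`, every vertex has a self-loop, and the
only vertex `o` that makes requests is not connected to the others; there are no responses. So
Player `0` wins everywhere except at `o`. Changing a request cell of another vertex, or the head of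
an edge other than the loop at `o`, makes Player `0` lose somewhere else. Hence all these cells must
be read, and a run reads at most as many cells as it makes steps. -/
theorem le_time_of_solvesStreett {p : RAM.Prog} {T : ℕ → ℕ → ℕ → ℕ} (hp : SolvesStreett p T)
    {n m d : ℕ} (hn : 2 ≤ n) (hd : 1 ≤ d) (hnm : n ≤ m) (hm : m ≤ (n - 1) * (n - 1) + 1) :
    d * (n - 1) + (m - 1) ≤ T n m d := by
  classical
  let o : Fin n := ⟨0, by omega⟩
  -- All edges that do not connect `o` with the rest; their number is the upper bound imposed on
  -- `m`.
  let W : Finset (Fin n × Fin n) :=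
    insert (o, o) (Finset.univ.erase o ×ˢ Finset.univ.erase o)
  have hW : ∀ x ∈ W, (x.1 = o ↔ x.2 = o) := by
    intro x hx
    simp only [W, Finset.mem_insert, Finset.mem_product, Finset.mem_erase] at hx
    rcases hx with rfl | hx
    · simp
    · simp [hx.1.1, hx.2.1]
  have hWcard : W.card = (n - 1) * (n - 1) + 1 := by
    rw [Finset.card_insert_of_notMem (by simp), Finset.card_product,
      Finset.card_erase_of_mem (Finset.mem_univ _), Finset.card_univ, Fintype.card_fin]
  let Dg : Finset (Fin n × Fin n) := Finset.univ.image fun v => (v, v)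
  have hDg : Dg.card = n := by
    rw [Finset.card_image_of_injective _ (fun a b h => (Prod.mk.inj h).1), Finset.card_univ,
      Fintype.card_fin]
  have hDW : Dg ⊆ W := by
    intro x hx
    simp only [Dg, Finset.mem_image, Finset.mem_univ, true_and] at hx
    obtain ⟨v, rfl⟩ := hx
    by_cases h : v = o
    · subst h; simp [W]
    · simp [W, h]
  obtain ⟨E, hDE, hEW, hE⟩ := Finset.exists_subsuperset_card_eq hDW (hDg.trans_le hnm)
    (hm.trans_eq hWcard.symm)
  let f := E.equivFinOfCardEq hE
  let e : Fin m → Fin n × Fin n := fun j => (f.symm j).1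
  have heE : ∀ j, e j ∈ E := fun j => (f.symm j).2
  have he : Function.Injective e := Subtype.val_injective.comp f.symm.injective
  have hsurj : ∀ x ∈ E, ∃ j, e j = x := fun x hx => ⟨f ⟨x, hx⟩, by simp [e]⟩
  have hself : ∀ v, ∃ j, e j = (v, v) := fun v => hsurj _ (hDE (by simp [Dg]))
  have htail : ∀ v, ∃ j, (e j).1 = v := fun v => (hself v).imp fun j hj => by rw [hj]
  let own : Fin n → Fin 2 := fun _ => 1
  let Γ : StreettPairs d (Fin n) := ⟨fun _ => {o}, fun _ => ∅⟩
  obtain ⟨t, τ, hrun, htT, hsol⟩ := hp n m d (by omega) (arenaOf own e htail) e Γ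
    (isEdgeList_arenaOf own e htail he)
  refine le_trans ?_ htT
  have hzero : ∀ v : Fin n, v ≠ o → τ 7 v = 0 := by
    intro v hv
    obtain ⟨i, hi, hvi⟩ := hsol v
    rcases (by omega : i = 0 ∨ i = 1) with rfl | rfl
    · exact hi
    · exfalso
      refine Arena.winningRegion_disjoint _ _ v ?_ hvi
      obtain ⟨σ⟩ := (arenaOf own e htail).nonempty_strategy 0
      refine ⟨σ, fun ρ hρ h0 _ => ?_⟩
      have : ∀ k, ρ k ≠ o := by
        intro k
        induction k with
        | zero => rw [h0]; exact hv
        | succ k ih =>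
          obtain ⟨j, hj⟩ := hρ k
          have := hW _ (hEW (heE j))
          rw [hj] at this
          exact fun h => ih (this.2 h)
      simp only [Arena.WonBy, if_true]
      intro c hc
      obtain ⟨k, hk⟩ := hc.exists
      exact absurd hk (this k)
  obtain ⟨R, hR, hloc⟩ := hrun.exists_support
  -- the cells that describe requests away from `o`
  have hQ : ∀ (c : Fin d) (v : Fin n), v ≠ o → (4, (c : ℕ) * n + v) ∈ R := by
    intro c v hv
    by_contra hcon
    -- With this one additional request, Player `1` wins by staying at `v`. The solver would not
    -- notice the change.
    let Γ' : StreettPairs d (Fin n) := ⟨fun c' => {u | u = o ∨ (c' = c ∧ u = v)}, fun _ => ∅⟩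
    obtain ⟨τ', hrun', heq⟩ := hloc (streettInput (arenaOf own e htail) e Γ') (by
      rintro ⟨a, i⟩ hai
      simp only
      rcases a with _ | _ | _ | _ | _ | _ | a <;> try rfl
      have hne : i ≠ (c : ℕ) * n + v := fun h => hcon (h ▸ hai)
      simp only [streettInput]
      congr 1
      apply propext
      constructor
      · rintro ⟨c', u, rfl, h | ⟨rfl, rfl⟩⟩
        · exact ⟨c', u, rfl, h⟩
        · exact absurd rfl hne
      · rintro ⟨c', u, rfl, h⟩
        exact ⟨c', u, rfl, Or.inl h⟩)
    obtain ⟨t₂, τ₂, hrun₂, -, hsol₂⟩ := hp n m d (by omega) (arenaOf own e htail) e Γ'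
      (isEdgeList_arenaOf own e htail he)
    obtain ⟨-, rfl⟩ := hrun'.deterministic hrun₂
    obtain ⟨i, hi, σ, hσ⟩ := hsol₂ v
    rw [heq 7 v rfl, hzero v hv] at hi
    have hi0 : i = 0 := Fin.ext hi.symm
    subst hi0
    have := hσ (fun _ => v) (fun _ => hself v) rfl
      (fun _ h => absurd h (by decide : (1 : Fin 2) ≠ 0))
    simp only [Arena.WonBy, if_true] at this
    exact (this c (Frequently.of_forall fun _ => Or.inr ⟨rfl, rfl⟩)).exists.elim fun _ h => h
  have hH : ∀ j : Fin m, e j ≠ (o, o) → (3, (j : ℕ)) ∈ R := by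
    intro j hj
    by_contra hcon
    have hu : (e j).1 ≠ o := fun h =>
      hj (Prod.ext h ((hW _ (hEW (heE j))).1 h))
    -- The edge `j` is bent towards `o`, where Player `1` can then stay forever. Tails are
    -- unchanged, so every vertex keeps an outgoing edge.
    let e' : Fin m → Fin n × Fin n := Function.update e j ((e j).1, o)
    have hnot : ∀ k, e k ≠ ((e j).1, o) := by
      intro k hk
      have := hW _ (hEW (heE k))
      rw [hk] at this
      exact hu (this.2 rfl)
    have he' : Function.Injective e' := by
      intro a b hab
      simp only [e', Function.update_apply] at hab
      split_ifs at hab with h1 h2 h2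
      · rw [h1, h2]
      · exact absurd hab.symm (hnot b)
      · exact absurd hab (hnot a)
      · exact he hab
    have htail' : ∀ v, ∃ j, (e' j).1 = v := by
      intro v
      obtain ⟨k, hk⟩ := htail v
      refine ⟨k, ?_⟩
      by_cases h : k = j
      · subst h; simpa [e'] using hk
      · simpa [e', h] using hk
    obtain ⟨τ', hrun', heq⟩ := hloc (streettInput (arenaOf own e' htail') e' Γ) (by
      rintro ⟨a, i⟩ hai
      simp only
      rcases a with _ | _ | _ | _ | _ | _ | a <;> try rfl
      · simp only [streettInput, table]
        split_ifs with hi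
        · by_cases h : (⟨i, hi⟩ : Fin m) = j
          · simp [e', h]
          · simp [e', h]
        · rfl
      · simp only [streettInput, table]
        split_ifs with hi
        · have h : (⟨i, hi⟩ : Fin m) ≠ j := by
            rintro rfl
            exact hcon hai
          simp [e', h]
        · rfl)
    obtain ⟨t₂, τ₂, hrun₂, -, hsol₂⟩ := hp n m d (by omega) (arenaOf own e' htail') e' Γ
      (isEdgeList_arenaOf own e' htail' he')
    obtain ⟨-, rfl⟩ := hrun'.deterministic hrun₂
    obtain ⟨i, hi, σ, hσ⟩ := hsol₂ (e j).1
    rw [heq 7 _ rfl, hzero _ hu] at hi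
    have hi0 : i = 0 := Fin.ext hi.symm
    subst hi0
    have := hσ (fun k => if k = 0 then (e j).1 else o) (fun k => ?_) rfl
      (fun _ h => absurd h (by decide : (1 : Fin 2) ≠ 0))
    · simp only [Arena.WonBy, if_true] at this
      refine (this ⟨0, hd⟩ (Eventually.frequently ?_)).exists.elim fun _ h => h
      filter_upwards [eventually_ge_atTop 1] with k hk
      have : k ≠ 0 := by omega
      simp [Γ, this]
    · by_cases hk : k = 0
      · subst hk; exact ⟨j, by simp [e']⟩
      · obtain ⟨k₀, hk₀⟩ := hself o
        have : k₀ ≠ j := fun h => hj (h ▸ hk₀)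
        exact ⟨k₀, by simp [e', hk, this, hk₀]⟩
  obtain ⟨j₀, hj₀⟩ := hself o
  let g : (Fin d × {v : Fin n // v ≠ o}) ⊕ {j : Fin m // j ≠ j₀} → ℕ × ℕ :=
    Sum.elim (fun x => (4, (x.1 : ℕ) * n + x.2.1)) (fun j => (3, (j.1 : ℕ)))
  have hg : Function.Injective g := by
    rintro (⟨c, v⟩ | j) (⟨c', v'⟩ | j') h <;> simp only [g, Sum.elim_inl, Sum.elim_inr,
      Prod.mk.injEq] at h
    · obtain ⟨h1, h2⟩ := mul_add_inj v.1.2 v'.1.2 h.2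
      obtain rfl : c = c' := Fin.ext h1
      obtain rfl : v = v' := Subtype.ext (Fin.ext h2)
      rfl
    · omega
    · omega
    · obtain rfl : j = j' := Subtype.ext (Fin.ext h.2)
      rfl
  have hcard := Finset.card_le_card_of_injOn (s := Finset.univ) (t := R) g (by
    rintro (⟨c, v⟩ | j) _
    · exact hQ c v.1 v.2
    · refine hH j.1 fun h => j.2 (he (h.trans hj₀.symm))) hg.injOn
  rw [Finset.card_univ, Fintype.card_sum, Fintype.card_prod, Fintype.card_subtype_compl,
    Fintype.card_subtype_compl] at hcard
  simp only [Fintype.card_fin, Fintype.card_unique] at hcard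
  exact hcard.trans hR

end GameIO

namespace RAM

/-! ### Running a program in a private part of the memory, with a log of its writes -/

/-- The part of the memory that is seen by a relocated program. -/
def view (σ : Mem) : Mem := fun a => σ (48 + 2 * a)

/-- Relocation of array `a` to array `48 + 2 * a`. -/
def Exp.reloc : Exp → Exp
  | .lit k => .lit k
  | .read a i => .read (48 + 2 * a) i.reloc
  | .add x y => .add x.reloc y.reloc
  | .sub x y => .sub x.reloc y.reloc

theorem Exp.val_reloc (σ : Mem) (x : Exp) : x.reloc.val σ = x.val (view σ) := by
  induction x with
  | lit k => rfl
  | read a i ih => simp only [reloc, val, ih, view]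
  | add x y hx hy => simp only [reloc, val, hx, hy]
  | sub x y hx hy => simp only [reloc, val, hx, hy]

theorem Exp.cost_reloc (x : Exp) : x.reloc.cost = x.cost := by
  induction x with
  | lit k => rfl
  | read a i ih => simp only [reloc, cost, ih]
  | add x y hx hy => simp only [reloc, cost, hx, hy]
  | sub x y hx hy => simp only [reloc, cost, hx, hy]

/-- The length of the log of array `a`. -/
def logLen (a : ℕ) : Exp := .read (49 + 2 * a) (.lit 0)

/-- The relocated program, which logs the indices of the cells of array `a` that it overwrites in
the cells `1, 2, …` of array `49 + 2 * a` and their number in cell `0`. -/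
def Prog.logged : Prog → Prog
  | .skip => .skip
  | .write a i x => .seq (.write (49 + 2 * a) (.add (logLen a) (.lit 1)) i.reloc) <|
      .seq (.write (48 + 2 * a) i.reloc x.reloc)
        (.write (49 + 2 * a) (.lit 0) (.add (logLen a) (.lit 1)))
  | .seq p q => .seq p.logged q.logged
  | .ite b p q => .ite b.reloc p.logged q.logged
  | .loop b p => .loop b.reloc p.logged

/-- All arrays written by a program are below this bound. -/
def Prog.bound : Prog → ℕ
  | .skip => 0
  | .write a _ _ => a + 1
  | .seq p q => max p.bound q.bound
  | .ite _ p q => max p.bound q.bound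
  | .loop _ p => p.bound

/-- From `σ` to `σ'`, at most `t` cells of arrays below `B` have been overwritten and logged. -/
structure LogExtends (B : ℕ) (σ σ' : Mem) (t : ℕ) : Prop where
  low : ∀ b < 48, σ' b = σ b
  len_le : ∀ a, σ (49 + 2 * a) 0 ≤ σ' (49 + 2 * a) 0
  le_len : ∀ a, σ' (49 + 2 * a) 0 ≤ σ (49 + 2 * a) 0 + t
  old : ∀ a k, 1 ≤ k → k ≤ σ (49 + 2 * a) 0 → σ' (49 + 2 * a) k = σ (49 + 2 * a) k
  log : ∀ a i, view σ' a i ≠ view σ a i →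
    ∃ k, 1 ≤ k ∧ k ≤ σ' (49 + 2 * a) 0 ∧ σ' (49 + 2 * a) k = i
  high : ∀ a, B ≤ a → σ' (49 + 2 * a) 0 = σ (49 + 2 * a) 0 ∧ view σ' a = view σ a

theorem LogExtends.refl (B : ℕ) (σ : Mem) (t : ℕ) : LogExtends B σ σ t :=
  ⟨fun _ _ => rfl, fun _ => le_rfl, fun _ => Nat.le_add_right _ _, fun _ _ _ _ => rfl,
    fun _ _ h => absurd rfl h, fun _ _ => ⟨rfl, rfl⟩⟩

theorem LogExtends.trans {B : ℕ} {σ σ' σ'' : Mem} {s t : ℕ} (h₁ : LogExtends B σ σ' s)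
    (h₂ : LogExtends B σ' σ'' t) : LogExtends B σ σ'' (s + t) where
  low b hb := (h₂.low b hb).trans (h₁.low b hb)
  len_le a := (h₁.len_le a).trans (h₂.len_le a)
  le_len a := by have := h₁.le_len a; have := h₂.le_len a; omega
  old a k hk hk' := (h₂.old a k hk (hk'.trans (h₁.len_le a))).trans (h₁.old a k hk hk')
  log a i hi := by
    by_cases h : view σ'' a i = view σ' a i
    · obtain ⟨k, hk, hk', e⟩ := h₁.log a i (h ▸ hi)
      exact ⟨k, hk, hk'.trans (h₂.len_le a), (h₂.old a k hk hk').trans e⟩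
    · exact h₂.log a i h
  high a ha := ⟨(h₂.high a ha).1.trans (h₁.high a ha).1, (h₂.high a ha).2.trans (h₁.high a ha).2⟩

theorem LogExtends.mono {B B' : ℕ} {σ σ' : Mem} {s t : ℕ} (h : LogExtends B σ σ' s) (hB : B ≤ B')
    (hst : s ≤ t) : LogExtends B' σ σ' t :=
  { h with
    le_len := fun a => (h.le_len a).trans (Nat.add_le_add_left hst _)
    high := fun a ha => h.high a (hB.trans ha) }

/-- A logged write evaluates the index twice and updates the log at constant cost; `13` covers this,
because the original write costs at least one step itself. Other instructions keep their cost. -/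
theorem Run.exists_logged {p : Prog} {μ : Mem} {t : ℕ} {μ' : Mem} (h : Run p μ t μ') :
    ∀ σ, view σ = μ → ∃ t' σ', Run p.logged σ t' σ' ∧ t' ≤ 13 * t ∧ view σ' = μ' ∧
      LogExtends p.bound σ σ' t := by
  induction h with
  | skip μ => intro σ hσ; exact ⟨1, σ, Run.skip σ, by omega, hσ, LogExtends.refl _ _ _⟩
  | write a i x μ =>
    intro σ hσ
    have hne : ∀ b : ℕ, 48 + 2 * b ≠ 49 + 2 * a := fun b => by omega
    refine ⟨_, _, (Run.write _ _ _ _).seq ((Run.write _ _ _ _).seq (Run.write _ _ _ _)), ?_, ?_, ?_⟩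
    · simp only [logLen, Exp.cost, Exp.cost_reloc]; omega
    · have hv : view (σ.write (49 + 2 * a) ((logLen a).val σ + 1) (i.val μ)) = μ := by
        funext b
        rw [← hσ]
        exact Mem.write_of_ne _ _ _ (hne b)
      funext b
      simp only [view]
      rw [Mem.write_of_ne _ _ _ (hne b)]
      simp only [Exp.val_reloc, Exp.val, hσ, hv]
      by_cases hb : b = a
      · subst hb
        rw [Mem.write_same, Mem.write_same, Mem.write_of_ne _ _ _ (hne b)]
        rw [← hσ]; rfl
      · rw [Mem.write_of_ne _ _ _ (by omega), Mem.write_of_ne _ _ _ (hne b),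
          Mem.write_of_ne _ _ _ hb, ← hσ]; rfl
    · have hv : view (σ.write (49 + 2 * a) ((logLen a).val σ + 1) (i.val μ)) = μ := by
        funext b
        rw [← hσ]
        exact Mem.write_of_ne _ _ _ (hne b)
      simp only [Exp.val_reloc, Exp.val, hσ, hv]
      simp only [logLen, Exp.val]
      constructor
      · intro b hb
        rw [Mem.write_of_ne _ _ _ (by omega), Mem.write_of_ne _ _ _ (by omega),
          Mem.write_of_ne _ _ _ (by omega)]
      · intro b
        simp only [Mem.write_apply]
        split_ifs <;> first | omega | simp_all
      · intro b
        simp only [Mem.write_apply]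
        split_ifs <;> first | omega | simp_all
      · intro b k hk hk'
        simp only [Mem.write_apply]
        split_ifs <;> first | omega | rfl | (exfalso; obtain rfl : b = a := by omega
                                             omega)
      · intro b j hj
        simp only [view, Mem.write_apply] at hj ⊢
        have hba : b = a ∧ j = i.val μ := by
          by_contra hcon
          apply hj
          rw [if_neg (by omega), if_neg (by omega), if_neg (by omega)]
        obtain ⟨rfl, rfl⟩ := hba
        refine ⟨σ (49 + 2 * b) 0 + 1, by omega, ?_, ?_⟩
        · rw [if_pos (by simp), if_neg (by omega), if_neg (by omega)]
        · rw [if_neg (by omega), if_neg (by omega), if_pos (by simp)]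
      · intro b hb
        simp only [Prog.bound] at hb
        refine ⟨?_, ?_⟩
        · rw [Mem.write_of_ne _ _ _ (by omega), Mem.write_of_ne _ _ _ (by omega),
            Mem.write_of_ne _ _ _ (by omega)]
        · simp only [view]
          rw [Mem.write_of_ne _ _ _ (by omega), Mem.write_of_ne _ _ _ (by omega),
            Mem.write_of_ne _ _ _ (by omega)]
  | seq _ _ ih₁ ih₂ =>
    intro σ hσ
    obtain ⟨s', σ', r₁, b₁, e₁, l₁⟩ := ih₁ σ hσ
    obtain ⟨t', σ'', r₂, b₂, e₂, l₂⟩ := ih₂ σ' e₁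
    exact ⟨_, _, r₁.seq r₂, by omega, e₂,
      (l₁.mono (le_max_left _ _) le_rfl).trans (l₂.mono (le_max_right _ _) le_rfl)⟩
  | @ite_pos b p q μ μ' t hb _ ih =>
    intro σ hσ
    obtain ⟨t', σ', r, b₁, e, l⟩ := ih σ hσ
    refine ⟨_, _, Run.ite_pos (by rwa [Exp.val_reloc, hσ]) r, ?_, e,
      l.mono (le_max_left _ _) (by omega)⟩
    rw [Exp.cost_reloc]; omega
  | @ite_neg b p q μ μ' t hb _ ih =>
    intro σ hσ
    obtain ⟨t', σ', r, b₁, e, l⟩ := ih σ hσ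
    refine ⟨_, _, Run.ite_neg (by rwa [Exp.val_reloc, hσ]) r, ?_, e,
      l.mono (le_max_right _ _) (by omega)⟩
    rw [Exp.cost_reloc]; omega
  | loop_exit hb =>
    intro σ hσ
    refine ⟨_, σ, Run.loop_exit (by rwa [Exp.val_reloc, hσ]), ?_, hσ, LogExtends.refl _ _ _⟩
    rw [Exp.cost_reloc]; omega
  | loop_step hb _ _ ih₁ ih₂ =>
    intro σ hσ
    obtain ⟨s', σ', r₁, b₁, e₁, l₁⟩ := ih₁ σ hσ
    obtain ⟨t', σ'', r₂, b₂, e₂, l₂⟩ := ih₂ σ' e₁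
    refine ⟨_, _, Run.loop_step (by rwa [Exp.val_reloc, hσ]) r₁ r₂, ?_, e₂,
      (l₁.trans l₂).mono le_rfl (by omega)⟩
    rw [Exp.cost_reloc]; omega

/-- Empties the log of array `a` and clears all logged cells. -/
def clearArray (a : ℕ) : Prog :=
  .loop (logLen a) <| .seq (.write (48 + 2 * a) (.read (49 + 2 * a) (logLen a)) (.lit 0))
    (.write (49 + 2 * a) (.lit 0) (.sub (logLen a) (.lit 1)))

/-- The log is popped from its end. Only its length returns to `0`: stale entries stay behind, which
is harmless since logs are read only up to their length. -/
theorem exists_exec_clearArray (a : ℕ) (σ : Mem) {S : ℕ} (hS : σ (49 + 2 * a) 0 + 1 ≤ S) :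
    ∃ τ, Exec (clearArray a) σ τ S ∧ (∀ b, b ≠ 48 + 2 * a → b ≠ 49 + 2 * a → τ b = σ b) ∧
      τ (49 + 2 * a) 0 = 0 ∧ (∀ i, τ (48 + 2 * a) i = σ (48 + 2 * a) i ∨ τ (48 + 2 * a) i = 0) ∧
      ∀ k, 1 ≤ k → k ≤ σ (49 + 2 * a) 0 → τ (48 + 2 * a) (σ (49 + 2 * a) k) = 0 := by
  set n := σ (49 + 2 * a) 0 with hn
  have hne : 48 + 2 * a ≠ 49 + 2 * a := by omega
  obtain ⟨t, τ, r, ht, h1, h2, h3, h4, h5⟩ := exists_run_loop (logLen a)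
    (.seq (.write (48 + 2 * a) (.read (49 + 2 * a) (logLen a)) (.lit 0))
      (.write (49 + 2 * a) (.lit 0) (.sub (logLen a) (.lit 1)))) _ n
    (fun k τ => (∀ b, b ≠ 48 + 2 * a → b ≠ 49 + 2 * a → τ b = σ b) ∧ τ (49 + 2 * a) 0 = n - k ∧
      (∀ j, 1 ≤ j → τ (49 + 2 * a) j = σ (49 + 2 * a) j) ∧
      (∀ i, τ (48 + 2 * a) i = σ (48 + 2 * a) i ∨ τ (48 + 2 * a) i = 0) ∧
      ∀ j, n - k < j → j ≤ n → τ (48 + 2 * a) (σ (49 + 2 * a) j) = 0)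
    (by
      rintro k hk τ ⟨-, h2, -⟩
      simp only [logLen, Exp.val, h2]; omega) (by
      rintro τ ⟨-, h2, -⟩
      simp only [logLen, Exp.val, h2]; omega) (by
      rintro k hk τ ⟨h1, h2, h3, h4, h5⟩
      refine ⟨_, _, (Run.write _ _ _ _).seq (Run.write _ _ _ _), le_rfl, ?_, ?_, ?_, ?_, ?_⟩
      · intro b hb hb'
        rw [Mem.write_of_ne _ _ _ hb', Mem.write_of_ne _ _ _ hb]; exact h1 b hb hb'
      · simp only [logLen, Exp.val, Mem.write_apply, h2, hne.symm, true_and, false_and, if_true,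
          if_false]
        omega
      · intro j hj
        simp only [Exp.val, Mem.write_apply, hne.symm, true_and, false_and, if_false]
        rw [if_neg (by omega)]; exact h3 j hj
      · intro i
        simp only [Exp.val, Mem.write_apply, hne, true_and, false_and, if_false]
        split_ifs
        · exact Or.inr rfl
        · exact h4 i
      · intro j hj hj'
        simp only [logLen, Exp.val, Mem.write_apply, hne, true_and, false_and, if_false, h2]
        rw [h3 (n - k) (by omega)]
        split_ifs with h
        · rfl
        · refine h5 j ?_ hj'
          by_contra hcon
          exact h (by rw [show n - k = j by omega]))
    σ ⟨fun _ _ _ => rfl, by rw [Nat.sub_zero], fun _ _ => rfl, fun _ => Or.inl rfl,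
      fun j hj hj' => by omega⟩
  refine ⟨τ, ⟨t, r, ?_⟩, h1, by omega, h4, fun k hk hk' => h5 k (by omega) hk'⟩
  simp only [clearArray, Prog.weight]
  refine ht.trans ?_
  simp only [logLen, Exp.cost]
  calc _ = 14 * n + 3 := by ring
    _ ≤ 14 * S := by omega
    _ ≤ _ := by apply Nat.mul_le_mul_right; omega

/-- Clears the logged cells of the arrays below `B`. -/
def clearArrays : ℕ → Prog
  | 0 => .skip
  | B + 1 => .seq (clearArrays B) (clearArray B)

theorem exists_exec_clearArrays (B : ℕ) (σ : Mem) {S : ℕ} (h1 : 1 ≤ S)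
    (hS : ∀ a, σ (49 + 2 * a) 0 + 1 ≤ S) :
    ∃ τ, Exec (clearArrays B) σ τ S ∧ (∀ b < 48, τ b = σ b) ∧
      (∀ a, B ≤ a → τ (49 + 2 * a) = σ (49 + 2 * a) ∧ τ (48 + 2 * a) = σ (48 + 2 * a)) ∧
      ∀ a < B, τ (49 + 2 * a) 0 = 0 ∧
        (∀ i, τ (48 + 2 * a) i = σ (48 + 2 * a) i ∨ τ (48 + 2 * a) i = 0) ∧
        ∀ k, 1 ≤ k → k ≤ σ (49 + 2 * a) 0 → τ (48 + 2 * a) (σ (49 + 2 * a) k) = 0 := by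
  induction B with
  | zero =>
    exact ⟨σ, Exec.of_run (Run.skip σ) h1, fun _ _ => rfl, fun _ _ => ⟨rfl, rfl⟩,
      fun a ha => absurd ha (Nat.not_lt_zero a)⟩
  | succ B ih =>
    obtain ⟨τ, r, e1, e2, e3⟩ := ih
    obtain ⟨υ, r', f1, f2, f3, f4⟩ := exists_exec_clearArray B τ (S := S)
      (by rw [(e2 B le_rfl).1]; exact hS B)
    rw [(e2 B le_rfl).1] at f4
    rw [(e2 B le_rfl).2] at f3
    refine ⟨υ, r.seq r', fun b hb => ?_, fun a ha => ?_, fun a ha => ?_⟩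
    · rw [f1 b (by omega) (by omega)]; exact e1 b hb
    · rw [f1 _ (by omega) (by omega), f1 _ (by omega) (by omega)]
      exact e2 a (by omega)
    · rcases Nat.lt_succ_iff_lt_or_eq.1 ha with h | rfl
      · rw [f1 _ (by omega) (by omega), f1 _ (by omega) (by omega)]
        exact e3 a h
      · exact ⟨f2, f3, f4⟩

/-- After clearing, every cell has its old value or is `0`. -/
theorem exists_exec_clear {B : ℕ} {σ σ' : Mem} {t S : ℕ} (h : LogExtends B σ σ' t)
    (h0 : ∀ a, σ (49 + 2 * a) 0 = 0) (hS : t + 1 ≤ S) :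
    ∃ τ, Exec (clearArrays B) σ' τ S ∧ (∀ b < 48, τ b = σ' b) ∧ (∀ a, τ (49 + 2 * a) 0 = 0) ∧
      ∀ a i, view τ a i = view σ a i ∨ view τ a i = 0 := by
  obtain ⟨τ, r, e1, e2, e3⟩ := exists_exec_clearArrays B σ' (S := S) (by omega)
    (fun a => by have := h.le_len a; rw [h0] at this; omega)
  refine ⟨τ, r, e1, fun a => ?_, fun a i => ?_⟩
  · rcases lt_or_ge a B with ha | ha
    · exact (e3 a ha).1
    · rw [(e2 a ha).1, (h.high a ha).1, h0]
  · rcases lt_or_ge a B with ha | ha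
    · by_cases hi : view σ' a i = view σ a i
      · rw [← hi]; exact (e3 a ha).2.1 i
      · obtain ⟨k, hk, hk', rfl⟩ := h.log a i hi
        exact Or.inr ((e3 a ha).2.2 k hk hk')
    · left
      have := (h.high a ha).2
      rw [← this]
      exact congrFun (e2 a ha).2 i

end RAM

namespace RAM

/-! ### Filling arrays with prescribed contents -/

/-- Apart from array `a` and the counters, the memories are equal. -/
def Frame (a : ℕ) (σ μ : Mem) : Prop := ∀ b, b ≠ a → b ≠ 8 → μ b = σ b

/-- The program turns `σ` into a memory where the contents of array `a` satisfy `F`; apart from the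
counters the rest is unchanged. -/
def Sets (q : Prog) (σ : Mem) (S a : ℕ) (F : (ℕ → ℕ) → Prop) : Prop :=
  ∃ τ, Exec q σ τ S ∧ Frame a σ τ ∧ F (τ a)

section Fill

variable {a : ℕ} {I J idx val : Exp} {σ : Mem} {S : ℕ}

theorem sets_fill (nI nJ : ℕ) (P : ℕ → (ℕ → ℕ) → Prop) (ha : a ≠ 8)
    (hI : ∀ μ, Frame a σ μ → I.val μ = nI) (hJ : ∀ μ, Frame a σ μ → J.val μ = nJ)
    (hS : nI * nJ + nI + 1 ≤ S) (h0 : P 0 (σ a))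
    (hstep : ∀ i < nI, ∀ j < nJ, ∀ μ, Frame a σ μ → μ 8 0 = i → μ 8 1 = j → μ 8 2 = i * nJ + j →
      P (i * nJ + j) (μ a) →
      P (i * nJ + j + 1) (Function.update (μ a) (idx.val μ) (val.val μ))) :
    Sets (fill a I J idx val) σ S a (P (nI * nJ)) :=
  exists_exec_fill nI nJ P ha hI hJ hS h0 hstep

theorem pair_lt_succ {nJ i j i' j' : ℕ} (hj : j < nJ) (hj' : j' < nJ)
    (h : i' * nJ + j' < i * nJ + j + 1) : i' * nJ + j' < i * nJ + j ∨ (i' = i ∧ j' = j) := by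
  rcases Nat.lt_succ_iff_lt_or_eq.1 h with h' | h'
  · exact Or.inl h'
  · exact Or.inr (GameIO.mul_add_inj hj' hj h')

theorem pair_lt {nI nJ i j : ℕ} (hi : i < nI) (hj : j < nJ) : i * nJ + j < nI * nJ :=
  calc i * nJ + j < i * nJ + nJ := by omega
    _ = (i + 1) * nJ := by ring
    _ ≤ nI * nJ := Nat.mul_le_mul_right _ hi

/-- Values `F i j` written to pairwise different cells `ι i j`. -/
theorem sets_scatter (nI nJ : ℕ) (ι F : ℕ → ℕ → ℕ) (ha : a ≠ 8)
    (hI : ∀ μ, Frame a σ μ → I.val μ = nI) (hJ : ∀ μ, Frame a σ μ → J.val μ = nJ)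
    (hS : nI * nJ + nI + 1 ≤ S)
    (hι : ∀ i < nI, ∀ j < nJ, ∀ i' < nI, ∀ j' < nJ, ι i j = ι i' j' → i = i' ∧ j = j')
    (hstep : ∀ i < nI, ∀ j < nJ, ∀ μ, Frame a σ μ → μ 8 0 = i → μ 8 1 = j → μ 8 2 = i * nJ + j →
      idx.val μ = ι i j ∧ val.val μ = F i j) :
    Sets (fill a I J idx val) σ S a fun g => (∀ i < nI, ∀ j < nJ, g (ι i j) = F i j) ∧
      ∀ x, (∀ i < nI, ∀ j < nJ, x ≠ ι i j) → g x = σ a x := by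
  obtain ⟨τ, h1, h2, h3, h4⟩ := sets_fill (a := a) (I := I) (J := J) (idx := idx)
    (val := val) (S := S) nI nJ
    (fun k g => (∀ i < nI, ∀ j < nJ, i * nJ + j < k → g (ι i j) = F i j) ∧
      ∀ x, (∀ i < nI, ∀ j < nJ, x ≠ ι i j) → g x = σ a x) ha hI hJ hS
    ⟨fun _ _ _ _ h => absurd h (Nat.not_lt_zero _), fun _ _ => rfl⟩ (by
      rintro i hi j hj μ hμ h1 h2 h3 ⟨h4, h5⟩
      obtain ⟨e1, e2⟩ := hstep i hi j hj μ hμ h1 h2 h3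
      rw [e1, e2]
      refine ⟨fun i' hi' j' hj' hlt => ?_, fun x hx => ?_⟩
      · rw [Function.update_apply]
        split_ifs with h
        · obtain ⟨rfl, rfl⟩ := hι i' hi' j' hj' i hi j hj h; rfl
        · rcases pair_lt_succ hj hj' hlt with h' | ⟨rfl, rfl⟩
          · exact h4 i' hi' j' hj' h'
          · exact absurd rfl h
      · rw [Function.update_of_ne (hx i hi j hj)]
        exact h5 x hx)
  exact ⟨τ, h1, h2, fun i hi j hj => h3 i hi j hj (pair_lt hi hj), h4⟩

/-- The cells `o, …, o + nI * nJ - 1` are filled in order. -/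
theorem sets_table (nI nJ o : ℕ) (F : ℕ → ℕ → ℕ) (ha : a ≠ 8)
    (hI : ∀ μ, Frame a σ μ → I.val μ = nI) (hJ : ∀ μ, Frame a σ μ → J.val μ = nJ)
    (hS : nI * nJ + nI + 1 ≤ S)
    (hstep : ∀ i < nI, ∀ j < nJ, ∀ μ, Frame a σ μ → μ 8 0 = i → μ 8 1 = j → μ 8 2 = i * nJ + j →
      idx.val μ = o + (i * nJ + j) ∧ val.val μ = F i j) :
    Sets (fill a I J idx val) σ S a fun g => (∀ i < nI, ∀ j < nJ, g (o + (i * nJ + j)) = F i j) ∧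
      ∀ x, (x < o ∨ o + nI * nJ ≤ x) → g x = σ a x := by
  obtain ⟨τ, h1, h2, h3, h4⟩ := sets_scatter (a := a) (I := I) (J := J) (idx := idx) (val := val)
    (S := S) nI nJ (fun i j => o + (i * nJ + j)) F ha hI hJ hS
    (fun i _ j hj i' _ j' hj' h => GameIO.mul_add_inj hj hj' (Nat.add_left_cancel h)) hstep
  refine ⟨τ, h1, h2, h3, fun x hx => h4 x fun i hi j hj e => ?_⟩
  have := pair_lt hi hj
  omega

/-- The recursion `f (k + 1) = val`, where `val` may depend on `f k`. -/
theorem sets_scan (L : ℕ) (f : ℕ → ℕ) (ha : a ≠ 8)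
    (hJ : ∀ μ, Frame a σ μ → J.val μ = L) (hS : L + 2 ≤ S) (h0 : σ a 0 = f 0)
    (hstep : ∀ k < L, ∀ μ, Frame a σ μ → μ 8 1 = k → μ a k = f k → val.val μ = f (k + 1)) :
    Sets (fill a (.lit 1) J (.add (reg 1) (.lit 1)) val) σ S a fun g => ∀ k ≤ L, g k = f k := by
  obtain ⟨τ, h1, h2, h3⟩ := sets_fill (a := a) (I := .lit 1) (J := J)
    (idx := .add (reg 1) (.lit 1)) (val := val) (S := S) 1 L
    (fun k g => ∀ x ≤ k, g x = f x) ha (fun _ _ => rfl) hJ (by omega)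
    (fun x hx => by rw [Nat.le_zero.1 hx, h0]) (by
      rintro i hi j hj μ hμ - h2 - h4
      obtain rfl : i = 0 := by omega
      rw [Nat.zero_mul, Nat.zero_add] at h4 ⊢
      have e := hstep j hj μ hμ h2 (h4 j le_rfl)
      intro x hx
      have e' : (Exp.add (reg 1) (.lit 1)).val μ = j + 1 := by
        simp only [reg, Exp.val, h2]
      rw [e, e', Function.update_apply]
      split_ifs with h
      · rw [h]
      · exact h4 x (by omega))
  exact ⟨τ, h1, h2, fun k hk => h3 k (by omega)⟩

/-- The maximum of two expressions. -/
def maxE (x y : Exp) : Exp := .add x (.sub y x)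

open Classical in
/-- The indicator of a proposition. -/
noncomputable def ind (p : Prop) : ℕ := if p then 1 else 0

theorem ind_pos {p : Prop} (h : p) : ind p = 1 := if_pos h

theorem ind_neg {p : Prop} (h : ¬ p) : ind p = 0 := if_neg h

theorem ind_congr {p q : Prop} (h : p ↔ q) : ind p = ind q := by rw [propext h]

/-- With truncated subtraction, this and the next identities turn the Boolean operations on
indicators into arithmetic of the machine. -/
theorem max_ind (p q : Prop) : ind p + (ind q - ind p) = ind (p ∨ q) := by
  by_cases hp : p <;> by_cases hq : q <;> simp [ind, hp, hq]

theorem and_ind (p q : Prop) : ind p + ind q - 1 = ind (p ∧ q) := by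
  by_cases hp : p <;> by_cases hq : q <;> simp [ind, hp, hq]

theorem not_ind (p : Prop) : 1 - ind p = ind (¬ p) := by
  by_cases hp : p <;> simp [ind, hp]

theorem diff_ind (p q : Prop) : ind p - ind q = ind (p ∧ ¬ q) := by
  by_cases hp : p <;> by_cases hq : q <;> simp [ind, hp, hq]

/-- Marking the cells `ι i j` for which `R i j` holds. -/
theorem sets_mark (nI nJ : ℕ) (R : ℕ → ℕ → Prop) (ι : ℕ → ℕ → ℕ) (ha : a ≠ 8)
    (hI : ∀ μ, Frame a σ μ → I.val μ = nI) (hJ : ∀ μ, Frame a σ μ → J.val μ = nJ)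
    (hS : nI * nJ + nI + 1 ≤ S) (h0 : ∀ x, σ a x = 0)
    (hstep : ∀ i < nI, ∀ j < nJ, ∀ μ, Frame a σ μ → μ 8 0 = i → μ 8 1 = j → μ 8 2 = i * nJ + j →
      idx.val μ = ι i j ∧ val.val μ = ind (R i j)) :
    Sets (fill a I J idx (maxE (.read a idx) val)) σ S a fun g =>
      ∀ x, g x = ind (∃ i < nI, ∃ j < nJ, x = ι i j ∧ R i j) := by
  obtain ⟨τ, h1, h2, h3⟩ := sets_fill (a := a) (I := I) (J := J) (idx := idx)
    (val := maxE (.read a idx) val) (S := S) nI nJ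
    (fun k h => ∀ x, h x = ind (∃ i < nI, ∃ j < nJ, i * nJ + j < k ∧ x = ι i j ∧ R i j))
    ha hI hJ hS
    (fun x => by
      rw [h0, ind_neg]
      rintro ⟨i, -, j, -, h, -⟩
      exact Nat.not_lt_zero _ h) (by
      rintro i hi j hj μ hμ h1 h2 h3 h4 x
      obtain ⟨e1, e2⟩ := hstep i hi j hj μ hμ h1 h2 h3
      simp only [maxE, Exp.val, e1, e2, h4, Function.update_apply, max_ind]
      split_ifs with hx
      · subst hx
        apply ind_congr
        constructor
        · rintro (⟨i', hi', j', hj', h5, h6⟩ | h5)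
          · exact ⟨i', hi', j', hj', by omega, h6⟩
          · exact ⟨i, hi, j, hj, by omega, rfl, h5⟩
        · rintro ⟨i', hi', j', hj', h5, h6, h7⟩
          rcases pair_lt_succ hj hj' h5 with h' | ⟨rfl, rfl⟩
          · exact Or.inl ⟨i', hi', j', hj', h', h6, h7⟩
          · exact Or.inr h7
      · apply ind_congr
        constructor
        · rintro ⟨i', hi', j', hj', h5, h6⟩
          exact ⟨i', hi', j', hj', by omega, h6⟩
        · rintro ⟨i', hi', j', hj', h5, h6, h7⟩
          rcases pair_lt_succ hj hj' h5 with h' | ⟨rfl, rfl⟩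
          · exact ⟨i', hi', j', hj', h', h6, h7⟩
          · exact absurd h6 hx)
  refine ⟨τ, h1, h2, fun x => ?_⟩
  rw [h3 x]
  apply ind_congr
  constructor
  · rintro ⟨i, hi, j, hj, -, h⟩
    exact ⟨i, hi, j, hj, h⟩
  · rintro ⟨i, hi, j, hj, h⟩
    exact ⟨i, hi, j, hj, pair_lt hi hj, h⟩

/-- Repeated update of all cells of an array. -/
theorem sets_rows (nI nJ : ℕ) (H : ℕ → ℕ → ℕ) (ha : a ≠ 8)
    (hI : ∀ μ, Frame a σ μ → I.val μ = nI) (hJ : ∀ μ, Frame a σ μ → J.val μ = nJ)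
    (hS : nI * nJ + nI + 1 ≤ S) (h0 : ∀ y < nJ, σ a y = H 0 y)
    (hstep : ∀ i < nI, ∀ j < nJ, ∀ μ, Frame a σ μ → μ 8 0 = i → μ 8 1 = j →
      μ a j = H i j → val.val μ = H (i + 1) j) :
    Sets (fill a I J (reg 1) val) σ S a fun g => ∀ y < nJ, g y = H nI y := by
  obtain ⟨τ, h1, h2, h3⟩ := sets_fill (a := a) (I := I) (J := J) (idx := reg 1)
    (val := val) (S := S) nI nJ
    (fun k h => ∀ i j, j ≤ nJ → k = i * nJ + j → ∀ y < nJ, h y = if y < j then H (i + 1) y else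
      H i y) ha hI hJ hS
    (fun i j hj hk y hy => by
      have hj0 : j = 0 := by omega
      have hi0 : i = 0 := by
        have : i * nJ = 0 := by omega
        rcases Nat.mul_eq_zero.1 this with h | h
        · exact h
        · omega
      subst hj0 hi0
      rw [if_neg (Nat.not_lt_zero y)]; exact h0 y hy) (by
      rintro i hi j hj μ hμ h1 h2 - h4 i' j' hj' hk y hy
      have h5 := h4 i j hj.le rfl
      have e := hstep i hi j hj μ hμ h1 h2 (by rw [h5 j hj, if_neg (lt_irrefl j)])
      have e' : (reg 1).val μ = j := by simp only [reg, Exp.val, h2]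
      rw [e, e', Function.update_apply]
      -- At the end of a row the same index reads as `(i, nJ)` and as `(i + 1, 0)`; the invariant
      -- covers both readings, so both have to be treated.
      have hcase : (i' = i ∧ j' = j + 1) ∨ (i' = i + 1 ∧ j' = 0 ∧ j + 1 = nJ) := by
        rcases Nat.lt_or_ge j' nJ with h | h
        · rcases Nat.lt_or_ge (j + 1) nJ with h' | h'
          · obtain ⟨a1, a2⟩ := GameIO.mul_add_inj (c := i') (c' := i) (n := nJ) h h'
              (by rw [← hk]; omega)
            exact Or.inl ⟨a1, a2⟩
          · obtain ⟨a1, a2⟩ := GameIO.mul_add_inj (c := i') (c' := i + 1) (n := nJ) (v' := 0) h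
              (by omega) (by rw [← hk, Nat.succ_mul]; omega)
            exact Or.inr ⟨a1, a2, by omega⟩
        · obtain rfl : j' = nJ := by omega
          rcases Nat.lt_or_ge (j + 1) j' with h' | h'
          · obtain ⟨a1, a2⟩ := GameIO.mul_add_inj (c := i' + 1) (c' := i) (n := j') (v := 0)
              (v' := j + 1) (by omega) h' (by rw [Nat.succ_mul]; omega)
            omega
          · obtain ⟨a1, a2⟩ := GameIO.mul_add_inj (c := i' + 1) (c' := i + 1) (n := j') (v := 0)
              (v' := 0) (by omega) (by omega) (by rw [Nat.succ_mul, Nat.succ_mul]; omega)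
            exact Or.inl ⟨by omega, by omega⟩
      rcases hcase with ⟨rfl, rfl⟩ | ⟨rfl, rfl, h6⟩
      · split_ifs with c1 c2 c2
        · rw [c1]
        · omega
        · rw [h5 y hy, if_pos (by omega)]
        · rw [h5 y hy, if_neg (by omega)]
      · rw [if_neg (Nat.not_lt_zero y)]
        split_ifs with c1
        · rw [c1]
        · rw [h5 y hy, if_pos (by omega)])
  refine ⟨τ, h1, h2, fun y hy => ?_⟩
  rw [h3 nI 0 (Nat.zero_le _) rfl y hy, if_neg (Nat.not_lt_zero y)]

end Fill

end RAM

/-! ### The product with the sets of open requests, on natural numbers -/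

/-- A game with costs in terms of numbers: `own v` is the owner of the vertex `v < n`, `tl j` and
`hd j` are the endpoints of the edge `j < m`, and `q c`, `p c`, and `inc c` hold for the requests,
the responses, and the increment-edges of pair `c < d`. -/
structure NumGame where
  n : ℕ
  m : ℕ
  d : ℕ
  own : ℕ → ℕ
  tl : ℕ → ℕ
  hd : ℕ → ℕ
  q : ℕ → ℕ → Prop
  p : ℕ → ℕ → Prop
  inc : ℕ → ℕ → Prop

theorem Nat.exists_count_eq (P : ℕ → Prop) [DecidablePred P] {t m : ℕ} (h : t < Nat.count P m) :
    ∃ j < m, P j ∧ Nat.count P j = t := by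
  induction m with
  | zero => simp at h
  | succ m ih =>
    rcases Nat.lt_or_ge t (Nat.count P m) with h' | h'
    · obtain ⟨j, hj, h1, h2⟩ := ih h'
      exact ⟨j, by omega, h1, h2⟩
    · rw [Nat.count_succ] at h
      split_ifs at h with hm
      · exact ⟨m, by omega, hm, by omega⟩
      · omega

namespace NumGame

open Classical in
/-- The number with binary digits `b lo, b (lo + 1), …, b (lo + len - 1)`. -/
noncomputable def digits (b : ℕ → Prop) (lo len : ℕ) : ℕ :=
  Nat.ofBits fun k : Fin len => decide (b (lo + k))

theorem digits_lt (b : ℕ → Prop) (lo len : ℕ) : digits b lo len < 2 ^ len :=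
  Nat.ofBits_lt_two_pow _

theorem testBit_digits (b : ℕ → Prop) {c len : ℕ} (h : c < len) :
    (digits b 0 len).testBit c = true ↔ b c := by
  rw [digits, Nat.testBit_ofBits_lt _ _ h]
  simp

theorem digits_succ (b : ℕ → Prop) (lo len : ℕ) :
    digits b lo (len + 1) = 2 * digits b (lo + 1) len + RAM.ind (b lo) := by
  rw [digits, Nat.ofBits_succ, digits]
  congr 1
  · congr 2
    funext k
    simp only [Function.comp, Fin.val_succ, decide_eq_decide]
    rw [Nat.add_assoc lo 1, Nat.add_comm 1]
  · by_cases h : b lo <;> simp [RAM.ind, h]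

variable (G : NumGame)

/-- The vertex `w` has an incoming increment-edge. -/
def incIn (c w : ℕ) : Prop := ∃ j < G.m, w = G.hd j ∧ G.inc c j

/-- The vertex `w` has an incoming `ε`-edge. -/
def epsIn (c w : ℕ) : Prop := ∃ j < G.m, w = G.hd j ∧ ¬ G.inc c j

def mixed (w : ℕ) : Prop := ∃ c < G.d, G.incIn c w ∧ G.epsIn c w

def anyInc (j : ℕ) : Prop := ∃ c < G.d, G.inc c j

/-- The edge `j` is subdivided. -/
def sub (j : ℕ) : Prop := G.anyInc j ∧ G.mixed (G.hd j)

open Classical in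
/-- The number of subdivided edges before edge `j`. -/
noncomputable def cnt (j : ℕ) : ℕ := Nat.count G.sub j

/-- The number of subdivided edges. -/
noncomputable def s : ℕ := G.cnt G.m

noncomputable def nth (t : ℕ) : ℕ := Nat.nth G.sub t

/-- The number of vertices and midpoints. -/
noncomputable def N : ℕ := G.n + G.s

/-- The number of edges after the subdivision. -/
noncomputable def M : ℕ := G.m + G.s

/-- The number of sets of open requests. -/
def K : ℕ := 2 ^ G.d

/-- The tails of the edges after the subdivision. -/
def tail2 (j : ℕ) : ℕ := if j < G.m then G.tl j else G.n + (j - G.m)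

open Classical in
/-- The heads of the edges after the subdivision. -/
noncomputable def head2 (j : ℕ) : ℕ :=
  if j < G.m then (if G.sub j then G.n + G.cnt j else G.hd j) else G.hd (G.nth (j - G.m))

/-- The requests of the `2 * d` pairs of the product. -/
def req (c x : ℕ) : Prop :=
  if c < G.d then x < G.n ∧ G.q c x
  else (x < G.n ∧ G.incIn (c - G.d) x ∧ ¬ G.mixed x) ∨
    (G.n ≤ x ∧ x < G.N ∧ G.inc (c - G.d) (G.nth (x - G.n)))

/-- The responses of the first `d` pairs. -/
def resp (c x : ℕ) : Prop := x < G.n ∧ G.p c x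

/-- The open requests after vertex `x` if those before are `O`; a vertex in `D` forgets them. -/
noncomputable def nxt (D : Set ℕ) (O x : ℕ) : ℕ :=
  digits (fun c => (O.testBit c = true ∨ G.req c x) ∧ ¬ G.resp c x ∧ x ∉ D) 0 G.d

/-- The edge chosen by `sel` at a vertex in `D` leads to a sink. -/
def redirected (sel : ℕ → ℕ) (D : Set ℕ) (j : ℕ) : Prop :=
  G.tail2 j ∈ D ∧ sel (G.tail2 j) = j

/-- The tails of the edges of the product. -/
noncomputable def etail (k : ℕ) : ℕ := k / G.M * G.N + G.tail2 (k % G.M)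

open Classical in
/-- The heads of the edges of the product. -/
noncomputable def ehead (sel : ℕ → ℕ) (D : Set ℕ) (k : ℕ) : ℕ :=
  if G.redirected sel D (k % G.M) then (G.K - 1) * G.N + G.tail2 (k % G.M)
  else G.nxt D (k / G.M) (G.tail2 (k % G.M)) * G.N + G.head2 (k % G.M)

open Classical in
/-- The owners of the vertices of the product. -/
noncomputable def pown (D : Set ℕ) (y : ℕ) : ℕ :=
  if y % G.N < G.n ∧ y % G.N ∉ D then G.own (y % G.N) else 0

/-- The requests of the product. -/
def preq (D : Set ℕ) (c y : ℕ) : Prop := G.req c (y % G.N) ∧ y % G.N ∉ D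

/-- The responses of the product. -/
def presp (D : Set ℕ) (c y : ℕ) : Prop :=
  if c < G.d then G.resp c (y % G.N) ∨ y % G.N ∈ D
  else ¬ (y / G.N).testBit (c - G.d) = true ∨ y % G.N ∈ D

/-- The edges are pairwise different pairs of vertices, and every vertex has an outgoing one. -/
structure Valid : Prop where
  own_lt : ∀ v, G.own v < 2
  tl_lt : ∀ j < G.m, G.tl j < G.n
  hd_lt : ∀ j < G.m, G.hd j < G.n
  inj : ∀ j < G.m, ∀ j' < G.m, G.tl j = G.tl j' → G.hd j = G.hd j' → j = j'
  exists_tl : ∀ v < G.n, ∃ j < G.m, G.tl j = v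

/-- The function `sel` selects an outgoing edge of every vertex. -/
def Selects (sel : ℕ → ℕ) : Prop := ∀ v < G.n, sel v < G.m ∧ G.tl (sel v) = v

variable {G}

theorem cnt_lt {j : ℕ} (hj : j < G.m) (h : G.sub j) : G.cnt j < G.s := by
  classical
  have : G.cnt (j + 1) ≤ G.s := Nat.count_monotone _ hj
  rw [cnt, Nat.count_succ, if_pos h] at this
  exact this

theorem nth_cnt {j : ℕ} (h : G.sub j) : G.nth (G.cnt j) = j := by
  classical
  exact Nat.nth_count h

theorem exists_cnt_eq {t : ℕ} (h : t < G.s) : ∃ j < G.m, G.sub j ∧ G.cnt j = t := by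
  classical
  exact Nat.exists_count_eq _ h

theorem nth_lt {t : ℕ} (h : t < G.s) : G.nth t < G.m ∧ G.sub (G.nth t) ∧ G.cnt (G.nth t) = t := by
  obtain ⟨j, hj, h1, rfl⟩ := exists_cnt_eq h
  rw [nth_cnt h1]
  exact ⟨hj, h1, rfl⟩

theorem one_le_K : 1 ≤ G.K := Nat.one_le_two_pow

theorem two_le_K (hd : 1 ≤ G.d) : 2 ≤ G.K :=
  Nat.le_self_pow (by omega) 2

theorem nxt_lt (D : Set ℕ) (O x : ℕ) : G.nxt D O x < G.K := digits_lt _ _ _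

theorem testBit_nxt (D : Set ℕ) (O x : ℕ) {c : ℕ} (hc : c < G.d) :
    (G.nxt D O x).testBit c = true ↔ (O.testBit c = true ∨ G.req c x) ∧ ¬ G.resp c x ∧ x ∉ D :=
  testBit_digits _ hc

theorem nxt_of_mem {D : Set ℕ} (O : ℕ) {x : ℕ} (hx : x ∈ D) : G.nxt D O x = 0 := by
  refine Nat.eq_of_testBit_eq fun c => ?_
  rw [Nat.zero_testBit]
  by_contra h
  have h : (G.nxt D O x).testBit c = true := by simpa using h
  rcases Nat.lt_or_ge c G.d with hc | hc
  · exact ((testBit_nxt D O x hc).1 h).2.2 hx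
  · rw [nxt, digits, Nat.testBit_ofBits_ge _ _ hc] at h
    exact absurd h (by simp)

/-- Midpoints carry neither requests nor responses of the original pairs, so the second half of a
subdivided edge stays within one copy. -/
theorem nxt_midpoint {D : Set ℕ} (hD : ∀ x ∈ D, x < G.n) {O x : ℕ} (hO : O < G.K) (hx : G.n ≤ x) :
    G.nxt D O x = O := by
  refine Nat.eq_of_testBit_eq fun c => ?_
  rcases Nat.lt_or_ge c G.d with hc | hc
  · rw [Bool.eq_iff_iff, testBit_nxt D O x hc, req, if_pos hc, resp]
    have h1 : ¬ x < G.n := by omega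
    have h2 : x ∉ D := fun h => h1 (hD x h)
    simp [h1, h2]
  · rw [Nat.testBit_lt_two_pow (hO.trans_le (Nat.pow_le_pow_right (by omega) hc)),
      Nat.testBit_lt_two_pow ((nxt_lt D O x).trans_le (Nat.pow_le_pow_right (by omega) hc))]

theorem tail2_lt (hG : G.Valid) {j : ℕ} (hj : j < G.M) : G.tail2 j < G.N := by
  unfold tail2 N
  unfold M at hj
  split_ifs with h
  · have := hG.tl_lt j h; omega
  · omega

theorem head2_lt (hG : G.Valid) {j : ℕ} (hj : j < G.M) : G.head2 j < G.N := by
  unfold head2 N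
  unfold M at hj
  split_ifs with h h'
  · have := cnt_lt h h'; omega
  · have := hG.hd_lt j h; omega
  · have := hG.hd_lt _ (nth_lt (show j - G.m < G.s by omega)).1; omega

/-- A midpoint identifies its edge, since `nth` inverts `cnt` on the subdivided edges; so distinct
first halves have distinct heads and distinct second halves have distinct tails. -/
theorem edge2_inj (hG : G.Valid) {j j' : ℕ} (ht : G.tail2 j = G.tail2 j')
    (hh : G.head2 j = G.head2 j') : j = j' := by
  unfold tail2 at ht
  unfold head2 at hh
  by_cases h : j < G.m <;> by_cases h' : j' < G.m
  · simp only [h, h', if_true] at ht hh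
    split_ifs at hh with h1 h2 h2
    · rw [← nth_cnt h1, ← nth_cnt h2, show G.cnt j = G.cnt j' by omega]
    · have := hG.hd_lt j' h'; omega
    · have := hG.hd_lt j h; omega
    · exact hG.inj j h j' h' ht hh
  · simp only [h, h', if_true, if_false] at ht
    have := hG.tl_lt j h; omega
  · simp only [h, h', if_true, if_false] at ht
    have := hG.tl_lt j' h'; omega
  · simp only [h, h', if_false] at ht
    omega

theorem exists_tail2 (hG : G.Valid) {x : ℕ} (hx : x < G.N) : ∃ j < G.M, G.tail2 j = x := by
  unfold N at hx
  unfold M tail2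
  rcases Nat.lt_or_ge x G.n with h | h
  · obtain ⟨j, hj, e⟩ := hG.exists_tl x h
    exact ⟨j, by omega, by rw [if_pos hj, e]⟩
  · exact ⟨G.m + (x - G.n), by omega, by rw [if_neg (by omega)]; omega⟩

theorem mul_add_lt {a b x y : ℕ} (hx : x < a) (hy : y < b) : x * b + y < a * b :=
  calc x * b + y < x * b + b := by omega
    _ = (x + 1) * b := by ring
    _ ≤ a * b := Nat.mul_le_mul_right _ hx

theorem pair_div {b x y : ℕ} (hy : y < b) : (x * b + y) / b = x := by
  rw [Nat.add_comm, Nat.add_mul_div_right _ _ (by omega), Nat.div_eq_of_lt hy, Nat.zero_add]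

theorem pair_mod {b x y : ℕ} (hy : y < b) : (x * b + y) % b = y := by
  rw [Nat.add_comm, Nat.add_mul_mod_self_right, Nat.mod_eq_of_lt hy]

theorem lt_of_lt_mul {k a b : ℕ} (h : k < a * b) : k / b < a ∧ k % b < b := by
  have hb : 0 < b := Nat.pos_of_ne_zero fun hb => by simp [hb] at h
  exact ⟨(Nat.div_lt_iff_lt_mul hb).2 h, Nat.mod_lt _ hb⟩

section Product
theorem etail_lt (hG : G.Valid) {k : ℕ} (hk : k < G.K * G.M) : G.etail k < G.K * G.N :=
  mul_add_lt (lt_of_lt_mul hk).1 (tail2_lt hG (lt_of_lt_mul hk).2)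

theorem ehead_lt (hG : G.Valid) (sel : ℕ → ℕ) (D : Set ℕ) {k : ℕ} (hk : k < G.K * G.M) :
    G.ehead sel D k < G.K * G.N := by
  have h1 := one_le_K (G := G)
  unfold ehead
  split_ifs
  · exact mul_add_lt (by omega) (tail2_lt hG (lt_of_lt_mul hk).2)
  · exact mul_add_lt (nxt_lt _ _ _) (head2_lt hG (lt_of_lt_mul hk).2)

theorem pown_lt (hG : G.Valid) (D : Set ℕ) (y : ℕ) : G.pown D y < 2 := by
  unfold pown
  split_ifs
  · exact hG.own_lt _
  · omega

/-- A redirected edge could collide with an ordinary edge from the same vertex. But the memory is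
forgotten in `D`, so ordinary edges from there lead to copy `0` and redirected ones to copy `K - 1`;
these differ because there is at least one pair. -/
theorem edge_inj (hG : G.Valid) (sel : ℕ → ℕ) (D : Set ℕ) (hd : 1 ≤ G.d) {k k' : ℕ}
    (hk : k < G.K * G.M) (hk' : k' < G.K * G.M)
    (ht : G.etail k = G.etail k') (hh : G.ehead sel D k = G.ehead sel D k') : k = k' := by
  have h2 := two_le_K hd
  have hj := (lt_of_lt_mul hk).2
  have hj' := (lt_of_lt_mul hk').2
  obtain ⟨e1, e2⟩ := GameIO.mul_add_inj (tail2_lt hG hj) (tail2_lt hG hj') ht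
  have key : k % G.M = k' % G.M := by
    unfold ehead at hh
    split_ifs at hh with a b b
    · rw [← a.2, ← b.2, e2]
    · have := (GameIO.mul_add_inj (tail2_lt hG hj) (head2_lt hG hj') hh).1
      rw [nxt_of_mem _ (e2 ▸ a.1)] at this
      omega
    · have := (GameIO.mul_add_inj (head2_lt hG hj) (tail2_lt hG hj') hh).1
      rw [nxt_of_mem _ (e2 ▸ b.1)] at this
      omega
    · exact edge2_inj hG e2 (GameIO.mul_add_inj (head2_lt hG hj) (head2_lt hG hj') hh).2
  rw [← Nat.div_add_mod' k G.M, ← Nat.div_add_mod' k' G.M, e1, key]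

theorem exists_etail (hG : G.Valid) {y : ℕ} (hy : y < G.K * G.N) :
    ∃ k < G.K * G.M, G.etail k = y := by
  obtain ⟨j, hj, e⟩ := exists_tail2 hG (lt_of_lt_mul hy).2
  refine ⟨y / G.N * G.M + j, mul_add_lt (lt_of_lt_mul hy).1 hj, ?_⟩
  rw [etail, pair_div hj, pair_mod hj, e, Nat.div_add_mod']

/-- The edges of the product. -/
noncomputable def pedges (hG : G.Valid) (sel : ℕ → ℕ) (D : Set ℕ) (k : Fin (G.K * G.M)) :
    Fin (G.K * G.N) × Fin (G.K * G.N) :=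
  (⟨G.etail k, etail_lt hG k.2⟩, ⟨G.ehead sel D k, ehead_lt hG sel D k.2⟩)

/-- The arena of the product. -/
noncomputable def parena (hG : G.Valid) (sel : ℕ → ℕ) (D : Set ℕ) : Arena (Fin (G.K * G.N)) :=
  GameIO.arenaOf (fun y => ⟨G.pown D y, pown_lt hG D y⟩) (pedges hG sel D) fun y => by
    obtain ⟨k, hk, e⟩ := exists_etail hG y.2
    exact ⟨⟨k, hk⟩, Fin.ext e⟩

theorem isEdgeList_pedges (hG : G.Valid) (sel : ℕ → ℕ) (D : Set ℕ) (hd : 1 ≤ G.d) :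
    GameIO.IsEdgeList (parena hG sel D) (pedges hG sel D) :=
  GameIO.isEdgeList_arenaOf _ _ _ fun k k' h => by
    simp only [pedges, Prod.mk.injEq, Fin.mk.injEq] at h
    exact Fin.ext (edge_inj hG sel D hd k.2 k'.2 h.1 h.2)

end Product

/-- The Streett pairs of the product. -/
def ppairs (G : NumGame) (D : Set ℕ) : StreettPairs (2 * G.d) (Fin (G.K * G.N)) where
  Q c := {y | G.preq D c y}
  P c := {y | G.presp D c y}

end NumGame

namespace GameIO

/-! ### The product of a game with costs and the sets of open requests -/

open NumGame

variable {n m d : ℕ}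

theorem table_val {k : ℕ} (f : Fin k → ℕ) (i : Fin k) : table f i = f i := by
  rw [table, dif_pos i.2]

theorem table_of_le {k : ℕ} (f : Fin k → ℕ) {i : ℕ} (h : k ≤ i) : table f i = 0 := by
  rw [table, dif_neg (by omega)]

theorem table_of_lt {k : ℕ} (f : Fin k → ℕ) {i : ℕ} (h : i < k) : table f i = f ⟨i, h⟩ := by
  rw [table, dif_pos h]

/-- A game with costs in terms of numbers. -/
noncomputable def numGame (A : Arena (Fin n)) (e : Fin m → Fin n × Fin n)
    (Γ : StreettPairs d (Fin n)) (Cst : CostFunctions d (Fin n)) : NumGame where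
  n := n
  m := m
  d := d
  own := table fun v => (A.owner v : ℕ)
  tl := table fun j => ((e j).1 : ℕ)
  hd := table fun j => ((e j).2 : ℕ)
  q c v := ∃ (c' : Fin d) (v' : Fin n), c = c' ∧ v = v' ∧ v' ∈ Γ.Q c'
  p c v := ∃ (c' : Fin d) (v' : Fin n), c = c' ∧ v = v' ∧ v' ∈ Γ.P c'
  inc c j := ∃ (c' : Fin d) (j' : Fin m), c = c' ∧ j = j' ∧
    Cst c' (e j').1 (e j').2 = CostLabel.inc

section NumGame

variable (A : Arena (Fin n)) (e : Fin m → Fin n × Fin n) (Γ : StreettPairs d (Fin n))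
  (Cst : CostFunctions d (Fin n))

theorem numGame_tl (j : Fin m) : (numGame A e Γ Cst).tl j = (e j).1 :=
  table_val (fun j => ((e j).1 : ℕ)) j

theorem numGame_hd (j : Fin m) : (numGame A e Γ Cst).hd j = (e j).2 :=
  table_val (fun j => ((e j).2 : ℕ)) j

theorem numGame_q (c : Fin d) (v : Fin n) : (numGame A e Γ Cst).q c v ↔ v ∈ Γ.Q c := by
  constructor
  · rintro ⟨c', v', h1, h2, h⟩
    rwa [Fin.ext h1, Fin.ext h2]
  · exact fun h => ⟨c, v, rfl, rfl, h⟩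

theorem numGame_p (c : Fin d) (v : Fin n) : (numGame A e Γ Cst).p c v ↔ v ∈ Γ.P c := by
  constructor
  · rintro ⟨c', v', h1, h2, h⟩
    rwa [Fin.ext h1, Fin.ext h2]
  · exact fun h => ⟨c, v, rfl, rfl, h⟩

theorem numGame_inc (c : Fin d) (j : Fin m) :
    (numGame A e Γ Cst).inc c j ↔ Cst c (e j).1 (e j).2 = CostLabel.inc := by
  constructor
  · rintro ⟨c', v', h1, h2, h⟩
    rwa [Fin.ext h1, Fin.ext h2]
  · exact fun h => ⟨c, j, rfl, rfl, h⟩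

variable {A e}

theorem numGame_valid (he : IsEdgeList A e) : (numGame A e Γ Cst).Valid where
  own_lt v := by
    rcases Nat.lt_or_ge v n with h | h
    · exact (table_of_lt (fun v => (A.owner v : ℕ)) h).trans_lt (A.owner ⟨v, h⟩).2
    · exact (table_of_le (fun v => (A.owner v : ℕ)) h).trans_lt Nat.zero_lt_two
  tl_lt j hj := (numGame_tl A e Γ Cst ⟨j, hj⟩).trans_lt (e ⟨j, hj⟩).1.2
  hd_lt j hj := (numGame_hd A e Γ Cst ⟨j, hj⟩).trans_lt (e ⟨j, hj⟩).2.2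
  inj j hj j' hj' h1 h2 := by
    have e1 := numGame_tl A e Γ Cst ⟨j, hj⟩
    have e2 := numGame_tl A e Γ Cst ⟨j', hj'⟩
    have e3 := numGame_hd A e Γ Cst ⟨j, hj⟩
    have e4 := numGame_hd A e Γ Cst ⟨j', hj'⟩
    have := he.1 (Prod.ext (Fin.ext (e1.symm.trans (h1.trans e2)))
      (Fin.ext (e3.symm.trans (h2.trans e4))))
    exact congrArg Fin.val this
  exists_tl v hv := by
    obtain ⟨w, hw⟩ := A.exists_edge ⟨v, hv⟩
    obtain ⟨j, hj⟩ := (he.2 _ _).1 hw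
    exact ⟨j, j.2, by rw [numGame_tl, hj]⟩

theorem numGame_incIn (he : IsEdgeList A e) (c : Fin d) (w : Fin n) :
    (numGame A e Γ Cst).incIn c w ↔ ∃ u, A.Edge u w ∧ Cst c u w = CostLabel.inc := by
  constructor
  · rintro ⟨j, hj, h1, h2⟩
    have h1 : w = (e ⟨j, hj⟩).2 := Fin.ext (h1.trans (numGame_hd A e Γ Cst ⟨j, hj⟩))
    have h2 := (numGame_inc A e Γ Cst c ⟨j, hj⟩).1 h2
    exact ⟨(e ⟨j, hj⟩).1, (he.2 _ _).2 ⟨⟨j, hj⟩, by rw [h1]⟩, by rw [h1]; exact h2⟩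
  · rintro ⟨u, h1, h2⟩
    obtain ⟨j, hj⟩ := (he.2 _ _).1 h1
    exact ⟨j, j.2, by rw [numGame_hd, hj], (numGame_inc A e Γ Cst c j).2 (by rw [hj]; exact h2)⟩

theorem numGame_epsIn (he : IsEdgeList A e) (c : Fin d) (w : Fin n) :
    (numGame A e Γ Cst).epsIn c w ↔ ∃ u, A.Edge u w ∧ Cst c u w = CostLabel.eps := by
  have hl : ∀ l : CostLabel, l = CostLabel.eps ↔ ¬ l = CostLabel.inc := by
    intro l; cases l <;> simp
  simp only [hl]
  constructor
  · rintro ⟨j, hj, h1, h2⟩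
    have h1 : w = (e ⟨j, hj⟩).2 := Fin.ext (h1.trans (numGame_hd A e Γ Cst ⟨j, hj⟩))
    have h2 := (numGame_inc A e Γ Cst c ⟨j, hj⟩).not.1 h2
    exact ⟨(e ⟨j, hj⟩).1, (he.2 _ _).2 ⟨⟨j, hj⟩, by rw [h1]⟩, by rw [h1]; exact h2⟩
  · rintro ⟨u, h1, h2⟩
    obtain ⟨j, hj⟩ := (he.2 _ _).1 h1
    exact ⟨j, j.2, by rw [numGame_hd, hj],
      (numGame_inc A e Γ Cst c j).not.2 (by rw [hj]; exact h2)⟩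

theorem numGame_mixed (he : IsEdgeList A e) (w : Fin n) :
    (numGame A e Γ Cst).mixed w ↔ A.Mixed Cst w := by
  constructor
  · rintro ⟨c, hc, h1, h2⟩
    exact ⟨⟨c, hc⟩, (numGame_incIn Γ Cst he ⟨c, hc⟩ w).1 h1,
      (numGame_epsIn Γ Cst he ⟨c, hc⟩ w).1 h2⟩
  · rintro ⟨c, h1, h2⟩
    exact ⟨c, c.2, (numGame_incIn Γ Cst he c w).2 h1, (numGame_epsIn Γ Cst he c w).2 h2⟩

theorem numGame_sub (he : IsEdgeList A e) (j : Fin m) : (numGame A e Γ Cst).sub j ↔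
    (∃ c, Cst c (e j).1 (e j).2 = CostLabel.inc) ∧ A.Mixed Cst (e j).2 := by
  rw [sub, numGame_hd, numGame_mixed Γ Cst he]
  refine and_congr_left fun _ => ⟨?_, ?_⟩
  · rintro ⟨c, hc, h⟩
    exact ⟨⟨c, hc⟩, (numGame_inc A e Γ Cst ⟨c, hc⟩ j).1 h⟩
  · rintro ⟨c, h⟩
    exact ⟨c, c.2, (numGame_inc A e Γ Cst c j).2 h⟩

theorem numGame_s (he : IsEdgeList A e) : (numGame A e Γ Cst).s = A.subdivisions Cst := by
  classical
  rw [Arena.subdivisions, s, cnt, Nat.count_eq_card_filter_range]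
  have h : {x : Fin n × Fin n | A.Edge x.1 x.2 ∧ (∃ c, Cst c x.1 x.2 = CostLabel.inc) ∧
      A.Mixed Cst x.2} =
      e '' ((Finset.univ.filter fun j : Fin m => (numGame A e Γ Cst).sub j : Finset (Fin m)) :
        Set (Fin m)) := by
    ext ⟨u, w⟩
    simp only [Set.mem_ofPred_eq, Set.mem_image, Finset.coe_filter, Finset.mem_univ, true_and]
    constructor
    · rintro ⟨h1, h2⟩
      obtain ⟨j, hj⟩ := (he.2 _ _).1 h1
      exact ⟨j, (numGame_sub Γ Cst he j).2 (by rw [hj]; exact h2), hj⟩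
    · rintro ⟨j, h1, h2⟩
      have := (numGame_sub Γ Cst he j).1 h1
      rw [h2] at this
      exact ⟨(he.2 _ _).2 ⟨j, h2⟩, this⟩
  rw [h, Set.ncard_image_of_injective _ he.1, Set.ncard_coe_finset]
  symm
  refine Finset.card_bij (fun j _ => (j : ℕ)) ?_ ?_ ?_
  · intro j hj
    simp only [Finset.mem_filter, Finset.mem_univ, true_and] at hj
    exact Finset.mem_filter.2 ⟨Finset.mem_range.2 j.2, hj⟩
  · intro j _ j' _ h
    exact Fin.ext h
  · intro j hj
    obtain ⟨h1, h2⟩ := Finset.mem_filter.1 hj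
    exact ⟨⟨j, Finset.mem_range.1 h1⟩, by simpa using h2, rfl⟩

end NumGame

end GameIO

/-! ### The product as a simulation of the game with costs -/

namespace NumGame

variable {G : NumGame}

/-- The index of an edge of the product is decoded into a copy and an edge of the subdivided arena.
-/
theorem parena_edge_iff (hG : G.Valid) (sel : ℕ → ℕ) (D : Set ℕ) (y z : Fin (G.K * G.N)) :
    (parena hG sel D).Edge y z ↔ ∃ O < G.K, ∃ j < G.M, (y : ℕ) = O * G.N + G.tail2 j ∧
      ((G.redirected sel D j ∧ (z : ℕ) = (G.K - 1) * G.N + G.tail2 j) ∨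
        (¬ G.redirected sel D j ∧ (z : ℕ) = G.nxt D O (G.tail2 j) * G.N + G.head2 j)) := by
  have key : ∀ k : Fin (G.K * G.M), ((z : ℕ) = G.ehead sel D k ↔
      ((G.redirected sel D (k % G.M) ∧ (z : ℕ) = (G.K - 1) * G.N + G.tail2 (k % G.M)) ∨
        (¬ G.redirected sel D (k % G.M) ∧
          (z : ℕ) = G.nxt D (k / G.M) (G.tail2 (k % G.M)) * G.N + G.head2 (k % G.M)))) := by
    intro k
    unfold ehead
    split_ifs with h <;> simp [h]
  constructor
  · rintro ⟨k, hk⟩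
    rw [Prod.mk.injEq] at hk
    refine ⟨k / G.M, (lt_of_lt_mul k.2).1, k % G.M, (lt_of_lt_mul k.2).2,
      (congrArg Fin.val hk.1).symm, (key k).1 (congrArg Fin.val hk.2).symm⟩
  · rintro ⟨O, hO, j, hj, h1, h2⟩
    let k : Fin (G.K * G.M) := ⟨O * G.M + j, mul_add_lt hO hj⟩
    have e1 : (k : ℕ) / G.M = O := pair_div hj
    have e2 : (k : ℕ) % G.M = j := pair_mod hj
    have h3 := key k
    rw [e1, e2] at h3
    refine ⟨k, Prod.ext (Fin.ext ?_) (Fin.ext (h3.2 h2).symm)⟩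
    rw [h1]
    change k / G.M * G.N + G.tail2 (k % G.M) = _
    rw [e1, e2]

variable (G) in
theorem n_le_N : G.n ≤ G.N := Nat.le_add_right _ _

end NumGame

namespace GameIO

open NumGame

variable {n m d : ℕ} {A : Arena (Fin n)} {e : Fin m → Fin n × Fin n} (Γ : StreettPairs d (Fin n))
  (Cst : CostFunctions d (Fin n))

open Classical in
/-- The midpoint of the edge `(u, w)` if it is subdivided. -/
noncomputable def midpoint (_ : IsEdgeList A e) (u w : Fin n)
    (O : Fin (numGame A e Γ Cst).K) : Fin ((numGame A e Γ Cst).K * (numGame A e Γ Cst).N) :=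
  if h : ∃ j : Fin m, e j = (u, w) ∧ (numGame A e Γ Cst).sub j then
    ⟨O * (numGame A e Γ Cst).N + (n + (numGame A e Γ Cst).cnt h.choose),
      mul_add_lt O.2 (Nat.add_lt_add_left (cnt_lt h.choose.2 h.choose_spec.2) _)⟩
  else ⟨O * (numGame A e Γ Cst).N + u, mul_add_lt O.2 (u.2.trans_le (n_le_N (numGame A e Γ Cst)))⟩

theorem midpoint_val (he : IsEdgeList A e) {u w : Fin n} {j : Fin m} (h : e j = (u, w))
    (hs : (numGame A e Γ Cst).sub j) (O : Fin (numGame A e Γ Cst).K) :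
    (midpoint Γ Cst he u w O : ℕ) =
      O * (numGame A e Γ Cst).N + (n + (numGame A e Γ Cst).cnt j) := by
  have hex : ∃ j : Fin m, e j = (u, w) ∧ (numGame A e Γ Cst).sub j := ⟨j, h, hs⟩
  have : hex.choose = j := he.1 (hex.choose_spec.1.trans h.symm)
  simp only [midpoint, dif_pos hex, this]

/-- The product simulates the game with costs. -/
noncomputable def simulates (he : IsEdgeList A e) (hd : 1 ≤ d) {sel : ℕ → ℕ}
    (hsel : (numGame A e Γ Cst).Selects sel) (D : Set (Fin n)) :
    StreettPairs.Simulates A Γ Cst D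
      (parena (numGame_valid Γ Cst he) sel (Fin.val '' D))
      ((numGame A e Γ Cst).ppairs (Fin.val '' D)) := by
  set G := numGame A e Γ Cst with hGdef
  have hG : G.Valid := numGame_valid Γ Cst he
  have hD : ∀ x ∈ (Fin.val '' D : Set ℕ), x < G.n := by
    rintro _ ⟨v, -, rfl⟩; exact v.2
  have hmem : ∀ u : Fin n, (u : ℕ) ∈ (Fin.val '' D : Set ℕ) ↔ u ∈ D := fun u => by
    simp [Fin.ext_iff.symm]
  have hnot : ∀ t, G.n + t ∉ (Fin.val '' D : Set ℕ) := fun t ht => by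
    have := hD _ ht; omega
  have hu : ∀ u : Fin n, (u : ℕ) < G.N := fun u => u.2.trans_le (n_le_N G)
  have hcnt : ∀ {j : Fin m}, G.sub j → n + G.cnt j < G.N := fun {j} h =>
    Nat.add_lt_add_left (cnt_lt j.2 h) _
  have hGn : G.n = n := rfl
  have hGm : G.m = m := rfl
  have hGd : G.d = d := rfl
  have htail : ∀ {j} {u : Fin n}, G.tail2 j = u → ∃ j' : Fin m, (j' : ℕ) = j ∧ (e j').1 = u := by
    intro j u h
    unfold tail2 at h
    split_ifs at h with hj
    · exact ⟨⟨j, hj⟩, rfl, Fin.ext ((numGame_tl A e Γ Cst ⟨j, hj⟩).symm.trans h)⟩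
    · have := u.2; omega
  have htail' : ∀ j : Fin m, G.tail2 j = (e j).1 := fun j => by
    rw [tail2, if_pos (show (j : ℕ) < G.m from j.2)]; exact numGame_tl A e Γ Cst j
  have hlt : ∀ j : Fin m, (j : ℕ) < G.M := fun j => j.2.trans_le (Nat.le_add_right _ _)
  have hreq1 : ∀ (c : Fin d) (x : ℕ), G.req c x ↔ x < n ∧ G.q c x := fun c x => by
    rw [req, if_pos (show (c : ℕ) < G.d from c.2), hGn]
  have hreq2 : ∀ (c : Fin d) (x : ℕ), G.req (d + c) x ↔ (x < n ∧ G.incIn c x ∧ ¬ G.mixed x) ∨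
      (n ≤ x ∧ x < G.N ∧ G.inc c (G.nth (x - n))) := fun c x => by
    rw [req, if_neg (show ¬ d + (c : ℕ) < G.d by omega), hGd, Nat.add_sub_cancel_left, hGn]
  have hpresp1 : ∀ (c : Fin d) (y : ℕ), G.presp (Fin.val '' D) c y ↔
      G.resp c (y % G.N) ∨ y % G.N ∈ (Fin.val '' D : Set ℕ) := fun c y => by
    rw [presp, if_pos (show (c : ℕ) < G.d from c.2)]
  have hpresp2 : ∀ (c : Fin d) (y : ℕ), G.presp (Fin.val '' D) (d + c) y ↔
      ¬ (y / G.N).testBit c = true ∨ y % G.N ∈ (Fin.val '' D : Set ℕ) := fun c y => by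
    rw [presp, if_neg (show ¬ d + (c : ℕ) < G.d by omega), hGd, Nat.add_sub_cancel_left]
  have hedge := parena_edge_iff hG sel (Fin.val '' D)
  exact
  { M := Fin G.K
    bit := fun O c => (O : ℕ).testBit c = true
    nxt := fun O u => ⟨G.nxt (Fin.val '' D) O u, nxt_lt _ _ _⟩
    start := ⟨0, one_le_K⟩
    real := fun u O => ⟨O * G.N + u, mul_add_lt O.2 (hu u)⟩
    mid := fun u w O => midpoint Γ Cst he u w O
    Sub := fun u w => ∃ j : Fin m, e j = (u, w) ∧ G.sub j
    cl := fun c => ⟨c, show (c : ℕ) < 2 * d by omega⟩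
    ch := fun c => ⟨d + c, show d + (c : ℕ) < 2 * d by omega⟩
    surj := by
      intro c'
      have hc : (c' : ℕ) < 2 * d := c'.2
      rcases Nat.lt_or_ge c' d with h | h
      · exact ⟨⟨c', h⟩, Or.inl rfl⟩
      · exact ⟨⟨c' - d, by omega⟩, Or.inr (Fin.ext (by simp only; omega))⟩
    not_bit_start := fun c => by simp
    bit_nxt := by
      intro u O c huD
      rw [testBit_nxt _ _ _ (show (c : ℕ) < G.d from c.2), hmem, hreq1, resp]
      have h1 : G.q c u ↔ u ∈ Γ.Q c := numGame_q A e Γ Cst c u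
      have h2 : G.p c u ↔ u ∈ Γ.P c := numGame_p A e Γ Cst c u
      have h3 : (u : ℕ) < n := u.2
      rw [h1, h2, hGn]
      tauto
    edge_real := by
      intro u O y huD
      rw [hedge]
      constructor
      · rintro ⟨O', hO', j, hj, h1, h2⟩
        obtain ⟨e1, e2⟩ := mul_add_inj (hu u) (tail2_lt hG hj) h1
        obtain ⟨j', rfl, hj'⟩ := htail e2.symm
        have hnr : ¬ G.redirected sel (Fin.val '' D) j' := fun h => huD ((hmem u).1 (e2 ▸ h.1))
        rw [or_iff_right (fun h => hnr h.1)] at h2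
        have h2 := h2.2
        rw [← e1, ← e2, head2, if_pos (show (j' : ℕ) < G.m from j'.2)] at h2
        have hej : e j' = (u, (e j').2) := by rw [← hj']
        refine ⟨(e j').2, (he.2 _ _).2 ⟨j', hej⟩, ?_⟩
        split_ifs at h2 with hs
        · refine Or.inl ⟨⟨j', hej, hs⟩, Fin.ext ?_⟩
          rw [h2, midpoint_val Γ Cst he hej hs]
          rfl
        · refine Or.inr ⟨?_, Fin.ext ?_⟩
          · rintro ⟨j'', h3, h4⟩
            rw [he.1 (h3.trans hej.symm)] at h4
            exact hs h4
          · rw [h2, numGame_hd]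
      · rintro ⟨w, hw, h⟩
        obtain ⟨j, hj⟩ := (he.2 _ _).1 hw
        have e2 : G.tail2 j = u := by rw [htail', hj]
        refine ⟨O, O.2, j, hlt j, by simp only [e2],
          Or.inr ⟨fun h => huD ((hmem u).1 (e2 ▸ h.1)), ?_⟩⟩
        rw [head2, if_pos (show (j : ℕ) < G.m from j.2), e2]
        rcases h with ⟨⟨j', h1, h2⟩, rfl⟩ | ⟨h1, rfl⟩
        · obtain rfl : j' = j := he.1 (h1.trans hj.symm)
          rw [if_pos h2, midpoint_val Γ Cst he h1 h2]
          rfl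
        · have hs : ¬ G.sub j := fun hs => h1 ⟨j, hj, hs⟩
          rw [if_neg hs, numGame_hd, hj]
    edge_mid := by
      rintro u w O y hw ⟨j, hj, hs⟩
      rw [hedge, midpoint_val Γ Cst he hj hs]
      have hw' : G.hd j = w := by rw [numGame_hd, hj]
      constructor
      · rintro ⟨O', hO', j', hj', h1, h2⟩
        obtain ⟨e1, e2⟩ := mul_add_inj (hcnt hs) (tail2_lt hG hj') h1
        have hjm : ¬ j' < G.m := fun h => by
          have := hG.tl_lt j' h
          rw [tail2, if_pos h] at e2
          omega
        have e3 : j' - G.m = G.cnt j := by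
          rw [tail2, if_neg hjm] at e2; omega
        -- Only original vertices lie in `D`, so the edges that leave midpoints are never
        -- redirected.
        have hnD : G.tail2 j' ∉ (Fin.val '' D : Set ℕ) := fun h => hnot _ (e2 ▸ h)
        rw [or_iff_right (fun h => hnD h.1.1)] at h2
        have h2 := h2.2
        rw [nxt_midpoint hD hO' (by omega), head2, if_neg hjm, e3, nth_cnt hs, hw', ← e1] at h2
        exact Fin.ext h2
      · rintro rfl
        have e2 : G.tail2 (G.m + G.cnt j) = n + G.cnt j := by
          rw [tail2, if_neg (by omega)]; omega
        refine ⟨O, O.2, G.m + G.cnt j, Nat.add_lt_add_left (cnt_lt j.2 hs) _, by rw [e2],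
          Or.inr ⟨fun h => hnot _ (e2 ▸ h.1), ?_⟩⟩
        rw [e2, nxt_midpoint hD O.2 (hGn.le.trans (Nat.le_add_right _ _)), head2, if_neg (by omega),
          Nat.add_sub_cancel_left, nth_cnt hs, hw']
    owner_real := by
      intro u O huD
      refine Fin.ext ?_
      change G.pown (Fin.val '' D) (O * G.N + u) = _
      rw [pown, pair_mod (hu u), if_pos ⟨u.2, fun h => huD ((hmem u).1 h)⟩]
      exact table_val (fun v => (A.owner v : ℕ)) u
    owner_mid := by
      rintro u w O hw ⟨j, hj, hs⟩
      refine Fin.ext ?_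
      change G.pown (Fin.val '' D) (midpoint Γ Cst he u w O) = _
      rw [midpoint_val Γ Cst he hj hs, pown, pair_mod (hcnt hs), if_neg (by omega)]
      rfl
    real_mem_Q_cl := by
      intro u O c huD
      change G.preq (Fin.val '' D) c (O * G.N + u) ↔ _
      rw [preq, pair_mod (hu u), hmem, hreq1]
      have h1 : G.q c u ↔ u ∈ Γ.Q c := numGame_q A e Γ Cst c u
      rw [h1]
      exact ⟨fun h => h.1.2, fun h => ⟨⟨u.2, h⟩, huD⟩⟩
    real_mem_P_cl := by
      intro u O c huD
      change G.presp (Fin.val '' D) c (O * G.N + u) ↔ _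
      rw [hpresp1, pair_mod (hu u), hmem, resp]
      have h1 : G.p c u ↔ u ∈ Γ.P c := numGame_p A e Γ Cst c u
      rw [h1]
      exact ⟨fun h => (h.resolve_right huD).2, fun h => Or.inl ⟨u.2, h⟩⟩
    mid_notMem_Q_cl := by
      rintro u w O c hw ⟨j, hj, hs⟩ h
      change G.preq (Fin.val '' D) c (midpoint Γ Cst he u w O) at h
      rw [midpoint_val Γ Cst he hj hs, preq, pair_mod (hcnt hs), hreq1] at h
      omega
    mid_notMem_P_cl := by
      rintro u w O c hw ⟨j, hj, hs⟩ h
      change G.presp (Fin.val '' D) c (midpoint Γ Cst he u w O) at h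
      rw [midpoint_val Γ Cst he hj hs, hpresp1, pair_mod (hcnt hs), resp] at h
      rcases h with h | h
      · omega
      · exact hnot _ h
    real_mem_P_ch := by
      intro u O c huD
      change G.presp (Fin.val '' D) (d + c) (O * G.N + u) ↔ _
      rw [hpresp2, pair_mod (hu u), pair_div (hu u), hmem]
      exact or_iff_left huD
    mid_mem_P_ch := by
      rintro u w O c hw ⟨j, hj, hs⟩
      change G.presp (Fin.val '' D) (d + c) (midpoint Γ Cst he u w O) ↔ _
      rw [midpoint_val Γ Cst he hj hs, hpresp2, pair_mod (hcnt hs), pair_div (hcnt hs)]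
      exact or_iff_left (hnot _)
    real_mem_Q_ch := by
      intro u w O c hw hs hwD
      change G.preq (Fin.val '' D) (d + c) (O * G.N + w) ↔ _
      rw [preq, pair_mod (hu w), hmem, hreq2]
      obtain ⟨j, hj⟩ := (he.2 _ _).1 hw
      have hs' : ¬ G.sub j := fun h => hs ⟨j, hj, h⟩
      rw [numGame_sub Γ Cst he, hj] at hs'
      have h1 := numGame_incIn Γ Cst he c w
      have h2 := numGame_mixed Γ Cst he w
      rw [h1, h2]
      constructor
      -- Some increment-edge enters `w`. As `w` is not mixed, the edge from `u` cannot be an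
      -- `ε`-edge.
      · rintro ⟨⟨-, ⟨u', h3, h4⟩, h5⟩ | h, -⟩
        · by_contra h6
          refine h5 ⟨c, ⟨u', h3, h4⟩, u, hw, ?_⟩
          cases h : Cst c u w
          · rfl
          · exact absurd h h6
        · have := w.2; omega
      -- An increment-edge that is not subdivided leads to a vertex that is not mixed.
      · exact fun h => ⟨Or.inl ⟨w.2, ⟨u, hw, h⟩, fun h' => hs' ⟨⟨c, h⟩, h'⟩⟩, hwD⟩
    mid_mem_Q_ch := by
      rintro u w O c hw ⟨j, hj, hs⟩
      change G.preq (Fin.val '' D) (d + c) (midpoint Γ Cst he u w O) ↔ _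
      rw [midpoint_val Γ Cst he hj hs, preq, pair_mod (hcnt hs), hreq2, Nat.add_sub_cancel_left,
        nth_cnt hs]
      have h1 := numGame_inc A e Γ Cst c j
      rw [hj] at h1
      rw [h1]
      constructor
      · rintro ⟨h | h, -⟩
        · omega
        · exact h.2.2
      · exact fun h => ⟨Or.inr ⟨Nat.le_add_right _ _, hcnt hs, h⟩, hnot _⟩
    real_notMem_Q_ch := by
      rintro u w O c hw ⟨j, hj, hs⟩ hwD h
      change G.preq (Fin.val '' D) (d + c) (O * G.N + w) at h
      rw [preq, pair_mod (hu w), hreq2] at h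
      rcases h.1 with h | h
      · refine h.2.2 ?_
        have := hs.2
        rwa [numGame_hd, hj] at this
      · have := w.2; omega
    sink := by
      intro u O huD
      have hK : 2 ≤ G.K := two_le_K hd
      have hK1 : G.K - 1 < G.K := by omega
      have hown : ∀ O : ℕ, G.pown (Fin.val '' D) (O * G.N + u) = 0 := fun O => by
        rw [pown, pair_mod (hu u), if_neg (fun h => h.2 ((hmem u).2 huD))]
      -- The selected edge leads from every copy of `u` to the last copy, and so from the last copy
      -- to itself.
      have hE : ∀ (O : ℕ) (hO : O < G.K), (parena hG sel (Fin.val '' D)).Edge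
          ⟨O * G.N + u, mul_add_lt hO (hu u)⟩
          ⟨(G.K - 1) * G.N + u, mul_add_lt hK1 (hu u)⟩ := fun O hO => by
        obtain ⟨h1, h2⟩ := hsel u u.2
        have e2 : G.tail2 (sel u) = u := by rw [tail2, if_pos h1, h2]
        rw [hedge]
        refine ⟨O, hO, sel u, h1.trans_le (Nat.le_add_right _ _), by rw [e2],
          Or.inl ⟨?_, by rw [e2]⟩⟩
        exact ⟨by rw [e2]; exact (hmem u).2 huD, by rw [e2]⟩
      refine ⟨⟨(G.K - 1) * G.N + u, mul_add_lt hK1 (hu u)⟩, Fin.ext (hown O), hE O O.2,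
        Fin.ext (hown _), hE _ hK1, fun c' h => ?_⟩
      change G.preq (Fin.val '' D) c' ((G.K - 1) * G.N + u) at h
      rw [preq, pair_mod (hu u)] at h
      exact h.2 ((hmem u).2 huD) }

end GameIO

namespace NumGame

open RAM

variable {G : NumGame}

/-! ### Sizes -/

theorem n_le_m (hG : G.Valid) : G.n ≤ G.m := by
  choose f hf using hG.exists_tl
  have : Function.Injective fun v : Fin G.n => (⟨f v v.2, (hf v v.2).1⟩ : Fin G.m) := by
    intro v w h
    simp only [Fin.mk.injEq] at h
    refine Fin.ext ?_
    rw [← (hf v v.2).2, ← (hf w w.2).2, h]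
  simpa using Fintype.card_le_of_injective _ this

theorem N_le_M (hG : G.Valid) : G.N ≤ G.M := Nat.add_le_add_right (n_le_m hG) _

theorem m_le_M : G.m ≤ G.M := Nat.le_add_right _ _

theorem s_le_M : G.s ≤ G.M := Nat.le_add_left _ _

theorem d_le_K : G.d ≤ G.K := Nat.lt_two_pow_self.le

/-- The size of the product. -/
noncomputable def size (G : NumGame) : ℕ := 2 * G.d * (G.K * G.N) + G.K * G.M

/-- The product is not empty, and three times its size is at most `S`. -/
structure Fits (G : NumGame) (S : ℕ) : Prop where
  valid : G.Valid
  n_pos : 0 < G.n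
  d_pos : 0 < G.d
  size_le : 3 * G.size ≤ S

theorem Fits.N_pos {S : ℕ} (h : G.Fits S) : 0 < G.N := h.n_pos.trans_le (n_le_N G)

theorem Fits.KN_pos {S : ℕ} (h : G.Fits S) : 0 < G.K * G.N := Nat.mul_pos one_le_K h.N_pos

theorem Fits.M_pos {S : ℕ} (h : G.Fits S) : 0 < G.M := h.N_pos.trans_le (N_le_M h.valid)

/-- Each of the three summands is at most `size`; this accounts for the factor `3` in `Fits`. The
loops over edges are treated likewise. -/
theorem Fits.loop_pairs {S : ℕ} (h : G.Fits S) {i j : ℕ} (hi : i ≤ 2 * G.d)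
    (hj : j ≤ G.K * G.N) : i * j + i + 1 ≤ S := by
  have h1 := h.size_le
  unfold size at h1
  have h2 := h.KN_pos
  have h3 := h.d_pos
  have h4 : i * j ≤ 2 * G.d * (G.K * G.N) := Nat.mul_le_mul hi hj
  have h5 : 2 * G.d ≤ 2 * G.d * (G.K * G.N) := Nat.le_mul_of_pos_right _ h2
  omega

theorem Fits.loop_edges {S : ℕ} (h : G.Fits S) {i j : ℕ} (hi : i ≤ G.K) (hj : j ≤ G.M) :
    i * j + i + 1 ≤ S := by
  have h1 := h.size_le
  unfold size at h1
  have h2 := h.M_pos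
  have h3 := one_le_K (G := G)
  have h4 : i * j ≤ G.K * G.M := Nat.mul_le_mul hi hj
  have h5 : G.K ≤ G.K * G.M := Nat.le_mul_of_pos_right _ h2
  omega

theorem Fits.scan_pairs {S : ℕ} (h : G.Fits S) {i : ℕ} (hi : i ≤ 2 * G.d) : i + 2 ≤ S := by
  have h1 := h.size_le
  unfold size at h1
  have h3 := h.d_pos
  have h5 : 2 * G.d ≤ 2 * G.d * (G.K * G.N) := Nat.le_mul_of_pos_right _ h.KN_pos
  omega

theorem Fits.scan_edges {S : ℕ} (h : G.Fits S) {i : ℕ} (hi : i ≤ G.K * G.M) : i + 2 ≤ S := by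
  have h1 := h.size_le
  unfold size at h1
  have h3 : 1 ≤ G.K * G.M := Nat.mul_pos one_le_K h.M_pos
  omega

theorem Fits.one_le {S : ℕ} (h : G.Fits S) : 1 ≤ S := by
  have := h.scan_pairs (i := 0) (by omega)
  omega

/-! ### The contents of the memory -/

/-- The intended contents of the arrays that do not change after the preprocessing. -/
def Spec (G : NumGame) : ℕ → (ℕ → ℕ) → Prop
  | 0, f => f 0 = G.n ∧ f 1 = G.m ∧ f 2 = G.d
  -- The zeros beyond `n` give the midpoints to Player `0`.
  | 1, f => ∀ v, f v = if v < G.n then G.own v else 0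
  | 2, f => ∀ j < G.m, f j = G.tl j
  | 3, f => ∀ j < G.m, f j = G.hd j
  | 4, f => ∀ c < G.d, ∀ v < G.n, f (c * G.n + v) = ind (G.q c v)
  | 5, f => ∀ c < G.d, ∀ v < G.n, f (c * G.n + v) = ind (G.p c v)
  | 6, f => ∀ c < G.d, ∀ j < G.m, f (c * G.m + j) = ind (G.inc c j)
  | 7, f => ∀ x, f x = 0
  | 9, f => ∀ c ≤ G.d, f c = c * G.n
  | 10, f => ∀ c ≤ G.d, f c = c * G.m
  | 11, f => ∀ c < G.d, ∀ w < G.n, f (c * G.n + w) = ind (G.incIn c w)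
  | 12, f => ∀ c < G.d, ∀ w < G.n, f (c * G.n + w) = ind (G.epsIn c w)
  | 13, f => ∀ w < G.n, f w = ind (G.mixed w)
  | 14, f => ∀ j < G.m, f j = ind (G.anyInc j)
  | 15, f => ∀ j ≤ G.m, f j = G.cnt j
  | 16, f => ∀ t < G.s, f t = G.nth t
  | 17, f => ∀ c ≤ G.d, f c = 2 ^ c
  | 18, f => f 0 = G.N ∧ f 1 = G.M ∧ f 2 = 2 * G.d
  | 19, f => ∀ c ≤ 2 * G.d, f c = c * G.N
  | 20, f => ∀ j < G.M, f j = G.tail2 j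
  | 21, f => ∀ j < G.M, f j = G.head2 j
  | 22, f => ∀ c < 2 * G.d, ∀ x < G.N, f (c * G.N + x) = ind (G.req c x)
  | 23, f => ∀ c < G.d, ∀ x < G.N, f (c * G.N + x) = ind (G.resp c x)
  | 24, f => G.Selects f
  | 25, f => ∀ O ≤ G.K, f O = O % 2
  | 26, f => ∀ O ≤ G.K, f O = O / 2
  | 27, f => ∀ c ≤ G.d, f c = c * G.K
  | 28, f => ∀ c < G.d, ∀ O < G.K, f (c * G.K + O) = ind (O.testBit c = true)
  | 29, f => ∀ O ≤ G.K, f O = O * G.N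
  | 30, f => ∀ O < G.K, ∀ x < G.N, f (O * G.N + x) = x
  | 31, f => ∀ O < G.K, ∀ x < G.N, f (O * G.N + x) = O
  -- Tables with two entries, indexed by an indicator, replace case distinctions in expressions.
  | 32, f => f 0 = 0 ∧ f 1 = G.K - 1
  | 33, f => f 0 = 0 ∧ f 1 = G.N
  | 34, f => ∀ c ≤ 2 * G.d, f c = c * (G.K * G.N)
  | 35, f => ∀ O ≤ G.K, f O = O * G.M
  | _, _ => True

/-- The arrays below `k` have their intended contents. -/
def Known (G : NumGame) (k : ℕ) (σ : Mem) : Prop := ∀ a < k, Spec G a (σ a)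

theorem Known.frame {k a : ℕ} {σ μ : Mem} (h : G.Known k σ) (hμ : Frame a σ μ) (ha : k ≤ a) :
    G.Known k μ := by
  intro b hb
  by_cases h8 : b = 8
  · subst h8; trivial
  · rw [hμ b (by omega) h8]
    exact h b hb

theorem Known.n {k : ℕ} {σ : Mem} (h : G.Known k σ) (hk : 0 < k) : σ 0 0 = G.n := (h 0 hk).1

theorem Known.m {k : ℕ} {σ : Mem} (h : G.Known k σ) (hk : 0 < k) : σ 0 1 = G.m := (h 0 hk).2.1

theorem Known.d {k : ℕ} {σ : Mem} (h : G.Known k σ) (hk : 0 < k) : σ 0 2 = G.d := (h 0 hk).2.2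

/-- Memory number `k`, where arrays from `k` on are blank. -/
def Upto (G : NumGame) (k : ℕ) (σ : Mem) : Prop :=
  G.Known k σ ∧ ∀ a, k ≤ a → a ≠ 8 → ∀ x, σ a x = 0

theorem Upto.next {k S : ℕ} {σ : Mem} {q : Prog} (h : G.Upto k σ) (hk : k ≠ 8)
    (hq : Sets q σ S k (G.Spec k)) : ∃ τ, Exec q σ τ S ∧ G.Upto (k + 1) τ := by
  obtain ⟨τ, h1, h2, h3⟩ := hq
  refine ⟨τ, h1, fun a ha => ?_, fun a ha h8 x => ?_⟩
  · rcases Nat.lt_succ_iff_lt_or_eq.1 ha with h' | rfl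
    · exact h.1.frame h2 le_rfl a h'
    · exact h3
  · rw [h2 a (by omega) h8]
    exact h.2 a (by omega) h8 x

theorem _root_.RAM.Sets.seq {q q' : Prog} {σ : Mem} {S a : ℕ} {F F' : (ℕ → ℕ) → Prop}
    (h : Sets q σ S a F) (h' : ∀ τ, Frame a σ τ → F (τ a) → Sets q' τ S a F') :
    Sets (.seq q q') σ S a F' := by
  obtain ⟨τ, h1, h2, h3⟩ := h
  obtain ⟨υ, h4, h5, h6⟩ := h' τ h2 h3
  exact ⟨υ, h1.seq h4, fun b hb hb' => (h5 b hb hb').trans (h2 b hb hb'), h6⟩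

theorem _root_.RAM.Sets.mono {q : Prog} {σ : Mem} {S a : ℕ} {F F' : (ℕ → ℕ) → Prop}
    (h : Sets q σ S a F) (h' : ∀ g, F g → F' g) : Sets q σ S a F' := by
  obtain ⟨τ, h1, h2, h3⟩ := h
  exact ⟨τ, h1, h2, h' _ h3⟩

theorem _root_.RAM.sets_write {σ : Mem} {S : ℕ} (a : ℕ) (i x : Exp) (hS : 1 ≤ S) :
    Sets (.write a i x) σ S a fun g => g = Function.update (σ a) (i.val σ) (x.val σ) :=
  ⟨_, Exec.write hS, fun _ hb _ => Mem.write_of_ne _ _ _ hb, Mem.write_same _ _ _ _⟩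

/-! ### The preprocessing -/

abbrev nE : Exp := .read 0 (.lit 0)
abbrev mE : Exp := .read 0 (.lit 1)
abbrev dE : Exp := .read 0 (.lit 2)

/-- Array `a` is filled with the multiples of `x`, up to the one by `J`. -/
abbrev multiples (a : ℕ) (J x : Exp) : Prog :=
  fill a (.lit 1) J (.add (reg 1) (.lit 1)) (.add (.read a (reg 1)) x)

theorem sets_multiples {σ : Mem} {S a : ℕ} {J x : Exp} (L y : ℕ) (ha : a ≠ 8)
    (hJ : ∀ μ, Frame a σ μ → J.val μ = L) (hx : ∀ μ, Frame a σ μ → x.val μ = y)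
    (hS : L + 2 ≤ S) (h0 : σ a 0 = 0) :
    Sets (multiples a J x) σ S a fun g => ∀ k ≤ L, g k = k * y :=
  sets_scan L (fun k => k * y) ha hJ hS (by rw [h0, Nat.zero_mul]) fun k _ μ hμ h1 h2 => by
    simp only [Exp.val, reg, h1, h2, hx μ hμ, Nat.succ_mul]

section Phases

variable {S : ℕ} {σ : Mem}

theorem sets_vertexOffsets (h : G.Upto 9 σ) (hG : G.Fits S) :
    Sets (multiples 9 dE nE) σ S 9 (G.Spec 9) := by
  refine sets_multiples G.d G.n (by omega) (fun μ hμ => ?_) (fun μ hμ => ?_)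
    (hG.scan_pairs (by omega)) (h.2 _ (by omega) (by omega) _)
  · exact (h.1.frame hμ le_rfl).d (by omega)
  · exact (h.1.frame hμ le_rfl).n (by omega)

theorem sets_edgeOffsets (h : G.Upto 10 σ) (hG : G.Fits S) :
    Sets (multiples 10 dE mE) σ S 10 (G.Spec 10) := by
  refine sets_multiples G.d G.m (by omega) (fun μ hμ => ?_) (fun μ hμ => ?_)
    (hG.scan_pairs (by omega)) (h.2 _ (by omega) (by omega) _)
  · exact (h.1.frame hμ le_rfl).d (by omega)
  · exact (h.1.frame hμ le_rfl).m (by omega)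

/-- Marks the heads of the edges for which `val` is `1`. -/
abbrev markHeads (a : ℕ) (val : Exp) : Prog :=
  fill a dE mE (.add (.read 9 (reg 0)) (.read 3 (reg 1)))
    (maxE (.read a (.add (.read 9 (reg 0)) (.read 3 (reg 1)))) val)

/-- Edges with the same head address the same cell, so the mark is a maximum and the array must be
blank at the start. -/
theorem sets_markHeads {a : ℕ} {val : Exp} (R : ℕ → ℕ → Prop) (ha : 11 ≤ a) (h : G.Known 11 σ)
    (hG : G.Fits S) (h0 : ∀ x, σ a x = 0) (hval : ∀ c < G.d, ∀ j < G.m, ∀ μ, G.Known 11 μ →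
      μ 8 2 = c * G.m + j → val.val μ = ind (R c j)) :
    Sets (markHeads a val) σ S a fun g => ∀ c < G.d, ∀ w < G.n,
      g (c * G.n + w) = ind (∃ j < G.m, w = G.hd j ∧ R c j) := by
  refine (sets_mark (a := a) (I := dE) (J := mE) G.d G.m R (fun c j => c * G.n + G.hd j) (by omega)
    (fun μ hμ => (h.frame hμ ha).d (by omega)) (fun μ hμ => (h.frame hμ ha).m (by omega))
    (hG.loop_edges d_le_K m_le_M) h0 fun c hc j hj μ hμ h1 h2 h3 => ?_).mono
      fun g hg c hc w hw => ?_
  · have k := h.frame hμ ha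
    have k9 : ∀ c ≤ G.d, μ 9 c = c * G.n := k 9 (by omega)
    have k3 : ∀ j < G.m, μ 3 j = G.hd j := k 3 (by omega)
    refine ⟨?_, hval c hc j hj μ k h3⟩
    simp only [Exp.val, reg, h1, h2, k9 c hc.le, k3 j hj]
  · rw [hg]
    apply ind_congr
    constructor
    · rintro ⟨c', hc', j, hj, h1, h2⟩
      obtain ⟨rfl, rfl⟩ := GameIO.mul_add_inj hw (hG.valid.hd_lt j hj) h1
      exact ⟨j, hj, rfl, h2⟩
    · rintro ⟨j, hj, rfl, h2⟩
      exact ⟨c, hc, j, hj, rfl, h2⟩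

theorem sets_incIn (h : G.Upto 11 σ) (hG : G.Fits S) :
    Sets (markHeads 11 (.read 6 (reg 2))) σ S 11 (G.Spec 11) :=
  sets_markHeads G.inc le_rfl h.1 hG (h.2 _ le_rfl (by omega)) fun c hc j hj μ k h3 => by
    have k6 : ∀ c < G.d, ∀ j < G.m, μ 6 (c * G.m + j) = ind (G.inc c j) := k 6 (by omega)
    simp only [Exp.val, reg, h3, k6 c hc j hj]

theorem sets_epsIn (h : G.Upto 12 σ) (hG : G.Fits S) :
    Sets (markHeads 12 (.sub (.lit 1) (.read 6 (reg 2)))) σ S 12 (G.Spec 12) :=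
  sets_markHeads (fun c j => ¬ G.inc c j) (by omega) (fun a ha => h.1 a (by omega)) hG
    (h.2 _ le_rfl (by omega)) fun c hc j hj μ k h3 => by
      have k6 : ∀ c < G.d, ∀ j < G.m, μ 6 (c * G.m + j) = ind (G.inc c j) := k 6 (by omega)
      simp only [Exp.val, reg, h3, k6 c hc j hj, not_ind]

/-- Marks the columns `j < J` for which `val` is `1` in some row `c < d`. -/
abbrev markColumns (a : ℕ) (J val : Exp) : Prog :=
  fill a dE J (reg 1) (maxE (.read a (reg 1)) val)

theorem sets_markColumns {k a : ℕ} {J val : Exp} (nJ : ℕ) (R : ℕ → ℕ → Prop) (hk : 8 < k)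
    (ha : k ≤ a) (h : G.Known k σ) (hG : G.Fits S) (h0 : ∀ x, σ a x = 0)
    (hJ : ∀ μ, G.Known k μ → J.val μ = nJ) (hM : nJ ≤ G.M)
    (hval : ∀ c < G.d, ∀ j < nJ, ∀ μ, G.Known k μ →
      μ 8 2 = c * nJ + j → val.val μ = ind (R c j)) :
    Sets (markColumns a J val) σ S a fun g => ∀ j < nJ, g j = ind (∃ c < G.d, R c j) := by
  refine (sets_mark (a := a) (I := dE) (J := J) G.d nJ R (fun _ j => j) (by omega)
    (fun μ hμ => (h.frame hμ ha).d (by omega)) (fun μ hμ => hJ μ (h.frame hμ ha))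
    (hG.loop_edges d_le_K hM) h0 fun c hc j hj μ hμ h1 h2 h3 => ?_).mono fun g hg j hj => ?_
  · exact ⟨h2, hval c hc j hj μ (h.frame hμ ha) h3⟩
  · rw [hg]
    apply ind_congr
    constructor
    · rintro ⟨c, hc, j', -, rfl, h⟩
      exact ⟨c, hc, h⟩
    · rintro ⟨c, hc, h⟩
      exact ⟨c, hc, j, hj, rfl, h⟩

theorem sets_mixed (h : G.Upto 13 σ) (hG : G.Fits S) :
    Sets (markColumns 13 nE (.sub (.add (.read 11 (reg 2)) (.read 12 (reg 2))) (.lit 1))) σ S 13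
      (G.Spec 13) :=
  sets_markColumns (k := 13) G.n (fun c w => G.incIn c w ∧ G.epsIn c w) (by omega) le_rfl h.1 hG
    (h.2 _ le_rfl (by omega)) (fun μ k => k.n (by omega)) ((n_le_m hG.valid).trans m_le_M)
    fun c hc w hw μ k h3 => by
      have k11 : ∀ c < G.d, ∀ w < G.n, μ 11 (c * G.n + w) = ind (G.incIn c w) := k 11 (by omega)
      have k12 : ∀ c < G.d, ∀ w < G.n, μ 12 (c * G.n + w) = ind (G.epsIn c w) := k 12 (by omega)
      simp only [Exp.val, reg, h3, k11 c hc w hw, k12 c hc w hw, and_ind]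

theorem sets_anyInc (h : G.Upto 14 σ) (hG : G.Fits S) :
    Sets (markColumns 14 mE (.read 6 (reg 2))) σ S 14 (G.Spec 14) :=
  sets_markColumns (k := 14) G.m G.inc (by omega) le_rfl h.1 hG
    (h.2 _ le_rfl (by omega)) (fun μ k => k.m (by omega)) m_le_M
    fun c hc w hw μ k h3 => by
      have k6 : ∀ c < G.d, ∀ j < G.m, μ 6 (c * G.m + j) = ind (G.inc c j) := k 6 (by omega)
      simp only [Exp.val, reg, h3, k6 c hc w hw]

theorem cnt_succ (j : ℕ) : G.cnt (j + 1) = G.cnt j + ind (G.sub j) := by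
  classical
  rw [cnt, cnt, Nat.count_succ]
  by_cases h : G.sub j <;> simp [ind, h]

theorem sets_cnt (h : G.Upto 15 σ) (hG : G.Fits S) :
    Sets (fill 15 (.lit 1) mE (.add (reg 1) (.lit 1)) (.add (.read 15 (reg 1))
      (.sub (.add (.read 14 (reg 1)) (.read 13 (.read 3 (reg 1)))) (.lit 1)))) σ S 15
      (G.Spec 15) := by
  refine sets_scan G.m G.cnt (by omega) (fun μ hμ => (h.1.frame hμ le_rfl).m (by omega))
    (hG.scan_edges (m_le_M.trans (Nat.le_mul_of_pos_left _ one_le_K))) ?_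
    fun j hj μ hμ h1 h2 => ?_
  · rw [h.2 _ le_rfl (by omega), cnt, Nat.count_zero]
  · have k := h.1.frame hμ le_rfl
    have k3 : ∀ j < G.m, μ 3 j = G.hd j := k 3 (by omega)
    have k13 : ∀ w < G.n, μ 13 w = ind (G.mixed w) := k 13 (by omega)
    have k14 : ∀ j < G.m, μ 14 j = ind (G.anyInc j) := k 14 (by omega)
    simp only [Exp.val, reg, h1, h2, k3 j hj, k13 _ (hG.valid.hd_lt j hj), k14 j hj, and_ind,
      cnt_succ]
    rfl

/-- Every edge `j` writes its index to cell `cnt j`. Edges that are not subdivided do not advance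
the count and are overwritten, so the last entry of each cell below `s` is a subdivided edge. -/
theorem sets_nth (h : G.Upto 16 σ) (hG : G.Fits S) :
    Sets (fill 16 (.lit 1) mE (.read 15 (reg 1)) (reg 1)) σ S 16 (G.Spec 16) := by
  refine (sets_fill (J := mE) 1 G.m (fun k g => ∀ t < G.cnt k, g t = G.nth t) (by omega)
    (fun _ _ => rfl) (fun μ hμ => (h.1.frame hμ le_rfl).m (by omega))
    (hG.loop_edges one_le_K m_le_M) (fun t ht => ?_) ?_).mono fun g hg t ht => ?_
  · simp [cnt] at ht
  · intro i hi j hj μ hμ h1 h2 h3 h4 t ht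
    obtain rfl : i = 0 := by omega
    rw [Nat.zero_mul, Nat.zero_add] at h4 ht
    have k15 : ∀ j ≤ G.m, μ 15 j = G.cnt j := h.1.frame hμ le_rfl 15 (by omega)
    simp only [Exp.val, reg, h2, k15 j hj.le, Function.update_apply]
    rw [cnt_succ] at ht
    split_ifs with e
    · have hs : G.sub j := by
        by_contra hs
        rw [ind_neg hs] at ht
        omega
      rw [e, nth_cnt hs]
    · refine h4 t ?_
      have : ind (G.sub j) ≤ 1 := by unfold ind; split_ifs <;> omega
      omega
  · rw [Nat.one_mul] at hg
    exact hg t ht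

theorem sets_powers (h : G.Upto 17 σ) (hG : G.Fits S) :
    Sets (.seq (.write 17 (.lit 0) (.lit 1)) (fill 17 (.lit 1) dE (.add (reg 1) (.lit 1))
      (.add (.read 17 (reg 1)) (.read 17 (reg 1))))) σ S 17 (G.Spec 17) := by
  refine (sets_write 17 _ _ hG.one_le).seq fun τ hτ e => ?_
  have h' := h.1.frame hτ le_rfl
  refine sets_scan G.d (fun c => 2 ^ c) (by omega)
    (fun μ hμ => (h'.frame hμ le_rfl).d (by omega))
    (hG.scan_pairs (by omega)) ?_ fun j hj μ hμ h1 h2 => ?_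
  · rw [e]; rfl
  · simp only [Exp.val, reg, h1, h2]
    rw [pow_succ]; omega

theorem sets_dimensions (h : G.Upto 18 σ) (hG : G.Fits S) :
    Sets (.seq (.write 18 (.lit 0) (.add nE (.read 15 mE)))
      (.seq (.write 18 (.lit 1) (.add mE (.read 15 mE)))
        (.write 18 (.lit 2) (.add dE dE)))) σ S 18 (G.Spec 18) := by
  refine (sets_write 18 _ _ hG.one_le).seq fun τ hτ e => ?_
  have k := h.1
  have k' := h.1.frame hτ le_rfl
  refine (sets_write 18 _ _ hG.one_le).seq fun υ hυ e' => ?_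
  have k'' := k'.frame hυ le_rfl
  refine (sets_write 18 _ _ hG.one_le).mono fun g hg => ?_
  have k15 : ∀ j ≤ G.m, σ 15 j = G.cnt j := k 15 (by omega)
  have k15' : ∀ j ≤ G.m, τ 15 j = G.cnt j := k' 15 (by omega)
  simp only [Exp.val, k.n, k.m, k'.m, k''.d, Nat.zero_lt_succ, k15, k15', le_refl] at e e' hg
  rw [e] at e'
  rw [e'] at hg
  rw [hg]
  refine ⟨rfl, rfl, ?_⟩
  simp [two_mul]

theorem Known.N {k : ℕ} {σ : Mem} (h : G.Known k σ) (hk : 18 < k) : σ 18 0 = G.N := (h 18 hk).1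

theorem Known.M {k : ℕ} {σ : Mem} (h : G.Known k σ) (hk : 18 < k) : σ 18 1 = G.M := (h 18 hk).2.1

theorem Known.dd {k : ℕ} {σ : Mem} (h : G.Known k σ) (hk : 18 < k) : σ 18 2 = 2 * G.d :=
  (h 18 hk).2.2

end Phases

end NumGame

/-! ### Preprocessing: the subdivided arena, binary digits and offsets -/

namespace NumGame

open RAM

variable {G : NumGame}

/-- A single loop that fills the cells from `o` on. -/
theorem _root_.RAM.sets_row {a : ℕ} {J idx val : Exp} {σ : Mem} {S : ℕ} (nJ o : ℕ) (F : ℕ → ℕ)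
    (ha : a ≠ 8) (hJ : ∀ μ, Frame a σ μ → J.val μ = nJ) (hS : 1 * nJ + 1 + 1 ≤ S)
    (hstep : ∀ j < nJ, ∀ μ, Frame a σ μ → μ 8 1 = j → idx.val μ = o + j ∧ val.val μ = F j) :
    Sets (fill a (.lit 1) J idx val) σ S a fun g => (∀ j < nJ, g (o + j) = F j) ∧
      ∀ x, (x < o ∨ o + nJ ≤ x) → g x = σ a x := by
  refine (sets_table (I := .lit 1) 1 nJ o (fun _ j => F j) ha (fun _ _ => rfl) hJ hS
    fun i hi j hj μ hμ _ h2 _ => ?_).mono fun g hg => ⟨fun j hj => ?_, fun x hx => ?_⟩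
  · obtain rfl : i = 0 := by omega
    rw [Nat.zero_mul, Nat.zero_add]
    exact hstep j hj μ hμ h2
  · have := hg.1 0 Nat.one_pos j hj
    rwa [Nat.zero_mul, Nat.zero_add] at this
  · exact hg.2 x (by rwa [Nat.one_mul])

/-- The number of subdivided edges. -/
abbrev sE : Exp := .read 15 mE

abbrev KE : Exp := .read 17 dE

abbrev NE : Exp := .read 18 (.lit 0)

abbrev ME : Exp := .read 18 (.lit 1)

/-- Twice the number of pairs. -/
abbrev ddE : Exp := .read 18 (.lit 2)

section Values

variable {k : ℕ} {μ : Mem}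

theorem Known.val_nE (h : G.Known k μ) (hk : 0 < k) : nE.val μ = G.n := h.n hk

theorem Known.val_mE (h : G.Known k μ) (hk : 0 < k) : mE.val μ = G.m := h.m hk

theorem Known.val_dE (h : G.Known k μ) (hk : 0 < k) : dE.val μ = G.d := h.d hk

theorem Known.val_sE (h : G.Known k μ) (hk : 15 < k) : sE.val μ = G.s := by
  have k15 : ∀ j ≤ G.m, μ 15 j = G.cnt j := h 15 (by omega)
  simp only [Exp.val, h.m (show 0 < k by omega), k15 _ le_rfl, s]

theorem Known.val_KE (h : G.Known k μ) (hk : 17 < k) : KE.val μ = G.K := by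
  have k17 : ∀ j ≤ G.d, μ 17 j = 2 ^ j := h 17 (by omega)
  simp only [Exp.val, h.d (show 0 < k by omega), k17 _ le_rfl, K]

theorem Known.val_NE (h : G.Known k μ) (hk : 18 < k) : NE.val μ = G.N := h.N hk

theorem Known.val_ME (h : G.Known k μ) (hk : 18 < k) : ME.val μ = G.M := h.M hk

theorem Known.val_ddE (h : G.Known k μ) (hk : 18 < k) : ddE.val μ = 2 * G.d := h.dd hk

end Values

section Phases

variable {S : ℕ} {σ : Mem}

theorem sets_rowOffsets (h : G.Upto 19 σ) (hG : G.Fits S) :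
    Sets (multiples 19 ddE NE) σ S 19 (G.Spec 19) :=
  sets_multiples (2 * G.d) G.N (by omega)
    (fun μ hμ => (h.1.frame hμ le_rfl).val_ddE (by omega))
    (fun μ hμ => (h.1.frame hμ le_rfl).val_NE (by omega))
    (hG.scan_pairs le_rfl) (h.2 _ (by omega) (by omega) _)

theorem sets_tail2 (h : G.Upto 20 σ) (hG : G.Fits S) :
    Sets (.seq (fill 20 (.lit 1) mE (reg 1) (.read 2 (reg 1)))
      (fill 20 (.lit 1) sE (.add mE (reg 1)) (.add nE (reg 1)))) σ S 20 (G.Spec 20) := by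
  refine (sets_row G.m 0 G.tl (by omega) (fun μ hμ => (h.1.frame hμ le_rfl).val_mE (by omega))
    (hG.loop_edges one_le_K m_le_M) fun j hj μ hμ h1 => ?_).seq fun τ hτ e => ?_
  · have k2 : ∀ j < G.m, μ 2 j = G.tl j := h.1.frame hμ le_rfl 2 (by omega)
    simp only [Exp.val, reg, h1, k2 j hj, Nat.zero_add, and_self]
  · have k := h.1.frame hτ le_rfl
    refine (sets_row G.s G.m (fun j => G.n + j) (by omega)
      (fun μ hμ => (k.frame hμ le_rfl).val_sE (by omega))
      (hG.loop_edges one_le_K s_le_M) fun j hj μ hμ h1 => ?_).mono fun g hg j hj => ?_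
    · have k' := k.frame hμ le_rfl
      simp only [Exp.val, reg, h1, k'.m, k'.n, Nat.zero_lt_succ, and_self]
    · unfold tail2
      unfold M at hj
      split_ifs with hm
      · have := e.1 j hm
        rw [Nat.zero_add] at this
        rw [hg.2 j (Or.inl hm), this]
      · have := hg.1 (j - G.m) (by omega)
        rwa [show G.m + (j - G.m) = j by omega] at this

theorem sets_head2 (h : G.Upto 21 σ) (hG : G.Fits S) :
    Sets (.seq (fill 21 (.lit 1) mE (reg 1) (.read 3 (reg 1)))
      (.seq (fill 21 (.lit 1) sE (.read 16 (reg 1)) (.add nE (reg 1)))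
        (fill 21 (.lit 1) sE (.add mE (reg 1)) (.read 3 (.read 16 (reg 1)))))) σ S 21
      (G.Spec 21) := by
  refine (sets_row G.m 0 G.hd (by omega) (fun μ hμ => (h.1.frame hμ le_rfl).val_mE (by omega))
    (hG.loop_edges one_le_K m_le_M) fun j hj μ hμ h1 => ?_).seq fun τ hτ e => ?_
  · have k3 : ∀ j < G.m, μ 3 j = G.hd j := h.1.frame hμ le_rfl 3 (by omega)
    simp only [Exp.val, reg, h1, k3 j hj, Nat.zero_add, and_self]
  · have k := h.1.frame hτ le_rfl
    refine (sets_scatter (I := .lit 1) (J := sE) 1 G.s (fun _ t => G.nth t) (fun _ t => G.n + t)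
      (by omega) (fun _ _ => rfl) (fun μ hμ => (k.frame hμ le_rfl).val_sE (by omega))
      (hG.loop_edges one_le_K s_le_M) ?_ fun i hi t ht μ hμ _ h1 _ => ?_).seq fun υ hυ e' => ?_
    · intro i hi t ht i' hi' t' ht' h
      refine ⟨by omega, ?_⟩
      rw [← (nth_lt ht).2.2, ← (nth_lt ht').2.2, h]
    · have k' := k.frame hμ le_rfl
      have k16 : ∀ t < G.s, μ 16 t = G.nth t := k' 16 (by omega)
      simp only [Exp.val, reg, h1, k'.n, Nat.zero_lt_succ, and_self, k16 t ht]
    · have k' := k.frame hυ le_rfl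
      refine (sets_row G.s G.m (fun t => G.hd (G.nth t)) (by omega)
        (fun μ hμ => (k'.frame hμ le_rfl).val_sE (by omega))
        (hG.loop_edges one_le_K s_le_M) fun t ht μ hμ h1 => ?_).mono fun g hg j hj => ?_
      · have k'' := k'.frame hμ le_rfl
        have k16 : ∀ t < G.s, μ 16 t = G.nth t := k'' 16 (by omega)
        have k3 : ∀ j < G.m, μ 3 j = G.hd j := k'' 3 (by omega)
        simp only [Exp.val, reg, h1, k''.m, Nat.zero_lt_succ, k16 t ht, k3 _ (nth_lt ht).1,
          and_self]
      · unfold head2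
        unfold M at hj
        split_ifs with hm hs
        · have := e'.1 0 Nat.one_pos (G.cnt j) (cnt_lt hm hs)
          rw [nth_cnt hs] at this
          rw [hg.2 j (Or.inl hm), this]
        · have := e.1 j hm
          rw [Nat.zero_add] at this
          rw [hg.2 j (Or.inl hm), e'.2 j fun _ _ t ht ht' => hs (ht' ▸ (nth_lt ht).2.1), this]
        · have := hg.1 (j - G.m) (by omega)
          rwa [show G.m + (j - G.m) = j by omega] at this

/-- Three disjoint blocks are written: the original requests, the increments at vertices that are
not mixed, and those at midpoints. The remaining cells, requests of original pairs at midpoints,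
stay blank. -/
theorem sets_req (h : G.Upto 22 σ) (hG : G.Fits S) :
    Sets (.seq (fill 22 dE nE (.add (.read 19 (reg 0)) (reg 1)) (.read 4 (reg 2)))
      (.seq (fill 22 dE nE (.add (.read 19 (.add dE (reg 0))) (reg 1))
          (.sub (.read 11 (reg 2)) (.read 13 (reg 1))))
        (fill 22 dE sE (.add (.read 19 (.add dE (reg 0))) (.add nE (reg 1)))
          (.read 6 (.add (.read 10 (reg 0)) (.read 16 (reg 1))))))) σ S 22 (G.Spec 22) := by
  have hnN := n_le_N G
  have hnM : G.n ≤ G.M := (n_le_m hG.valid).trans m_le_M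
  refine (sets_scatter (I := dE) (J := nE) G.d G.n (fun c x => c * G.N + x)
    (fun c x => ind (G.q c x)) (by omega) (fun μ hμ => (h.1.frame hμ le_rfl).val_dE (by omega))
    (fun μ hμ => (h.1.frame hμ le_rfl).val_nE (by omega)) (hG.loop_edges d_le_K hnM)
    (fun c _ x hx c' _ x' hx' h => GameIO.mul_add_inj (by omega) (by omega) h)
    fun c hc x hx μ hμ h1 h2 h3 => ?_).seq fun τ hτ e => ?_
  · have k := h.1.frame hμ le_rfl
    have k4 : ∀ c < G.d, ∀ v < G.n, μ 4 (c * G.n + v) = ind (G.q c v) := k 4 (by omega)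
    have k19 : ∀ c ≤ 2 * G.d, μ 19 c = c * G.N := k 19 (by omega)
    simp only [Exp.val, reg, h1, h2, h3, k4 c hc x hx, k19 c (by omega), and_self]
  have k := h.1.frame hτ le_rfl
  refine (sets_scatter (I := dE) (J := nE) G.d G.n (fun c x => (G.d + c) * G.N + x)
    (fun c x => ind (G.incIn c x ∧ ¬ G.mixed x)) (by omega)
    (fun μ hμ => (k.frame hμ le_rfl).val_dE (by omega))
    (fun μ hμ => (k.frame hμ le_rfl).val_nE (by omega)) (hG.loop_edges d_le_K hnM)
    (fun c _ x hx c' _ x' hx' h => ?_)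
    fun c hc x hx μ hμ h1 h2 h3 => ?_).seq fun υ hυ e' => ?_
  · have := GameIO.mul_add_inj (show x < G.N by omega) (show x' < G.N by omega) h
    omega
  · have k := k.frame hμ le_rfl
    have k11 : ∀ c < G.d, ∀ v < G.n, μ 11 (c * G.n + v) = ind (G.incIn c v) := k 11 (by omega)
    have k13 : ∀ v < G.n, μ 13 v = ind (G.mixed v) := k 13 (by omega)
    have k19 : ∀ c ≤ 2 * G.d, μ 19 c = c * G.N := k 19 (by omega)
    simp only [Exp.val, reg, h1, h2, h3, k11 c hc x hx, k13 x hx, k19 (G.d + c) (by omega),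
      k.d (show 0 < 22 by omega), diff_ind, and_self]
  have k' := k.frame hυ le_rfl
  refine (sets_scatter (I := dE) (J := sE) G.d G.s (fun c t => (G.d + c) * G.N + (G.n + t))
    (fun c t => ind (G.inc c (G.nth t))) (by omega)
    (fun μ hμ => (k'.frame hμ le_rfl).val_dE (by omega))
    (fun μ hμ => (k'.frame hμ le_rfl).val_sE (by omega)) (hG.loop_edges d_le_K s_le_M)
    (fun c _ t ht c' _ t' ht' h => ?_)
    fun c hc t ht μ hμ h1 h2 h3 => ?_).mono fun g hg => ?_
  · have := GameIO.mul_add_inj (show G.n + t < G.N by unfold N; omega)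
      (show G.n + t' < G.N by unfold N; omega) h
    omega
  · have k := k'.frame hμ le_rfl
    have k6 : ∀ c < G.d, ∀ j < G.m, μ 6 (c * G.m + j) = ind (G.inc c j) := k 6 (by omega)
    have k10 : ∀ c ≤ G.d, μ 10 c = c * G.m := k 10 (by omega)
    have k16 : ∀ t < G.s, μ 16 t = G.nth t := k 16 (by omega)
    have k19 : ∀ c ≤ 2 * G.d, μ 19 c = c * G.N := k 19 (by omega)
    simp only [Exp.val, reg, h1, h2, k10 c hc.le, k16 t ht, k6 c hc _ (nth_lt ht).1,
      k19 (G.d + c) (by omega), k.d (show 0 < 22 by omega), k.n (show 0 < 22 by omega), and_self]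
  intro c hc x hx
  have hne : ∀ c' x', x' < G.N → (c ≠ c' ∨ x ≠ x') → c * G.N + x ≠ c' * G.N + x' := by
    intro c' x' hx' hcx h
    have := GameIO.mul_add_inj hx hx' h
    omega
  unfold req
  by_cases hcd : c < G.d
  · rw [if_pos hcd, hg.2 _ fun c' hc' t ht => hne _ _ (by unfold N; omega) (Or.inl (by omega)),
      e'.2 _ fun c' hc' x' hx' => hne _ _ (by omega) (Or.inl (by omega))]
    by_cases hxn : x < G.n
    · rw [e.1 c hcd x hxn]
      exact ind_congr (by simp [hxn])
    · rw [e.2 _ fun c' hc' x' hx' => hne _ _ (by omega) (Or.inr (by omega)),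
        h.2 _ le_rfl (by omega), ind_neg fun h => hxn h.1]
  · rw [if_neg hcd]
    obtain ⟨c, rfl⟩ := Nat.exists_eq_add_of_le (show G.d ≤ c by omega)
    rw [Nat.add_sub_cancel_left]
    by_cases hxn : x < G.n
    · rw [hg.2 _ fun c' hc' t ht => hne _ _ (by unfold N; omega) (Or.inr (by omega)),
        e'.1 c (by omega) x hxn]
      exact ind_congr (by simp [hxn])
    · have h1 := hg.1 c (by omega) (x - G.n) (by unfold N at hx; omega)
      simp only [show G.n + (x - G.n) = x by omega] at h1
      rw [h1]
      refine ind_congr ⟨fun h => Or.inr ⟨by omega, hx, h⟩, ?_⟩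
      rintro (h | h)
      · exact absurd h.1 hxn
      · exact h.2.2

theorem sets_resp (h : G.Upto 23 σ) (hG : G.Fits S) :
    Sets (fill 23 dE nE (.add (.read 19 (reg 0)) (reg 1)) (.read 5 (reg 2))) σ S 23
      (G.Spec 23) := by
  have hnN := n_le_N G
  have hnM : G.n ≤ G.M := (n_le_m hG.valid).trans m_le_M
  refine (sets_scatter (I := dE) (J := nE) G.d G.n (fun c x => c * G.N + x)
    (fun c x => ind (G.p c x)) (by omega) (fun μ hμ => (h.1.frame hμ le_rfl).val_dE (by omega))
    (fun μ hμ => (h.1.frame hμ le_rfl).val_nE (by omega)) (hG.loop_edges d_le_K hnM)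
    (fun c _ x hx c' _ x' hx' h => GameIO.mul_add_inj (by omega) (by omega) h)
    fun c hc x hx μ hμ h1 h2 h3 => ?_).mono fun g hg c hc x hx => ?_
  · have k := h.1.frame hμ le_rfl
    have k5 : ∀ c < G.d, ∀ v < G.n, μ 5 (c * G.n + v) = ind (G.p c v) := k 5 (by omega)
    have k19 : ∀ c ≤ 2 * G.d, μ 19 c = c * G.N := k 19 (by omega)
    simp only [Exp.val, reg, h1, h2, h3, k5 c hc x hx, k19 c (by omega), and_self]
  · unfold resp
    by_cases hxn : x < G.n
    · rw [hg.1 c hc x hxn]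
      exact ind_congr (by simp [hxn])
    · rw [hg.2 _ fun c' hc' x' hx' h => ?_, h.2 _ le_rfl (by omega), ind_neg fun h => hxn h.1]
      have := GameIO.mul_add_inj hx (by omega) h
      omega

/-- Every edge enters itself at its tail; whichever comes last is selected. -/
theorem sets_selection (h : G.Upto 24 σ) (hG : G.Fits S) :
    Sets (fill 24 (.lit 1) mE (.read 2 (reg 1)) (reg 1)) σ S 24 (G.Spec 24) := by
  refine (sets_fill (J := mE) 1 G.m
    (fun k g => ∀ j < k, g (G.tl j) < G.m ∧ G.tl (g (G.tl j)) = G.tl j) (by omega)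
    (fun _ _ => rfl) (fun μ hμ => (h.1.frame hμ le_rfl).m (by omega))
    (hG.loop_edges one_le_K m_le_M) (fun t ht => absurd ht (Nat.not_lt_zero t)) ?_).mono
    fun g hg v hv => ?_
  · intro i hi j hj μ hμ _ h2 _ h4 j' hj'
    obtain rfl : i = 0 := by omega
    rw [Nat.zero_mul, Nat.zero_add] at h4 hj'
    have k2 : ∀ j < G.m, μ 2 j = G.tl j := h.1.frame hμ le_rfl 2 (by omega)
    simp only [Exp.val, reg, h2, k2 j hj, Function.update_apply]
    split_ifs with e
    · exact ⟨hj, e.symm⟩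
    · refine h4 j' ?_
      rcases Nat.lt_succ_iff_lt_or_eq.1 hj' with h' | rfl
      · exact h'
      · exact absurd rfl e
  · obtain ⟨j, hj, rfl⟩ := hG.valid.exists_tl v hv
    exact hg j (by omega)

/-- Division is not available, so parities are found by alternation. Halves then arise as prefix
sums of parities, and the digits of all sets of requests from both. -/
theorem sets_parity (h : G.Upto 25 σ) (hG : G.Fits S) :
    Sets (fill 25 (.lit 1) KE (.add (reg 1) (.lit 1)) (.sub (.lit 1) (.read 25 (reg 1)))) σ S 25
      (G.Spec 25) := by
  refine sets_scan G.K (fun O => O % 2) (by omega)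
    (fun μ hμ => (h.1.frame hμ le_rfl).val_KE (by omega))
    (hG.scan_edges (Nat.le_mul_of_pos_right _ hG.M_pos)) (h.2 _ le_rfl (by omega) _)
    fun O hO μ hμ h1 h2 => ?_
  simp only [Exp.val, reg, h1, h2]
  omega

theorem sets_half (h : G.Upto 26 σ) (hG : G.Fits S) :
    Sets (fill 26 (.lit 1) KE (.add (reg 1) (.lit 1)) (.add (.read 26 (reg 1))
      (.read 25 (reg 1)))) σ S 26 (G.Spec 26) := by
  refine sets_scan G.K (fun O => O / 2) (by omega)
    (fun μ hμ => (h.1.frame hμ le_rfl).val_KE (by omega))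
    (hG.scan_edges (Nat.le_mul_of_pos_right _ hG.M_pos)) (h.2 _ le_rfl (by omega) _)
    fun O hO μ hμ h1 h2 => ?_
  have k25 : ∀ O ≤ G.K, μ 25 O = O % 2 := h.1.frame hμ le_rfl 25 (by omega)
  simp only [Exp.val, reg, h1, h2, k25 O hO.le]
  omega

theorem sets_setOffsets (h : G.Upto 27 σ) (hG : G.Fits S) :
    Sets (multiples 27 dE KE) σ S 27 (G.Spec 27) :=
  sets_multiples G.d G.K (by omega)
    (fun μ hμ => (h.1.frame hμ le_rfl).val_dE (by omega))
    (fun μ hμ => (h.1.frame hμ le_rfl).val_KE (by omega))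
    (hG.scan_pairs (by omega)) (h.2 _ (by omega) (by omega) _)

theorem sets_testBit (h : G.Upto 28 σ) (hG : G.Fits S) :
    Sets (.seq (fill 28 (.lit 1) KE (reg 1) (.read 25 (reg 1)))
      (fill 28 (.sub dE (.lit 1)) KE (.add (.read 27 (.add (reg 0) (.lit 1))) (reg 1))
        (.read 28 (.add (.read 27 (reg 0)) (.read 26 (reg 1)))))) σ S 28 (G.Spec 28) := by
  have hKN : G.K ≤ G.K * G.N := Nat.le_mul_of_pos_right _ hG.N_pos
  refine (sets_row G.K 0 (fun O => O % 2) (by omega)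
    (fun μ hμ => (h.1.frame hμ le_rfl).val_KE (by omega))
    (hG.loop_pairs (by have := hG.d_pos; omega) hKN) fun O hO μ hμ h1 => ?_).seq fun τ hτ e => ?_
  · have k25 : ∀ O ≤ G.K, μ 25 O = O % 2 := h.1.frame hμ le_rfl 25 (by omega)
    simp only [Exp.val, reg, h1, k25 O hO.le, Nat.zero_add, and_self]
  have k := h.1.frame hτ le_rfl
  -- Row `c + 1` at `O` is row `c` at `O / 2`. Row `0` is already there, so the invariant is `K`
  -- cells ahead of the loop.
  refine (sets_fill (I := .sub dE (.lit 1)) (J := KE) (G.d - 1) G.K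
    (fun k g => ∀ c O, O < G.K → c * G.K + O < k + G.K →
      g (c * G.K + O) = ind (O.testBit c = true)) (by omega)
    (fun μ hμ => ?_) (fun μ hμ => (k.frame hμ le_rfl).val_KE (by omega))
    (hG.loop_pairs (by omega) hKN) (fun c O hO hc => ?_) ?_).mono fun g hg c hc O hO => ?_
  · simp only [Exp.val, (k.frame hμ le_rfl).d (show 0 < 28 by omega)]
  · obtain rfl : c = 0 := by
      by_contra hc0
      have : 1 * G.K ≤ c * G.K := Nat.mul_le_mul_right _ (by omega)
      omega
    have := e.1 O hO
    rw [Nat.zero_add] at this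
    rw [Nat.zero_mul, Nat.zero_add, this]
    unfold ind
    rw [Nat.testBit_zero]
    split_ifs with h2
    · simpa using h2
    · have h2 : ¬ O % 2 = 1 := by simpa using h2
      omega
  · intro i hi j hj μ hμ h1 h2 _ h4 c O hO hc
    have k' := k.frame hμ le_rfl
    have k26 : ∀ O ≤ G.K, μ 26 O = O / 2 := k' 26 (by omega)
    have k27 : ∀ c ≤ G.d, μ 27 c = c * G.K := k' 27 (by omega)
    simp only [Exp.val, reg, h1, h2, k26 j hj.le, k27 i (by omega), k27 (i + 1) (by omega),
      Function.update_apply]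
    split_ifs with e
    · obtain ⟨rfl, rfl⟩ := GameIO.mul_add_inj hO hj e
      rw [h4 i (O / 2) (by omega) (by omega), Nat.testBit_succ]
    · refine h4 c O hO ?_
      have : (i + 1) * G.K = i * G.K + G.K := Nat.succ_mul _ _
      omega
  · refine hg c O hO ?_
    have h1 := mul_add_lt (show c < G.d - 1 + 1 by omega) hO
    rwa [Nat.succ_mul] at h1

theorem sets_copyOffsets (h : G.Upto 29 σ) (hG : G.Fits S) :
    Sets (multiples 29 KE NE) σ S 29 (G.Spec 29) :=
  sets_multiples G.K G.N (by omega)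
    (fun μ hμ => (h.1.frame hμ le_rfl).val_KE (by omega))
    (fun μ hμ => (h.1.frame hμ le_rfl).val_NE (by omega))
    (hG.scan_edges (Nat.le_mul_of_pos_right _ hG.M_pos)) (h.2 _ (by omega) (by omega) _)

theorem sets_baseVertex (h : G.Upto 30 σ) (hG : G.Fits S) :
    Sets (fill 30 KE NE (reg 2) (reg 1)) σ S 30 (G.Spec 30) := by
  refine (sets_table (I := KE) (J := NE) G.K G.N 0 (fun _ x => x) (by omega)
    (fun μ hμ => (h.1.frame hμ le_rfl).val_KE (by omega))
    (fun μ hμ => (h.1.frame hμ le_rfl).val_NE (by omega))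
    (hG.loop_edges le_rfl (N_le_M hG.valid))
    fun O hO x hx μ hμ h1 h2 h3 => ?_).mono fun g hg O hO x hx => ?_
  · simp only [Exp.val, reg, h2, h3, Nat.zero_add, and_self]
  · have := hg.1 O hO x hx
    rwa [Nat.zero_add] at this

theorem sets_openSet (h : G.Upto 31 σ) (hG : G.Fits S) :
    Sets (fill 31 KE NE (reg 2) (reg 0)) σ S 31 (G.Spec 31) := by
  refine (sets_table (I := KE) (J := NE) G.K G.N 0 (fun O _ => O) (by omega)
    (fun μ hμ => (h.1.frame hμ le_rfl).val_KE (by omega))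
    (fun μ hμ => (h.1.frame hμ le_rfl).val_NE (by omega))
    (hG.loop_edges le_rfl (N_le_M hG.valid))
    fun O hO x hx μ hμ h1 h2 h3 => ?_).mono fun g hg O hO x hx => ?_
  · simp only [Exp.val, reg, h1, h3, Nat.zero_add, and_self]
  · have := hg.1 O hO x hx
    rwa [Nat.zero_add] at this

theorem sets_sinkShift (h : G.Upto 32 σ) (hG : G.Fits S) :
    Sets (.write 32 (.lit 1) (.sub KE (.lit 1))) σ S 32 (G.Spec 32) := by
  refine (sets_write 32 _ _ hG.one_le).mono fun g hg => ?_
  have e : (Exp.sub KE (.lit 1)).val σ = G.K - 1 := by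
    rw [Exp.val, h.1.val_KE (by omega)]; rfl
  rw [hg, e]
  exact ⟨h.2 32 le_rfl (by omega) 0, rfl⟩

theorem sets_headShift (h : G.Upto 33 σ) (hG : G.Fits S) :
    Sets (.write 33 (.lit 1) NE) σ S 33 (G.Spec 33) := by
  refine (sets_write 33 _ _ hG.one_le).mono fun g hg => ?_
  have := h.1.val_NE (by omega)
  rw [hg, this]
  exact ⟨h.2 33 le_rfl (by omega) 0, rfl⟩

/-- The number of vertices of the product. -/
abbrev KNE : Exp := .read 29 KE

/-- The number of edges of the product. -/
abbrev KME : Exp := .read 35 KE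

theorem Known.val_KNE {k : ℕ} {μ : Mem} (h : G.Known k μ) (hk : 29 < k) :
    KNE.val μ = G.K * G.N := by
  have k29 : ∀ O ≤ G.K, μ 29 O = O * G.N := h 29 (by omega)
  rw [KNE, Exp.val, h.val_KE (by omega), k29 _ le_rfl]

theorem Known.val_KME {k : ℕ} {μ : Mem} (h : G.Known k μ) (hk : 35 < k) :
    KME.val μ = G.K * G.M := by
  have k35 : ∀ O ≤ G.K, μ 35 O = O * G.M := h 35 (by omega)
  rw [KME, Exp.val, h.val_KE (by omega), k35 _ le_rfl]

theorem sets_pairOffsets (h : G.Upto 34 σ) (hG : G.Fits S) :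
    Sets (multiples 34 ddE KNE) σ S 34 (G.Spec 34) :=
  sets_multiples (2 * G.d) (G.K * G.N) (by omega)
    (fun μ hμ => (h.1.frame hμ le_rfl).val_ddE (by omega))
    (fun μ hμ => (h.1.frame hμ le_rfl).val_KNE (by omega))
    (hG.scan_pairs le_rfl) (h.2 _ (by omega) (by omega) _)

theorem sets_edgeCopyOffsets (h : G.Upto 35 σ) (hG : G.Fits S) :
    Sets (multiples 35 KE ME) σ S 35 (G.Spec 35) :=
  sets_multiples G.K G.M (by omega)
    (fun μ hμ => (h.1.frame hμ le_rfl).val_KE (by omega))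
    (fun μ hμ => (h.1.frame hμ le_rfl).val_ME (by omega))
    (hG.scan_edges (Nat.le_mul_of_pos_right _ hG.M_pos)) (h.2 _ (by omega) (by omega) _)

end Phases

end NumGame

/-! ### The preprocessing as one program -/

namespace NumGame

open RAM

variable {G : NumGame}

/-- The program that fills array `a` in the preprocessing. -/
def phase : ℕ → Prog
  | 9 => multiples 9 dE nE
  | 10 => multiples 10 dE mE
  | 11 => markHeads 11 (.read 6 (reg 2))
  | 12 => markHeads 12 (.sub (.lit 1) (.read 6 (reg 2)))
  | 13 => markColumns 13 nE (.sub (.add (.read 11 (reg 2)) (.read 12 (reg 2))) (.lit 1))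
  | 14 => markColumns 14 mE (.read 6 (reg 2))
  | 15 => fill 15 (.lit 1) mE (.add (reg 1) (.lit 1)) (.add (.read 15 (reg 1))
      (.sub (.add (.read 14 (reg 1)) (.read 13 (.read 3 (reg 1)))) (.lit 1)))
  | 16 => fill 16 (.lit 1) mE (.read 15 (reg 1)) (reg 1)
  | 17 => .seq (.write 17 (.lit 0) (.lit 1)) (fill 17 (.lit 1) dE (.add (reg 1) (.lit 1))
      (.add (.read 17 (reg 1)) (.read 17 (reg 1))))
  | 18 => .seq (.write 18 (.lit 0) (.add nE (.read 15 mE)))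
      (.seq (.write 18 (.lit 1) (.add mE (.read 15 mE)))
        (.write 18 (.lit 2) (.add dE dE)))
  | 19 => multiples 19 ddE NE
  | 20 => .seq (fill 20 (.lit 1) mE (reg 1) (.read 2 (reg 1)))
      (fill 20 (.lit 1) sE (.add mE (reg 1)) (.add nE (reg 1)))
  | 21 => .seq (fill 21 (.lit 1) mE (reg 1) (.read 3 (reg 1)))
      (.seq (fill 21 (.lit 1) sE (.read 16 (reg 1)) (.add nE (reg 1)))
        (fill 21 (.lit 1) sE (.add mE (reg 1)) (.read 3 (.read 16 (reg 1)))))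
  | 22 => .seq (fill 22 dE nE (.add (.read 19 (reg 0)) (reg 1)) (.read 4 (reg 2)))
      (.seq (fill 22 dE nE (.add (.read 19 (.add dE (reg 0))) (reg 1))
          (.sub (.read 11 (reg 2)) (.read 13 (reg 1))))
        (fill 22 dE sE (.add (.read 19 (.add dE (reg 0))) (.add nE (reg 1)))
          (.read 6 (.add (.read 10 (reg 0)) (.read 16 (reg 1))))))
  | 23 => fill 23 dE nE (.add (.read 19 (reg 0)) (reg 1)) (.read 5 (reg 2))
  | 24 => fill 24 (.lit 1) mE (.read 2 (reg 1)) (reg 1)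
  | 25 => fill 25 (.lit 1) KE (.add (reg 1) (.lit 1)) (.sub (.lit 1) (.read 25 (reg 1)))
  | 26 => fill 26 (.lit 1) KE (.add (reg 1) (.lit 1)) (.add (.read 26 (reg 1))
      (.read 25 (reg 1)))
  | 27 => multiples 27 dE KE
  | 28 => .seq (fill 28 (.lit 1) KE (reg 1) (.read 25 (reg 1)))
      (fill 28 (.sub dE (.lit 1)) KE (.add (.read 27 (.add (reg 0) (.lit 1))) (reg 1))
        (.read 28 (.add (.read 27 (reg 0)) (.read 26 (reg 1)))))
  | 29 => multiples 29 KE NE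
  | 30 => fill 30 KE NE (reg 2) (reg 1)
  | 31 => fill 31 KE NE (reg 2) (reg 0)
  | 32 => .write 32 (.lit 1) (.sub KE (.lit 1))
  | 33 => .write 33 (.lit 1) NE
  | 34 => multiples 34 ddE KNE
  | 35 => multiples 35 KE ME
  | _ => .skip

theorem sets_phase {a S : ℕ} {σ : Mem} (ha : 9 ≤ a) (ha' : a < 36) (h : G.Upto a σ)
    (hG : G.Fits S) : Sets (phase a) σ S a (G.Spec a) := by
  interval_cases a
  · exact sets_vertexOffsets h hG
  · exact sets_edgeOffsets h hG
  · exact sets_incIn h hG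
  · exact sets_epsIn h hG
  · exact sets_mixed h hG
  · exact sets_anyInc h hG
  · exact sets_cnt h hG
  · exact sets_nth h hG
  · exact sets_powers h hG
  · exact sets_dimensions h hG
  · exact sets_rowOffsets h hG
  · exact sets_tail2 h hG
  · exact sets_head2 h hG
  · exact sets_req h hG
  · exact sets_resp h hG
  · exact sets_selection h hG
  · exact sets_parity h hG
  · exact sets_half h hG
  · exact sets_setOffsets h hG
  · exact sets_testBit h hG
  · exact sets_copyOffsets h hG
  · exact sets_baseVertex h hG
  · exact sets_openSet h hG
  · exact sets_sinkShift h hG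
  · exact sets_headShift h hG
  · exact sets_pairOffsets h hG
  · exact sets_edgeCopyOffsets h hG

/-- The preprocessing. -/
def prep : ℕ → Prog
  | 0 => .skip
  | k + 1 => .seq (prep k) (phase (9 + k))

theorem exists_exec_prep {S : ℕ} {σ : Mem} (h : G.Upto 9 σ) (hG : G.Fits S) :
    ∀ k ≤ 27, ∃ τ, Exec (prep k) σ τ S ∧ G.Upto (9 + k) τ := by
  intro k hk
  induction k with
  | zero => exact ⟨σ, Exec.of_run (Run.skip σ) hG.one_le, h⟩
  | succ k ih =>
    obtain ⟨τ, h1, h2⟩ := ih (by omega)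
    obtain ⟨υ, h3, h4⟩ := h2.next (by omega) (sets_phase (by omega) (by omega) h2 hG)
    exact ⟨υ, h1.seq h3, h4⟩

/-! ### Writing down the product -/

section Product

variable (G) (sel : ℕ → ℕ) (D : Set ℕ)

open Classical in
/-- The intended contents of the arrays that depend on `D`. -/
def DynSpec : ℕ → (ℕ → ℕ) → Prop
  | 36, f => ∀ x, f x = ind (x ∈ D)
  | 37, f => ∀ O < G.K, ∀ x < G.N, f (O * G.N + x) = G.nxt D O x
  | 48, f => f 0 = G.K * G.N ∧ f 1 = G.K * G.M ∧ f 2 = 2 * G.d ∧ ∀ x, 3 ≤ x → f x = 0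
  | 50, f => ∀ y, f y = if y < G.K * G.N then G.pown D y else 0
  | 52, f => ∀ k, f k = if k < G.K * G.M then G.etail k else 0
  | 54, f => ∀ k, f k = if k < G.K * G.M then G.ehead sel D k else 0
  | 56, f => (∀ c < 2 * G.d, ∀ y < G.K * G.N, f (c * (G.K * G.N) + y) = ind (G.preq D c y)) ∧
      ∀ x, 2 * G.d * (G.K * G.N) ≤ x → f x = 0
  | 58, f => (∀ c < 2 * G.d, ∀ y < G.K * G.N, f (c * (G.K * G.N) + y) = ind (G.presp D c y)) ∧
      ∀ x, 2 * G.d * (G.K * G.N) ≤ x → f x = 0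
  | _, _ => True

/-- The arrays below `k` have their intended contents. -/
def Dyn (k : ℕ) (σ : Mem) : Prop :=
  (G.Known 36 σ ∧ σ 24 = sel) ∧ ∀ a < k, 36 ≤ a → DynSpec G sel D a (σ a)

/-- The sizes of the arrays of the input. -/
noncomputable def inputSize : ℕ → ℕ
  | 0 => 3
  | 1 => G.K * G.N
  | 2 => G.K * G.M
  | 3 => G.K * G.M
  | 4 => 2 * G.d * (G.K * G.N)
  | 5 => 2 * G.d * (G.K * G.N)
  | _ => 0

end Product

variable {sel : ℕ → ℕ} {D : Set ℕ}

theorem Dyn.frame {k a : ℕ} {σ μ : Mem} (h : Dyn G sel D k σ) (hμ : Frame a σ μ) (hk : 36 ≤ k)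
    (ha : k ≤ a) : Dyn G sel D k μ := by
  refine ⟨⟨h.1.1.frame hμ (hk.trans ha), ?_⟩, fun b hb hb' => ?_⟩
  · rw [hμ 24 (by omega) (by omega)]; exact h.1.2
  · rw [hμ b (by omega) (by omega)]
    exact h.2 b hb hb'

theorem Dyn.next {k S : ℕ} {σ : Mem} {q : Prog} (h : Dyn G sel D k σ) (hk : 36 ≤ k)
    (hq : Sets q σ S k (DynSpec G sel D k)) :
    ∃ τ, Exec q σ τ S ∧ Dyn G sel D (k + 1) τ ∧ Frame k σ τ := by
  obtain ⟨τ, h1, h2, h3⟩ := hq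
  have h' := h.frame h2 hk le_rfl
  refine ⟨τ, h1, ⟨h'.1, fun a ha ha' => ?_⟩, h2⟩
  rcases Nat.lt_succ_iff_lt_or_eq.1 ha with h'' | rfl
  · exact h'.2 a h'' ha'
  · exact h3

section Phases

variable {S : ℕ} {σ : Mem}

/-- The number of the pair that is handled in this row. -/
abbrev pairE : Exp := .sub (.sub dE (.lit 1)) (reg 0)

/-- The base vertex and the set of open requests of a vertex of the product. -/
abbrev baseE : Exp := .read 30 (reg 1)
abbrev setE : Exp := .read 31 (reg 1)

/-- Computes the next sets of open requests. -/
abbrev nxtProg : Prog :=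
  .seq (fill 37 (.lit 1) KNE (reg 1) (.lit 0)) <|
    fill 37 dE KNE (reg 1) (.add (.add (.read 37 (reg 1)) (.read 37 (reg 1)))
      (.sub (maxE (.read 28 (.add (.read 27 pairE) setE)) (.read 22 (.add (.read 19 pairE) baseE)))
        (maxE (.read 23 (.add (.read 19 pairE) baseE)) (.read 36 baseE))))

/-- Horner's rule for all vertices of the product at once: row `i` doubles the number found so far
and adds digit `d - 1 - i` of the new set, from the highest digit down. -/
theorem sets_nxt (h : Dyn G sel D 37 σ) (hG : G.Fits S) :
    Sets nxtProg σ S 37 (DynSpec G sel D 37) := by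
  refine (sets_row (G.K * G.N) 0 (fun _ => 0) (by omega)
    (fun μ hμ => (h.frame hμ (by omega) le_rfl).1.1.val_KNE (by omega))
    (hG.loop_pairs (by have := hG.d_pos; omega) le_rfl) fun j hj μ hμ h1 => ?_).seq
    fun τ hτ e => ?_
  · simp only [Exp.val, reg, h1, Nat.zero_add, and_self]
  have h' := h.frame hτ (by omega) le_rfl
  set b : ℕ → ℕ → Prop := fun y c => ((y / G.N).testBit c = true ∨ G.req c (y % G.N)) ∧
    ¬ G.resp c (y % G.N) ∧ y % G.N ∉ D with hb
  refine (sets_rows (I := dE) (J := KNE) G.d (G.K * G.N)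
    (fun i y => digits (b y) (G.d - i) i) (by omega)
    (fun μ hμ => (h'.frame hμ (by omega) le_rfl).1.1.val_dE (by omega))
    (fun μ hμ => (h'.frame hμ (by omega) le_rfl).1.1.val_KNE (by omega))
    (hG.loop_pairs (by omega) le_rfl) (fun y hy => ?_) fun i hi y hy μ hμ h1 h2 h3 => ?_).mono
    fun g hg O hO x hx => ?_
  · have := e.1 y hy
    rw [Nat.zero_add] at this
    rw [this, digits, Nat.ofBits_zero]
  · have k := h'.frame hμ (by omega) le_rfl
    have k28 : ∀ c < G.d, ∀ O < G.K, μ 28 (c * G.K + O) = ind (O.testBit c = true) :=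
      k.1.1 28 (by omega)
    have k27 : ∀ c ≤ G.d, μ 27 c = c * G.K := k.1.1 27 (by omega)
    have k19 : ∀ c ≤ 2 * G.d, μ 19 c = c * G.N := k.1.1 19 (by omega)
    have k22 : ∀ c < 2 * G.d, ∀ x < G.N, μ 22 (c * G.N + x) = ind (G.req c x) :=
      k.1.1 22 (by omega)
    have k23 : ∀ c < G.d, ∀ x < G.N, μ 23 (c * G.N + x) = ind (G.resp c x) := k.1.1 23 (by omega)
    have k30 : ∀ O < G.K, ∀ x < G.N, μ 30 (O * G.N + x) = x := k.1.1 30 (by omega)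
    have k31 : ∀ O < G.K, ∀ x < G.N, μ 31 (O * G.N + x) = O := k.1.1 31 (by omega)
    have k36 : ∀ x, μ 36 x = ind (x ∈ D) := k.2 36 (by omega) le_rfl
    obtain ⟨hO, hx⟩ := lt_of_lt_mul hy
    have k30' := k30 _ hO _ hx
    have k31' := k31 _ hO _ hx
    rw [Nat.div_add_mod'] at k30' k31'
    have hc : G.d - 1 - i < G.d := by omega
    simp only [maxE, Exp.val, reg, h1, h2, h3, k30', k31', k.1.1.d (show 0 < 36 by omega),
      k27 _ hc.le, k28 _ hc _ hO, k19 (G.d - 1 - i) (by omega), k22 (G.d - 1 - i) (by omega) _ hx,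
      k23 _ hc _ hx, k36, max_ind]
    -- After `i` rounds the digits from `d - i` on are known; the next one is prepended at the low
    -- end.
    rw [diff_ind, digits_succ, show G.d - (i + 1) + 1 = G.d - i by omega,
      show G.d - (i + 1) = G.d - 1 - i by omega, two_mul]
    congr 1
    exact ind_congr (by simp only [hb, not_or])
  · rw [hg _ (mul_add_lt hO hx), Nat.sub_self, nxt]
    simp only [hb, pair_div hx, pair_mod hx]

theorem sets_viewDimensions (h : Dyn G sel D 48 σ) (hG : G.Fits S) (h0 : ∀ x, 3 ≤ x → σ 48 x = 0) :
    Sets (.seq (.write 48 (.lit 0) KNE) (.seq (.write 48 (.lit 1) KME)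
      (.write 48 (.lit 2) ddE))) σ S 48 (DynSpec G sel D 48) := by
  refine (sets_write 48 _ _ hG.one_le).seq fun τ hτ e => ?_
  have k' := h.frame hτ (by omega) le_rfl
  refine (sets_write 48 _ _ hG.one_le).seq fun υ hυ e' => ?_
  have k'' := k'.frame hυ (by omega) le_rfl
  refine (sets_write 48 _ _ hG.one_le).mono fun g hg => ?_
  rw [h.1.1.val_KNE (by omega)] at e
  rw [k'.1.1.val_KME (by omega), e] at e'
  rw [k''.1.1.val_ddE (by omega), e'] at hg
  rw [hg]
  refine ⟨rfl, rfl, rfl, fun x hx => ?_⟩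
  simp only [Exp.val, Function.update_apply]
  rw [if_neg (by omega), if_neg (by omega), if_neg (by omega), h0 x hx]

/-- Owners are `0` or `1`, so subtracting the indicator of `D` gives the vertices of `D` to Player
`0`. -/
theorem sets_viewOwners (h : Dyn G sel D 50 σ) (hG : G.Fits S)
    (h0 : ∀ x, G.K * G.N ≤ x → σ 50 x = 0) :
    Sets (fill 50 (.lit 1) KNE (reg 1) (.sub (.read 1 baseE) (.read 36 baseE))) σ S 50
      (DynSpec G sel D 50) := by
  refine (sets_row (G.K * G.N) 0 (G.pown D) (by omega)
    (fun μ hμ => (h.frame hμ (by omega) le_rfl).1.1.val_KNE (by omega))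
    (hG.loop_pairs (by have := hG.d_pos; omega) le_rfl) fun y hy μ hμ h1 => ?_).mono
    fun g hg y => ?_
  · have k := h.frame hμ (by omega) le_rfl
    have k1 : ∀ v, μ 1 v = if v < G.n then G.own v else 0 := k.1.1 1 (by omega)
    have k30 : ∀ O < G.K, ∀ x < G.N, μ 30 (O * G.N + x) = x := k.1.1 30 (by omega)
    have k36 : ∀ x, μ 36 x = ind (x ∈ D) := k.2 36 (by omega) le_rfl
    obtain ⟨hO, hx⟩ := lt_of_lt_mul hy
    have k30' := k30 _ hO _ hx
    rw [Nat.div_add_mod'] at k30'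
    simp only [Exp.val, reg, h1, k30', k1, k36, Nat.zero_add, true_and, pown]
    have h2 := hG.valid.own_lt (y % G.N)
    by_cases h3 : y % G.N < G.n <;> by_cases h4 : y % G.N ∈ D <;> simp [ind, h3, h4]
    omega
  · split_ifs with hy
    · rw [← hg.1 y hy, Nat.zero_add]
    · rw [hg.2 y (Or.inr (by omega)), h0 y (by omega)]

theorem sets_viewTails (h : Dyn G sel D 52 σ) (hG : G.Fits S)
    (h0 : ∀ x, G.K * G.M ≤ x → σ 52 x = 0) :
    Sets (fill 52 KE ME (reg 2) (.add (.read 29 (reg 0)) (.read 20 (reg 1)))) σ S 52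
      (DynSpec G sel D 52) := by
  refine (sets_table (I := KE) (J := ME) G.K G.M 0 (fun O j => O * G.N + G.tail2 j) (by omega)
    (fun μ hμ => (h.frame hμ (by omega) le_rfl).1.1.val_KE (by omega))
    (fun μ hμ => (h.frame hμ (by omega) le_rfl).1.1.val_ME (by omega))
    (hG.loop_edges le_rfl le_rfl) fun O hO j hj μ hμ h1 h2 h3 => ?_).mono fun g hg k => ?_
  · have k := h.frame hμ (by omega) le_rfl
    have k29 : ∀ O ≤ G.K, μ 29 O = O * G.N := k.1.1 29 (by omega)
    have k20 : ∀ j < G.M, μ 20 j = G.tail2 j := k.1.1 20 (by omega)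
    simp only [Exp.val, reg, h1, h2, h3, k29 O hO.le, k20 j hj, Nat.zero_add, and_self]
  · split_ifs with hk
    · obtain ⟨hO, hj⟩ := lt_of_lt_mul hk
      have := hg.1 _ hO _ hj
      rwa [Nat.zero_add, Nat.div_add_mod'] at this
    · rw [hg.2 k (Or.inr (by omega)), h0 k (by omega)]

/-- The indicator of a redirected edge. -/
abbrev redirE : Exp := .sub (.read 36 (.read 20 (reg 1)))
  (.add (.sub (.read 24 (.read 20 (reg 1))) (reg 1)) (.sub (reg 1) (.read 24 (.read 20 (reg 1)))))

/-- The sum of both truncated differences is the distance between the selected edge and `j`;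
subtracted from the indicator of `D`, it leaves `1` exactly if it vanishes and the tail is in `D`.
-/
theorem val_redirE (h : Dyn G sel D 37 σ) {j : ℕ} (hj : j < G.M) (h1 : σ 8 1 = j) :
    redirE.val σ = ind (G.redirected sel D j) := by
  have k20 : ∀ j < G.M, σ 20 j = G.tail2 j := h.1.1 20 (by omega)
  have k36 : ∀ x, σ 36 x = ind (x ∈ D) := h.2 36 (by omega) le_rfl
  simp only [Exp.val, reg, h1, k20 j hj, k36, h.1.2]
  unfold redirected ind
  by_cases h2 : G.tail2 j ∈ D <;> by_cases h3 : sel (G.tail2 j) = j <;> simp [h2, h3]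
  omega

/-- A case distinction by arithmetic: subtracting `N` cancels whichever of `head2` and `tail2` is
not wanted, as both are below `N`. On a redirected edge the memory is `0`, so adding `K - 1`
addresses the last copy. -/
theorem sets_viewHeads (h : Dyn G sel D 54 σ) (hG : G.Fits S)
    (h0 : ∀ x, G.K * G.M ≤ x → σ 54 x = 0) :
    Sets (fill 54 KE ME (reg 2) (.add
      (.read 29 (.add (.read 37 (.add (.read 29 (reg 0)) (.read 20 (reg 1)))) (.read 32 redirE)))
      (.add (.sub (.read 21 (reg 1)) (.read 33 redirE))
        (.sub (.read 20 (reg 1)) (.read 33 (.sub (.lit 1) redirE)))))) σ S 54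
      (DynSpec G sel D 54) := by
  classical
  refine (sets_table (I := KE) (J := ME) G.K G.M 0
    (fun O j => if G.redirected sel D j then (G.K - 1) * G.N + G.tail2 j
      else G.nxt D O (G.tail2 j) * G.N + G.head2 j) (by omega)
    (fun μ hμ => (h.frame hμ (by omega) le_rfl).1.1.val_KE (by omega))
    (fun μ hμ => (h.frame hμ (by omega) le_rfl).1.1.val_ME (by omega))
    (hG.loop_edges le_rfl le_rfl) fun O hO j hj μ hμ h1 h2 h3 => ?_).mono fun g hg k => ?_
  · have k := h.frame hμ (by omega) le_rfl
    have k29 : ∀ O ≤ G.K, μ 29 O = O * G.N := k.1.1 29 (by omega)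
    have k20 : ∀ j < G.M, μ 20 j = G.tail2 j := k.1.1 20 (by omega)
    have k21 : ∀ j < G.M, μ 21 j = G.head2 j := k.1.1 21 (by omega)
    have k32 : μ 32 0 = 0 ∧ μ 32 1 = G.K - 1 := k.1.1 32 (by omega)
    have k33 : μ 33 0 = 0 ∧ μ 33 1 = G.N := k.1.1 33 (by omega)
    have k37 : ∀ O < G.K, ∀ x < G.N, μ 37 (O * G.N + x) = G.nxt D O x := k.2 37 (by omega) (by omega)
    have hr : redirE.val μ = ind (G.redirected sel D j) :=
      val_redirE ⟨k.1, fun a ha => k.2 a (by omega)⟩ hj h2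
    have ht := tail2_lt hG.valid hj
    have hh := head2_lt hG.valid hj
    generalize redirE = r at hr
    simp only [Exp.val, reg, h1, h2, h3, k29 O hO.le, k20 j hj, k21 j hj, hr, k37 O hO _ ht,
      Nat.zero_add, true_and]
    by_cases hred : G.redirected sel D j
    · simp only [ind_pos hred, if_pos hred, k32, k33, nxt_of_mem O hred.1, Nat.zero_add,
        Nat.sub_self, Nat.sub_zero, Nat.sub_eq_zero_of_le hh.le,
        k29 (G.K - 1) (Nat.sub_le _ _)]
    · simp only [ind_neg hred, if_neg hred, k32, k33, Nat.add_zero, Nat.sub_zero,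
        Nat.sub_eq_zero_of_le ht.le, k29 _ (nxt_lt D O _).le]
  · split_ifs with hk
    · obtain ⟨hO, hj⟩ := lt_of_lt_mul hk
      have := hg.1 _ hO _ hj
      rwa [Nat.zero_add, Nat.div_add_mod'] at this
    · rw [hg.2 k (Or.inr (by omega)), h0 k (by omega)]

theorem sets_viewRequests (h : Dyn G sel D 56 σ) (hG : G.Fits S)
    (h0 : ∀ x, 2 * G.d * (G.K * G.N) ≤ x → σ 56 x = 0) :
    Sets (fill 56 ddE KNE (reg 2) (.sub (.read 22 (.add (.read 19 (reg 0)) baseE))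
      (.read 36 baseE))) σ S 56 (DynSpec G sel D 56) := by
  refine (sets_table (I := ddE) (J := KNE) (2 * G.d) (G.K * G.N) 0
    (fun c y => ind (G.preq D c y)) (by omega)
    (fun μ hμ => (h.frame hμ (by omega) le_rfl).1.1.val_ddE (by omega))
    (fun μ hμ => (h.frame hμ (by omega) le_rfl).1.1.val_KNE (by omega))
    (hG.loop_pairs le_rfl le_rfl) fun c hc y hy μ hμ h1 h2 h3 => ?_).mono fun g hg => ?_
  · have k := h.frame hμ (by omega) le_rfl
    have k19 : ∀ c ≤ 2 * G.d, μ 19 c = c * G.N := k.1.1 19 (by omega)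
    have k22 : ∀ c < 2 * G.d, ∀ x < G.N, μ 22 (c * G.N + x) = ind (G.req c x) :=
      k.1.1 22 (by omega)
    have k30 : ∀ O < G.K, ∀ x < G.N, μ 30 (O * G.N + x) = x := k.1.1 30 (by omega)
    have k36 : ∀ x, μ 36 x = ind (x ∈ D) := k.2 36 (by omega) le_rfl
    obtain ⟨hO, hx⟩ := lt_of_lt_mul hy
    have k30' := k30 _ hO _ hx
    rw [Nat.div_add_mod'] at k30'
    simp only [Exp.val, reg, h1, h2, h3, k19 c hc.le, k30', k22 c hc _ hx, k36, diff_ind,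
      Nat.zero_add, true_and]
    rfl
  · refine ⟨fun c hc y hy => ?_, fun x hx => ?_⟩
    · rw [← hg.1 c hc y hy, Nat.zero_add]
    · rw [hg.2 x (Or.inr (by omega)), h0 x hx]

theorem sets_viewResponses (h : Dyn G sel D 58 σ) (hG : G.Fits S)
    (h0 : ∀ x, 2 * G.d * (G.K * G.N) ≤ x → σ 58 x = 0) :
    Sets (.seq (fill 58 dE KNE (reg 2) (maxE (.read 23 (.add (.read 19 (reg 0)) baseE))
        (.read 36 baseE)))
      (fill 58 dE KNE (.add (.read 34 dE) (reg 2))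
        (maxE (.sub (.lit 1) (.read 28 (.add (.read 27 (reg 0)) setE))) (.read 36 baseE)))) σ S 58
      (DynSpec G sel D 58) := by
  refine (sets_table (I := dE) (J := KNE) G.d (G.K * G.N) 0
    (fun c y => ind (G.presp D c y)) (by omega)
    (fun μ hμ => (h.frame hμ (by omega) le_rfl).1.1.val_dE (by omega))
    (fun μ hμ => (h.frame hμ (by omega) le_rfl).1.1.val_KNE (by omega))
    (hG.loop_pairs (by omega) le_rfl) fun c hc y hy μ hμ h1 h2 h3 => ?_).seq fun τ hτ e => ?_
  · have k := h.frame hμ (by omega) le_rfl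
    have k19 : ∀ c ≤ 2 * G.d, μ 19 c = c * G.N := k.1.1 19 (by omega)
    have k23 : ∀ c < G.d, ∀ x < G.N, μ 23 (c * G.N + x) = ind (G.resp c x) :=
      k.1.1 23 (by omega)
    have k30 : ∀ O < G.K, ∀ x < G.N, μ 30 (O * G.N + x) = x := k.1.1 30 (by omega)
    have k36 : ∀ x, μ 36 x = ind (x ∈ D) := k.2 36 (by omega) le_rfl
    obtain ⟨hO, hx⟩ := lt_of_lt_mul hy
    have k30' := k30 _ hO _ hx
    rw [Nat.div_add_mod'] at k30'
    simp only [maxE, Exp.val, reg, h1, h2, h3, k19 c (by omega), k30', k23 c hc _ hx, k36, max_ind,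
      Nat.zero_add, true_and, presp, if_pos hc]
  have k' := h.frame hτ (by omega) le_rfl
  refine (sets_table (I := dE) (J := KNE) G.d (G.K * G.N) (G.d * (G.K * G.N))
    (fun c y => ind (G.presp D (G.d + c) y)) (by omega)
    (fun μ hμ => (k'.frame hμ (by omega) le_rfl).1.1.val_dE (by omega))
    (fun μ hμ => (k'.frame hμ (by omega) le_rfl).1.1.val_KNE (by omega))
    (hG.loop_pairs (by omega) le_rfl) fun c hc y hy μ hμ h1 h2 h3 => ?_).mono fun g hg => ?_
  · have k := k'.frame hμ (by omega) le_rfl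
    have k34 : ∀ c ≤ 2 * G.d, μ 34 c = c * (G.K * G.N) := k.1.1 34 (by omega)
    have k27 : ∀ c ≤ G.d, μ 27 c = c * G.K := k.1.1 27 (by omega)
    have k28 : ∀ c < G.d, ∀ O < G.K, μ 28 (c * G.K + O) = ind (O.testBit c = true) :=
      k.1.1 28 (by omega)
    have k30 : ∀ O < G.K, ∀ x < G.N, μ 30 (O * G.N + x) = x := k.1.1 30 (by omega)
    have k31 : ∀ O < G.K, ∀ x < G.N, μ 31 (O * G.N + x) = O := k.1.1 31 (by omega)
    have k36 : ∀ x, μ 36 x = ind (x ∈ D) := k.2 36 (by omega) le_rfl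
    obtain ⟨hO, hx⟩ := lt_of_lt_mul hy
    have k30' := k30 _ hO _ hx
    have k31' := k31 _ hO _ hx
    rw [Nat.div_add_mod'] at k30' k31'
    simp only [maxE, Exp.val, reg, h1, h2, h3, k34 G.d (by omega), k27 c hc.le, k30', k31',
      k28 c hc _ hO, k36, not_ind, max_ind, k.1.1.d (show 0 < 36 by omega), true_and, presp,
      Nat.add_sub_cancel_left, if_neg (show ¬ G.d + c < G.d by omega)]
  · refine ⟨fun c hc y hy => ?_, fun x hx => ?_⟩
    · rcases Nat.lt_or_ge c G.d with h' | h'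
      · have h1 := mul_add_lt h' hy
        rw [hg.2 _ (Or.inl h1), ← e.1 c h' y hy, Nat.zero_add]
      · obtain ⟨c, rfl⟩ := Nat.exists_eq_add_of_le h'
        rw [Nat.add_mul, Nat.add_assoc, hg.1 c (by omega) y hy]
    · have h1 : 2 * G.d * (G.K * G.N) = G.d * (G.K * G.N) + G.d * (G.K * G.N) := by ring
      rw [hg.2 x (Or.inr (by omega)), e.2 x (Or.inr (by omega)), h0 x hx]

end Phases

end NumGame

namespace NumGame

open RAM GameIO

variable {G : NumGame} {sel : ℕ → ℕ} {D : Set ℕ}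

/-! ### Running the solver for Streett games on the product -/

/-- The memory before the product with respect to `D` is solved. -/
structure Ready (G : NumGame) (sel : ℕ → ℕ) (D : Set ℕ) (σ : Mem) : Prop where
  dyn : Dyn G sel D 37 σ
  logs : ∀ a, σ (49 + 2 * a) 0 = 0
  clean : ∀ a x, G.inputSize a ≤ x → view σ a x = 0

theorem Dyn.extend {k k' : ℕ} {σ : Mem} (h : Dyn G sel D k σ)
    (h' : ∀ a, k ≤ a → a < k' → ∀ f, DynSpec G sel D a f) : Dyn G sel D k' σ := by
  refine ⟨h.1, fun a ha ha' => ?_⟩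
  rcases Nat.lt_or_ge a k with h'' | h''
  · exact h.2 a h'' ha'
  · exact h' a h'' ha _

/-- Writes the product as an input for the solver. -/
def load : Prog :=
  .seq nxtProg <|
  .seq (.seq (.write 48 (.lit 0) KNE) (.seq (.write 48 (.lit 1) KME) (.write 48 (.lit 2) ddE))) <|
  .seq (fill 50 (.lit 1) KNE (reg 1) (.sub (.read 1 baseE) (.read 36 baseE))) <|
  .seq (fill 52 KE ME (reg 2) (.add (.read 29 (reg 0)) (.read 20 (reg 1)))) <|
  .seq (fill 54 KE ME (reg 2) (.add
      (.read 29 (.add (.read 37 (.add (.read 29 (reg 0)) (.read 20 (reg 1)))) (.read 32 redirE)))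
      (.add (.sub (.read 21 (reg 1)) (.read 33 redirE))
        (.sub (.read 20 (reg 1)) (.read 33 (.sub (.lit 1) redirE)))))) <|
  .seq (fill 56 ddE KNE (reg 2) (.sub (.read 22 (.add (.read 19 (reg 0)) baseE))
      (.read 36 baseE))) <|
  .seq (fill 58 dE KNE (reg 2) (maxE (.read 23 (.add (.read 19 (reg 0)) baseE))
        (.read 36 baseE)))
      (fill 58 dE KNE (.add (.read 34 dE) (reg 2))
        (maxE (.sub (.lit 1) (.read 28 (.add (.read 27 (reg 0)) setE))) (.read 36 baseE)))

/-- Every array of the input is written afresh up to its size. So it suffices that the private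
memory is blank beyond these sizes; leftovers of an earlier round within them do no harm. -/
theorem exists_exec_load {S : ℕ} {σ : Mem} (h : Ready G sel D σ) (hG : G.Fits S) :
    ∃ τ, Exec load σ τ S ∧ Dyn G sel D 59 τ ∧ ∀ b, (b < 48 ∨ b % 2 = 1 ∨ 60 ≤ b) → b ≠ 8 →
      b ≠ 37 → τ b = σ b := by
  have hc : ∀ a, ∀ x, G.inputSize a ≤ x → σ (48 + 2 * a) x = 0 := h.clean
  obtain ⟨σ₁, r₁, h₁, f₁⟩ := h.dyn.next (by omega) (sets_nxt h.dyn hG)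
  have h₁ : Dyn G sel D 48 σ₁ := h₁.extend fun a ha ha' f => by interval_cases a <;> trivial
  obtain ⟨σ₂, r₂, h₂, f₂⟩ := h₁.next (by omega) (sets_viewDimensions h₁ hG fun x hx => by
    rw [f₁ _ (by omega) (by omega)]; exact hc 0 x hx)
  have h₂ : Dyn G sel D 50 σ₂ := h₂.extend fun a ha ha' f => by interval_cases a; trivial
  obtain ⟨σ₃, r₃, h₃, f₃⟩ := h₂.next (by omega) (sets_viewOwners h₂ hG fun x hx => by
    rw [f₂ _ (by omega) (by omega), f₁ _ (by omega) (by omega)]; exact hc 1 x hx)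
  have h₃ : Dyn G sel D 52 σ₃ := h₃.extend fun a ha ha' f => by interval_cases a; trivial
  obtain ⟨σ₄, r₄, h₄, f₄⟩ := h₃.next (by omega) (sets_viewTails h₃ hG fun x hx => by
    rw [f₃ _ (by omega) (by omega), f₂ _ (by omega) (by omega), f₁ _ (by omega) (by omega)]
    exact hc 2 x hx)
  have h₄ : Dyn G sel D 54 σ₄ := h₄.extend fun a ha ha' f => by interval_cases a; trivial
  obtain ⟨σ₅, r₅, h₅, f₅⟩ := h₄.next (by omega) (sets_viewHeads h₄ hG fun x hx => by
    rw [f₄ _ (by omega) (by omega), f₃ _ (by omega) (by omega), f₂ _ (by omega) (by omega),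
      f₁ _ (by omega) (by omega)]
    exact hc 3 x hx)
  have h₅ : Dyn G sel D 56 σ₅ := h₅.extend fun a ha ha' f => by interval_cases a; trivial
  obtain ⟨σ₆, r₆, h₆, f₆⟩ := h₅.next (by omega) (sets_viewRequests h₅ hG fun x hx => by
    rw [f₅ _ (by omega) (by omega), f₄ _ (by omega) (by omega), f₃ _ (by omega) (by omega),
      f₂ _ (by omega) (by omega), f₁ _ (by omega) (by omega)]
    exact hc 4 x hx)
  have h₆ : Dyn G sel D 58 σ₆ := h₆.extend fun a ha ha' f => by interval_cases a; trivial
  obtain ⟨σ₇, r₇, h₇, f₇⟩ := h₆.next (by omega) (sets_viewResponses h₆ hG fun x hx => by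
    rw [f₆ _ (by omega) (by omega), f₅ _ (by omega) (by omega), f₄ _ (by omega) (by omega),
      f₃ _ (by omega) (by omega), f₂ _ (by omega) (by omega), f₁ _ (by omega) (by omega)]
    exact hc 5 x hx)
  refine ⟨σ₇, r₁.seq (r₂.seq (r₃.seq (r₄.seq (r₅.seq (r₆.seq r₇))))), h₇, fun b hb h8 h37 => ?_⟩
  rw [f₇ _ (by omega) h8, f₆ _ (by omega) h8, f₅ _ (by omega) h8, f₄ _ (by omega) h8,
    f₃ _ (by omega) h8, f₂ _ (by omega) h8, f₁ _ h37 h8]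

theorem view_eq_zero_of_dyn {σ : Mem} (h : Dyn G sel D 59 σ)
    (hc : ∀ a, 6 ≤ a → ∀ x, view σ a x = 0) (a x : ℕ) (hx : G.inputSize a ≤ x) :
    view σ a x = 0 := by
  have k48 := h.2 48 (by omega) (by omega)
  have k50 := h.2 50 (by omega) (by omega)
  have k52 := h.2 52 (by omega) (by omega)
  have k54 := h.2 54 (by omega) (by omega)
  have k56 := h.2 56 (by omega) (by omega)
  have k58 := h.2 58 (by omega) (by omega)
  match a with
  | 0 => exact k48.2.2.2 x hx
  | 1 => exact (k50 x).trans (if_neg (Nat.not_lt.2 hx))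
  | 2 => exact (k52 x).trans (if_neg (Nat.not_lt.2 hx))
  | 3 => exact (k54 x).trans (if_neg (Nat.not_lt.2 hx))
  | 4 => exact k56.2 x hx
  | 5 => exact k58.2 x hx
  | a + 6 => exact hc (a + 6) (by omega) x

open Classical in
theorem eq_ite_of_cells {d n : ℕ} {f : ℕ → ℕ} {R : ℕ → ℕ → Prop} (Q : Fin d → Set (Fin n))
    (hQ : ∀ c v, v ∈ Q c ↔ R c v)
    (h1 : ∀ c < d, ∀ y < n, f (c * n + y) = ind (R c y)) (h2 : ∀ x, d * n ≤ x → f x = 0) (i : ℕ) :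
    f i = if ∃ (c : Fin d) (v : Fin n), i = c * n + v ∧ v ∈ Q c then 1 else 0 := by
  rcases Nat.lt_or_ge i (d * n) with hi | hi
  · obtain ⟨hc, hy⟩ := lt_of_lt_mul hi
    have := h1 _ hc _ hy
    rw [Nat.div_add_mod'] at this
    rw [this]
    refine (ind_congr (q := ∃ (c : Fin d) (v : Fin n), i = c * n + v ∧ v ∈ Q c)
      ⟨fun h => ⟨⟨_, hc⟩, ⟨_, hy⟩, (Nat.div_add_mod' i n).symm, (hQ _ _).2 h⟩, ?_⟩).trans ?_
    · rintro ⟨c, v, rfl, h⟩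
      simp only [pair_div v.2, pair_mod v.2]
      exact (hQ c v).1 h
    · unfold ind
      split_ifs <;> rfl
  · rw [h2 i hi, if_neg]
    rintro ⟨c, v, rfl, -⟩
    exact absurd (mul_add_lt c.2 v.2) (Nat.not_lt.2 hi)

theorem view_eq_streettInput {σ : Mem} (hG : G.Valid) (h : Dyn G sel D 59 σ)
    (hc : ∀ a, 6 ≤ a → ∀ x, view σ a x = 0) :
    view σ = streettInput (parena hG sel D) (pedges hG sel D) (ppairs G D) := by
  have k48 := h.2 48 (by omega) (by omega)
  have k50 := h.2 50 (by omega) (by omega)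
  have k52 := h.2 52 (by omega) (by omega)
  have k54 := h.2 54 (by omega) (by omega)
  have k56 := h.2 56 (by omega) (by omega)
  have k58 := h.2 58 (by omega) (by omega)
  funext a i
  match a with
  | 0 =>
    match i with
    | 0 => exact k48.1
    | 1 => exact k48.2.1
    | 2 => exact k48.2.2.1
    | i + 3 => exact (k48.2.2.2 (i + 3) (by omega)).trans (table_of_le _ (by omega)).symm
  | 1 =>
    refine (k50 i).trans ?_
    simp only [streettInput, table]
    split_ifs <;> rfl
  | 2 =>
    refine (k52 i).trans ?_
    simp only [streettInput, table]
    split_ifs <;> rfl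
  | 3 =>
    refine (k54 i).trans ?_
    simp only [streettInput, table]
    split_ifs <;> rfl
  | 4 => exact eq_ite_of_cells (ppairs G D).Q (fun _ _ => Iff.rfl) k56.1 k56.2 i
  | 5 => exact eq_ite_of_cells (ppairs G D).P (fun _ _ => Iff.rfl) k58.1 k58.2 i
  | a + 6 => exact hc (a + 6) (by omega) i

/-- The vertices from which Player `0` wins the product with respect to `D`. -/
def step (hG : G.Valid) (sel : ℕ → ℕ) (D : Set ℕ) : Set ℕ :=
  {x | x < G.n ∧ ∃ h : x < G.K * G.N,
    ⟨x, h⟩ ∈ (parena hG sel D).winningRegion (ppairs G D).streett 0}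

/-- Solves the product with respect to `D` and updates `D`. -/
def iteration (p : Prog) : Prog :=
  .seq load <| .seq p.logged <|
    .seq (fill 36 (.lit 1) nE (reg 1) (.sub (.lit 1) (.read 62 (reg 1)))) (clearArrays p.bound)

/-- The solver cannot tell its private arrays from a fresh input, since the logs are outside of its
view. Clearing the logged cells restores the zeros beyond the input, which makes the memory ready
for another round with the new `D`. -/
theorem exists_exec_iteration {p : Prog} {T : ℕ → ℕ → ℕ → ℕ} (hp : SolvesStreett p T) {S : ℕ}
    {σ : Mem} (h : Ready G sel D σ) (hD : ∀ x ∈ D, x < G.n) (hG : G.Fits S)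
    (hT : 13 * T (G.K * G.N) (G.K * G.M) (2 * G.d) + 1 ≤ S) :
    ∃ τ, Exec (iteration p) σ τ S ∧ Ready G sel (step hG.valid sel D) τ ∧ τ 7 = σ 7 ∧
      τ 38 = σ 38 := by
  obtain ⟨σ₁, r₁, h₁, f₁⟩ := exists_exec_load h hG
  have hc : ∀ a, 6 ≤ a → ∀ x, view σ₁ a x = 0 := fun a ha x => by
    have : view σ₁ a = view σ a := f₁ _ (by omega) (by omega) (by omega)
    rw [this]
    refine h.clean a x ?_
    obtain ⟨a, rfl⟩ := Nat.exists_eq_add_of_le' ha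
    exact Nat.zero_le x
  obtain ⟨t, μ, run, ht, hsol⟩ := hp _ _ _ hG.KN_pos (parena hG.valid sel D)
    (pedges hG.valid sel D) (ppairs G D) (isEdgeList_pedges hG.valid sel D hG.d_pos)
  obtain ⟨t', σ₂, r₂, ht', v₂, log⟩ := run.exists_logged σ₁ (view_eq_streettInput hG.valid h₁ hc)
  have h₂ : Dyn G sel D 37 σ₂ := by
    refine ⟨⟨fun a ha => ?_, ?_⟩, fun a ha ha' => ?_⟩
    · rw [log.low a (by omega)]; exact h₁.1.1 a ha
    · rw [log.low 24 (by omega)]; exact h₁.1.2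
    · rw [log.low a (by omega)]; exact h₁.2 a (by omega) ha'
  obtain ⟨σ₃, r₃, f₃, e₃⟩ := sets_row (σ := σ₂) (S := S) (a := 36) (J := nE) (idx := reg 1)
    (val := .sub (.lit 1) (.read 62 (reg 1))) G.n 0 (fun v => 1 - σ₂ 62 v) (by omega)
    (fun μ hμ => by
      rw [Exp.val, hμ 0 (by omega) (by omega)]; exact h₂.1.1.n (by omega))
    (hG.loop_edges one_le_K ((n_le_m hG.valid).trans m_le_M)) fun j hj μ hμ h1 => by
      simp only [Exp.val, reg, h1, hμ 62 (by omega) (by omega), Nat.zero_add, and_self]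
  have f₃' : ∀ b, 48 ≤ b → σ₃ b = σ₂ b := fun b hb => f₃ b (by omega) (by omega)
  -- Array `36` has been updated between the run and the clearing. A memory with the new low part
  -- and the old private part lets the log of the run also account for this state.
  obtain ⟨σ₀, lo, hi⟩ : ∃ σ₀ : Mem, (∀ b < 48, σ₀ b = σ₃ b) ∧ ∀ b, 48 ≤ b → σ₀ b = σ₁ b :=
    ⟨fun b => if b < 48 then σ₃ b else σ₁ b, fun b hb => if_pos hb, fun b hb => if_neg (by omega)⟩
  have ev : ∀ a, view σ₀ a = view σ₁ a := fun a => hi _ (by omega)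
  have ev' : ∀ a, view σ₃ a = view σ₂ a := fun a => f₃' _ (by omega)
  have log' : LogExtends p.bound σ₀ σ₃ t := by
    refine ⟨fun b hb => (lo b hb).symm, fun a => ?_, fun a => ?_, fun a k hk hk' => ?_,
      fun a i hi' => ?_, fun a ha => ?_⟩
    · rw [hi _ (by omega), f₃' _ (by omega)]; exact log.len_le a
    · rw [hi _ (by omega), f₃' _ (by omega)]; exact log.le_len a
    · rw [hi _ (by omega)] at hk' ⊢
      rw [f₃' _ (by omega)]; exact log.old a k hk hk'
    · rw [ev, ev'] at hi'
      rw [f₃' _ (by omega)]; exact log.log a i hi'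
    · rw [hi _ (by omega), f₃' _ (by omega), ev, ev']; exact log.high a ha
  obtain ⟨σ₄, r₄, f₄, l₄, c₄⟩ := exists_exec_clear (S := S) log' (fun a => by
    rw [hi _ (by omega), f₁ _ (by omega) (by omega) (by omega)]
    exact h.logs a) (by omega)
  refine ⟨σ₄, r₁.seq ((Exec.of_run r₂ (by omega)).seq (r₃.seq r₄)),
    ⟨⟨⟨?_, ?_⟩, ?_⟩, l₄, ?_⟩, ?_, ?_⟩
  · intro a ha
    rw [f₄ a (by omega)]
    exact h₂.1.1.frame f₃ le_rfl a ha
  · rw [f₄ 24 (by omega), f₃ 24 (by omega) (by omega)]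
    exact h₂.1.2
  · intro a ha ha'
    obtain rfl : a = 36 := by omega
    rw [f₄ 36 (by omega)]
    intro x
    rcases Nat.lt_or_ge x G.n with hx | hx
    · have hx' : x < G.K * G.N := (hx.trans_le (n_le_N G)).trans_le
        (Nat.le_mul_of_pos_left _ one_le_K)
      have e := e₃.1 x hx
      rw [Nat.zero_add] at e
      obtain ⟨i, hi, hw⟩ := hsol ⟨x, hx'⟩
      have e' : σ₂ 62 x = i := by rw [← hi, ← v₂]; rfl
      rw [e, e']
      match i with
      | 0 => exact (ind_pos ⟨hx, hx', hw⟩).symm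
      | 1 =>
        -- The solver names Player `1`; disjointness of the winning regions turns this into
        -- non-membership in the region of Player `0`.
        refine (ind_neg ?_).symm
        rintro ⟨_, _, hw'⟩
        exact Arena.winningRegion_disjoint _ _ _ hw' hw
    · rw [e₃.2 x (Or.inr (by omega))]
      have : σ₂ 36 x = ind (x ∈ D) := h₂.2 36 (by omega) le_rfl x
      rw [this, ind_neg fun hx' => absurd (hD x hx') (by omega),
        ind_neg fun hx' => absurd hx'.1 (by omega)]
  · intro a x hx
    rcases c₄ a x with h' | h'
    · rw [h', ev]
      exact view_eq_zero_of_dyn h₁ hc a x hx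
    · exact h'
  · rw [f₄ 7 (by omega), f₃ 7 (by omega) (by omega), log.low 7 (by omega)]
    exact f₁ 7 (by omega) (by omega) (by omega)
  · rw [f₄ 38 (by omega), f₃ 38 (by omega) (by omega), log.low 38 (by omega)]
    exact f₁ 38 (by omega) (by omega) (by omega)

/-! ### The whole program -/

/-- Iterates as often as `B` says. -/
def iterations (p : Prog) (B : Exp) : Prog :=
  .loop (.sub B (.read 38 (.lit 0)))
    (.seq (iteration p) (.write 38 (.lit 0) (.add (.read 38 (.lit 0)) (.lit 1))))

/-- Solves games with costs with the help of `p`. -/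
def costSolver (p : Prog) (B : Exp) : Prog :=
  .ite dE (.seq (prep 27) (.seq (iterations p B)
    (fill 7 (.lit 1) nE (reg 1) (.sub (.lit 1) (.read 36 (reg 1)))))) .skip

/-- Preprocessing and output are executed once and each of the `β` iterations takes at most its
weight times `S`. Since `1 ≤ β` and `1 ≤ S`, everything is bounded by a multiple of `β * S`, with a
constant that depends on the programs only. -/
theorem exists_run_costSolver {p : Prog} {T : ℕ → ℕ → ℕ → ℕ} (hp : SolvesStreett p T) {S : ℕ}
    {σ : Mem} (h : G.Upto 9 σ) (hG : G.Fits S)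
    (hT : 13 * T (G.K * G.N) (G.K * G.M) (2 * G.d) + 1 ≤ S) {B : Exp} {β : ℕ} (hβ : 1 ≤ β)
    (hB : ∀ μ, G.Known 36 μ → B.val μ = β) :
    ∃ t τ sel, Run (costSolver p B) σ t τ ∧ t ≤ 2 * (costSolver p B).weight * (β * S) ∧
      G.Selects sel ∧ ∀ v < G.n, τ 7 v = 1 - ind (v ∈ (step hG.valid sel)^[β] ∅) := by
  obtain ⟨σ₁, r₁, h₁⟩ := exists_exec_prep h hG 27 le_rfl
  set sel := σ₁ 24 with hsel
  have hn : ∀ k, ∀ x ∈ (step hG.valid sel)^[k] ∅, x < G.n := by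
    intro k x hx
    cases k with
    | zero => exact absurd hx (Set.notMem_empty x)
    | succ k => rw [Function.iterate_succ_apply'] at hx; exact hx.1
  have hready : Ready G sel ∅ σ₁ := by
    refine ⟨⟨⟨h₁.1, rfl⟩, fun a ha ha' => ?_⟩, fun a => h₁.2 _ (by omega) (by omega) _,
      fun a x _ => h₁.2 _ (by omega) (by omega) _⟩
    obtain rfl : a = 36 := by omega
    intro x
    rw [h₁.2 36 le_rfl (by omega), ind_neg (Set.notMem_empty x)]
  have hS := hG.one_le
  obtain ⟨t, σ₂, r₂, ht, h₂, -⟩ := exists_run_loop (.sub B (.read 38 (.lit 0)))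
    (.seq (iteration p) (.write 38 (.lit 0) (.add (.read 38 (.lit 0)) (.lit 1))))
    ((Prog.seq (iteration p) (.write 38 (.lit 0) (.add (.read 38 (.lit 0)) (.lit 1)))).weight * S) β
    (fun k τ => Ready G sel ((step hG.valid sel)^[k] ∅) τ ∧ τ 38 0 = k)
    (fun k hk τ hτ => by
      rw [Exp.val, hB τ hτ.1.dyn.1.1, Exp.val, Exp.val, hτ.2]; omega)
    (fun τ hτ => by
      rw [Exp.val, hB τ hτ.1.dyn.1.1, Exp.val, Exp.val, hτ.2]; omega)
    (fun k hk τ hτ => by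
      obtain ⟨υ, r, h1, -, h3⟩ := exists_exec_iteration hp hτ.1 (hn k) hG hT
      obtain ⟨t, run, ht⟩ := r.seq (Exec.write (a := 38) (i := .lit 0)
        (x := .add (.read 38 (.lit 0)) (.lit 1)) hS)
      have hne : ∀ b, b ≠ 38 → υ.write 38 0 (υ 38 0 + 1) b = υ b := fun b hb =>
        Mem.write_of_ne _ _ _ hb
      refine ⟨t, _, run, ht, ⟨⟨⟨fun a ha => ?_, ?_⟩, fun a ha ha' => ?_⟩, fun a => ?_,
        fun a x hx => ?_⟩, ?_⟩
      · change Spec G a (υ.write 38 0 (υ 38 0 + 1) a)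
        rw [hne a (by omega)]; exact h1.dyn.1.1 a ha
      · change υ.write 38 0 (υ 38 0 + 1) 24 = _
        rw [hne 24 (by omega)]; exact h1.dyn.1.2
      · change DynSpec G sel _ a (υ.write 38 0 (υ 38 0 + 1) a)
        rw [hne a (by omega), Function.iterate_succ_apply']; exact h1.dyn.2 a ha ha'
      · change υ.write 38 0 (υ 38 0 + 1) (49 + 2 * a) 0 = 0
        rw [hne _ (by omega)]; exact h1.logs a
      · change υ.write 38 0 (υ 38 0 + 1) (48 + 2 * a) x = 0
        rw [hne _ (by omega)]; exact h1.clean a x hx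
      · change υ.write 38 0 (υ 38 0 + 1) 38 0 = k + 1
        rw [Mem.write_same, Function.update_self, h3, hτ.2])
    σ₁ ⟨hready, h₁.2 _ (by omega) (by omega) _⟩
  obtain ⟨σ₃, r₃, f₃, e₃⟩ := sets_row (σ := σ₂) (S := S) (a := 7) (J := nE) (idx := reg 1)
    (val := .sub (.lit 1) (.read 36 (reg 1))) G.n 0 (fun v => 1 - σ₂ 36 v) (by omega)
    (fun μ hμ => by
      rw [Exp.val, hμ 0 (by omega) (by omega)]; exact h₂.dyn.1.1.n (by omega))
    (hG.loop_edges one_le_K ((n_le_m hG.valid).trans m_le_M)) fun j hj μ hμ h1 => by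
      simp only [Exp.val, reg, h1, hμ 36 (by omega) (by omega), Nat.zero_add, and_self]
  obtain ⟨t₁, run₁, ht₁⟩ := r₁
  obtain ⟨t₃, run₃, ht₃⟩ := r₃
  have hd : dE.val σ ≠ 0 := by
    rw [h.1.val_dE (by omega)]; exact hG.d_pos.ne'
  refine ⟨_, σ₃, sel, Run.ite_pos hd (run₁.seq (r₂.seq run₃)), ?_, h₁.1 24 (by omega),
    fun v hv => ?_⟩
  · have hSβ : S ≤ β * S := Nat.le_mul_of_pos_left _ hβ
    have hβS : β ≤ β * S := Nat.le_mul_of_pos_right _ hS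
    have h1β : 1 ≤ β * S := hS.trans hSβ
    have w1 : (costSolver p B).weight = dE.cost + 1 + ((prep 27).weight +
        ((iterations p B).weight + (fill 7 (.lit 1) nE (reg 1)
          (.sub (.lit 1) (.read 36 (reg 1)))).weight)) + 1 := rfl
    have w2 : (iterations p B).weight = (Exp.sub B (.read 38 (.lit 0))).cost + 1 +
        (Prog.seq (iteration p) (.write 38 (.lit 0)
          (.add (.read 38 (.lit 0)) (.lit 1)))).weight := rfl
    rw [w1, w2]
    generalize (prep 27).weight = a1 at *
    generalize (Prog.seq (iteration p) (.write 38 (.lit 0)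
          (.add (.read 38 (.lit 0)) (.lit 1)))).weight = a2 at *
    generalize (fill 7 (.lit 1) nE (reg 1) (.sub (.lit 1) (.read 36 (reg 1)))).weight = a3 at *
    generalize (Exp.sub B (.read 38 (.lit 0))).cost = a4 at *
    generalize dE.cost = a5 at *
    calc a5 + 1 + (t₁ + (t + t₃))
        ≤ (a5 + 1) * 1 + (a1 * S + ((β * (a4 + 1 + a2 * S) + (a4 + 1)) + a3 * S)) := by omega
      _ = (a5 + 1) * 1 + a1 * S + (a4 + 1) * β + a2 * (β * S) + (a4 + 1) * 1 + a3 * S := by ring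
      _ ≤ (a5 + 1) * (β * S) + a1 * (β * S) + (a4 + 1) * (β * S) + a2 * (β * S) +
          (a4 + 1) * (β * S) + a3 * (β * S) := by gcongr
      _ ≤ (a5 + 1) * (β * S) + a1 * (β * S) + (a4 + 1) * (β * S) + a2 * (β * S) +
          (a4 + 1) * (β * S) + a3 * (β * S) + (a5 + 1 + a1 + a2 + a3 + 2) * (β * S) :=
        Nat.le_add_right _ _
      _ = _ := by ring
  · have e := e₃.1 v hv
    rw [Nat.zero_add] at e
    have : σ₂ 36 v = ind (v ∈ (step hG.valid sel)^[β] ∅) := h₂.dyn.2 36 (by omega) le_rfl v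
    rw [e, this]

end NumGame

/-! ### Sinks without requests, and the empty target -/

namespace Arena

/-- Player `0` moves to `y` and stays there, so no pair is requested infinitely often. -/
theorem mem_winningRegion_of_sink {V : Type} {d : ℕ} (A : Arena V) (Γ : StreettPairs d V) {x y : V}
    (hx : A.owner x = 0) (hxy : A.Edge x y) (hy : A.owner y = 0) (hyy : A.Edge y y)
    (hQ : ∀ c, y ∉ Γ.Q c) : x ∈ A.winningRegion Γ.streett 0 := by
  classical
  choose f hf using A.exists_edge
  refine ⟨⟨fun _ u => if u = x ∨ u = y then y else f u, fun _ u _ => ?_⟩, fun ρ _ h0 hρ => ?_⟩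
  · split_ifs with h
    · rcases h with rfl | rfl
      · exact hxy
      · exact hyy
    · exact hf u
  · have hk : ∀ k, ρ (k + 1) = y := by
      intro k
      induction k with
      | zero => rw [hρ 0 (h0 ▸ hx)]; simp [h0]
      | succ k ih => rw [hρ (k + 1) (ih ▸ hy)]; simp [ih]
    rw [WonBy, if_pos rfl]
    intro c hc
    obtain ⟨k, hk1, hk2⟩ := frequently_atTop.1 hc 1
    obtain ⟨j, rfl⟩ := Nat.exists_eq_add_of_le' hk1
    rw [hk] at hk2
    exact absurd hk2 (hQ c)

theorem reach_empty {V : Type} : reach (∅ : Set V) = ∅ := by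
  ext ρ
  simp [reach]

end Arena

namespace GameIO

open NumGame RAM

variable {n m d : ℕ} {A : Arena (Fin n)} {e : Fin m → Fin n × Fin n} (Γ : StreettPairs d (Fin n))
  (Cst : CostFunctions d (Fin n))

/-! ### The winning regions of games with costs -/

theorem simulates_real_start (he : IsEdgeList A e) (hd : 1 ≤ d) {sel : ℕ → ℕ}
    (hsel : (numGame A e Γ Cst).Selects sel) (D : Set (Fin n)) (v : Fin n)
    (h : (v : ℕ) < (numGame A e Γ Cst).K * (numGame A e Γ Cst).N) :
    (simulates Γ Cst he hd hsel D).real v (simulates Γ Cst he hd hsel D).start = ⟨v, h⟩ := by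
  refine Fin.ext ?_
  change 0 * _ + (v : ℕ) = v
  rw [Nat.zero_mul, Nat.zero_add]

variable {Γ Cst}

theorem mem_winningRegion_zero_of_step (he : IsEdgeList A e) (hd : 1 ≤ d) {sel : ℕ → ℕ}
    (hsel : (numGame A e Γ Cst).Selects sel) {D : Set (Fin n)} {v : Fin n}
    (hv : (v : ℕ) ∈ step (numGame_valid Γ Cst he) sel (Fin.val '' D)) :
    v ∈ A.winningRegion (Γ.bndCostStreett Cst ∪ Arena.reach D) 0 := by
  obtain ⟨-, h, hw⟩ := hv
  rw [← simulates_real_start Γ Cst he hd hsel D v h] at hw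
  exact (simulates Γ Cst he hd hsel D).mem_winningRegion_zero hw

/-- This replaces a proof of determinacy: that the solver is correct on the product means that a
vertex outside of the region of Player `0` is in that of Player `1`. -/
theorem mem_winningRegion_one_of_step {p : Prog} {T : ℕ → ℕ → ℕ → ℕ} (hp : SolvesStreett p T)
    (he : IsEdgeList A e) (hd : 1 ≤ d) {sel : ℕ → ℕ}
    (hsel : (numGame A e Γ Cst).Selects sel) {D : Set (Fin n)} {v : Fin n}
    (hv : (v : ℕ) ∉ step (numGame_valid Γ Cst he) sel (Fin.val '' D)) :
    v ∈ A.winningRegion (Γ.relaxed Cst ∪ Arena.reach D) 1 := by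
  have h : (v : ℕ) < (numGame A e Γ Cst).K * (numGame A e Γ Cst).N :=
    (v.2.trans_le (n_le_N (numGame A e Γ Cst))).trans_le (Nat.le_mul_of_pos_left _ one_le_K)
  obtain ⟨-, μ, -, -, hsol⟩ := hp _ _ _ (Nat.zero_lt_of_lt h)
    (parena (numGame_valid Γ Cst he) sel (Fin.val '' D))
    (pedges (numGame_valid Γ Cst he) sel (Fin.val '' D)) (ppairs _ (Fin.val '' D))
    (isEdgeList_pedges _ _ _ hd)
  obtain ⟨i, -, hw⟩ := hsol ⟨v, h⟩
  match i with
  | 0 => exact absurd ⟨v.2, h, hw⟩ hv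
  | 1 =>
    rw [← simulates_real_start Γ Cst he hd hsel D v h] at hw
    exact (simulates Γ Cst he hd hsel D).mem_winningRegion_one hw

/-- Over `D` the product contains the sink, so Player `0` wins there at once. This makes the
iteration increasing without any monotonicity of `step`. -/
theorem mem_step_of_mem (he : IsEdgeList A e) (hd : 1 ≤ d) {sel : ℕ → ℕ}
    (hsel : (numGame A e Γ Cst).Selects sel) {D : Set (Fin n)} {v : Fin n} (hv : v ∈ D) :
    (v : ℕ) ∈ step (numGame_valid Γ Cst he) sel (Fin.val '' D) := by
  have h : (v : ℕ) < (numGame A e Γ Cst).K * (numGame A e Γ Cst).N :=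
    (v.2.trans_le (n_le_N (numGame A e Γ Cst))).trans_le (Nat.le_mul_of_pos_left _ one_le_K)
  refine ⟨v.2, h, ?_⟩
  rw [← simulates_real_start Γ Cst he hd hsel D v h]
  obtain ⟨y, h1, h2, h3, h4, h5⟩ := (simulates Γ Cst he hd hsel D).sink _ hv
  exact Arena.mem_winningRegion_of_sink _ _ h1 h2 h3 h4 h5

/-- The vertices that are won by Player `0` after `k` iterations. -/
def won (he : IsEdgeList A e) (Γ : StreettPairs d (Fin n)) (Cst : CostFunctions d (Fin n))
    (sel : ℕ → ℕ) (k : ℕ) : Set (Fin n) :=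
  {v | (v : ℕ) ∈ (step (numGame_valid Γ Cst he) sel)^[k] ∅}

theorem image_won (he : IsEdgeList A e) (sel : ℕ → ℕ) (k : ℕ) :
    Fin.val '' won he Γ Cst sel k = (step (numGame_valid Γ Cst he) sel)^[k] ∅ := by
  ext x
  constructor
  · rintro ⟨v, hv, rfl⟩
    exact hv
  · intro hx
    have hxn : x < n := by
      cases k with
      | zero => exact absurd hx (Set.notMem_empty x)
      | succ k => rw [Function.iterate_succ_apply'] at hx; exact hx.1
    exact ⟨⟨x, hxn⟩, hx, rfl⟩

theorem mem_won_succ (he : IsEdgeList A e) (sel : ℕ → ℕ) (k : ℕ) (v : Fin n) :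
    v ∈ won he Γ Cst sel (k + 1) ↔
      (v : ℕ) ∈ step (numGame_valid Γ Cst he) sel (Fin.val '' won he Γ Cst sel k) := by
  rw [image_won, ← Function.iterate_succ_apply' (step (numGame_valid Γ Cst he) sel)]
  rfl

theorem won_zero (he : IsEdgeList A e) (sel : ℕ → ℕ) : won he Γ Cst sel 0 = ∅ := by
  ext v
  exact Iff.rfl

/-- An increasing chain of sets of at most `n` vertices cannot grow strictly in each of `n + 1`
rounds, and once two consecutive sets agree the iteration is constant. -/
theorem won_stable (he : IsEdgeList A e) (hd : 1 ≤ d) {sel : ℕ → ℕ}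
    (hsel : (numGame A e Γ Cst).Selects sel) :
    won he Γ Cst sel (n + 1) = won he Γ Cst sel n := by
  have hsub : ∀ k, won he Γ Cst sel k ⊆ won he Γ Cst sel (k + 1) := fun k v hv =>
    (mem_won_succ he sel k v).2 (mem_step_of_mem he hd hsel hv)
  have hstab : ∀ k, won he Γ Cst sel (k + 1) = won he Γ Cst sel k → ∀ j,
      won he Γ Cst sel (k + j) = won he Γ Cst sel k := by
    intro k hk j
    induction j with
    | zero => rfl
    | succ j ih =>
      rw [← hk]
      ext v
      rw [← Nat.add_assoc, mem_won_succ, mem_won_succ, ih]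
  obtain ⟨k, hk, hk'⟩ : ∃ k ≤ n, won he Γ Cst sel (k + 1) = won he Γ Cst sel k := by
    by_contra! hcon
    have hcard : ∀ k ≤ n + 1, k ≤ (won he Γ Cst sel k).ncard := by
      intro k hk
      induction k with
      | zero => exact Nat.zero_le _
      | succ k ih =>
        exact (ih (by omega)).trans_lt (Set.ncard_lt_ncard
          ((hsub k).ssubset_of_ne (hcon k (by omega)).symm) (Set.toFinite _))
    have h1 := hcard (n + 1) le_rfl
    have h2 := Set.ncard_le_card (won he Γ Cst sel (n + 1))
    rw [Nat.card_eq_fintype_card, Fintype.card_fin] at h2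
    omega
  obtain ⟨j, rfl⟩ := Nat.exists_eq_add_of_le hk
  rw [Nat.add_assoc, hstab k hk', hstab k hk']

theorem mem_winningRegion_bndCostStreett {p : Prog} {T : ℕ → ℕ → ℕ → ℕ} (hp : SolvesStreett p T)
    (he : IsEdgeList A e) (hd : 1 ≤ d) {sel : ℕ → ℕ}
    (hsel : (numGame A e Γ Cst).Selects sel) (v : Fin n) :
    (v ∈ won he Γ Cst sel 1 → v ∈ A.winningRegion (Γ.bndCostStreett Cst) 0) ∧
      (v ∉ won he Γ Cst sel 1 → v ∈ A.winningRegion (Γ.bndCostStreett Cst) 1) := by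
  rw [mem_won_succ, won_zero]
  constructor
  · intro hv
    have := mem_winningRegion_zero_of_step he hd hsel hv
    rwa [Arena.reach_empty, Set.union_empty] at this
  · intro hv
    have := mem_winningRegion_one_of_step hp he hd hsel hv
    rw [Arena.reach_empty, Set.union_empty] at this
    exact A.winningRegion_one_anti StreettPairs.bndCostStreett_subset_relaxed this

/-- By induction every vertex won so far is in the region of Player `0`: she wins the bounded game
or reaches an earlier set, and tails decide the condition. Stability says that outside of the final
set Player `1` wins `relaxed` and avoids the set, as the restarting strategy requires. -/
theorem mem_winningRegion_costStreett {p : Prog} {T : ℕ → ℕ → ℕ → ℕ} (hp : SolvesStreett p T)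
    (he : IsEdgeList A e) (hd : 1 ≤ d) {sel : ℕ → ℕ}
    (hsel : (numGame A e Γ Cst).Selects sel) (v : Fin n) :
    (v ∈ won he Γ Cst sel n → v ∈ A.winningRegion (Γ.costStreett Cst) 0) ∧
      (v ∉ won he Γ Cst sel n → v ∈ A.winningRegion (Γ.costStreett Cst) 1) := by
  constructor
  · have h : ∀ k, won he Γ Cst sel k ⊆ A.winningRegion (Γ.costStreett Cst) 0 := by
      intro k
      induction k with
      | zero => rw [won_zero]; exact Set.empty_subset _
      | succ k ih =>
        intro v hv
        refine A.winningRegion_of_reach _ _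
          (fun ρ k h => (StreettPairs.costStreett_tail_iff ρ k).1 h) ih ?_
        exact A.winningRegion_zero_mono
          (Set.union_subset_union_left _ StreettPairs.bndCostStreett_subset_costStreett)
          (mem_winningRegion_zero_of_step he hd hsel ((mem_won_succ he sel k v).1 hv))
    exact fun hv => h n hv
  · refine StreettPairs.mem_winningRegion_one_costStreett A Γ Cst _ (fun u hu => ?_) v
    rw [← won_stable he hd hsel, mem_won_succ] at hu
    exact mem_winningRegion_one_of_step hp he hd hsel hu

/-! ### Correctness and running time of the solver -/

theorem upto_costInput (A : Arena (Fin n)) (e : Fin m → Fin n × Fin n)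
    (Γ : StreettPairs d (Fin n)) (Cst : CostFunctions d (Fin n)) :
    (numGame A e Γ Cst).Upto 9 (costInput A e Γ Cst) := by
  classical
  have hne : ∀ a, a ≠ 6 → costInput A e Γ Cst a = streettInput A e Γ a := fun a ha =>
    Function.update_of_ne ha _ _
  refine ⟨fun a ha => ?_, fun a ha h8 x => ?_⟩
  · match a with
    | 0 => rw [hne 0 (by omega)]; exact ⟨rfl, rfl, rfl⟩
    | 1 =>
      rw [hne 1 (by omega)]
      intro v
      change table (fun v => (A.owner v : ℕ)) v =
        if v < n then table (fun v => (A.owner v : ℕ)) v else 0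
      split_ifs with h
      · rfl
      · exact table_of_le _ (by omega)
    | 2 => rw [hne 2 (by omega)]; exact fun j hj => rfl
    | 3 => rw [hne 3 (by omega)]; exact fun j hj => rfl
    | 4 =>
      rw [hne 4 (by omega)]
      intro c hc v hv
      change (if ∃ (c' : Fin d) (v' : Fin n), c * n + v = c' * n + v' ∧ v' ∈ Γ.Q c'
        then 1 else 0) = _
      unfold ind
      congr 1
      refine propext ⟨?_, ?_⟩
      · rintro ⟨c', v', h, h'⟩
        obtain ⟨h1, h2⟩ := mul_add_inj hv v'.2 h
        exact ⟨c', v', h1, h2, h'⟩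
      · rintro ⟨c', v', rfl, rfl, h'⟩
        exact ⟨c', v', rfl, h'⟩
    | 5 =>
      rw [hne 5 (by omega)]
      intro c hc v hv
      change (if ∃ (c' : Fin d) (v' : Fin n), c * n + v = c' * n + v' ∧ v' ∈ Γ.P c'
        then 1 else 0) = _
      unfold ind
      congr 1
      refine propext ⟨?_, ?_⟩
      · rintro ⟨c', v', h, h'⟩
        obtain ⟨h1, h2⟩ := mul_add_inj hv v'.2 h
        exact ⟨c', v', h1, h2, h'⟩
      · rintro ⟨c', v', rfl, rfl, h'⟩
        exact ⟨c', v', rfl, h'⟩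
    | 6 =>
      rw [costInput, Function.update_self]
      intro c hc j hj
      change (if ∃ (c' : Fin d) (j' : Fin m), c * m + j = c' * m + j' ∧
        Cst c' (e j').1 (e j').2 = CostLabel.inc then 1 else 0) = _
      unfold ind
      congr 1
      refine propext ⟨?_, ?_⟩
      · rintro ⟨c', j', h, h'⟩
        obtain ⟨h1, h2⟩ := mul_add_inj hj j'.2 h
        exact ⟨c', j', h1, h2, h'⟩
      · rintro ⟨c', j', rfl, rfl, h'⟩
        exact ⟨c', j', rfl, h'⟩
    | 7 => rw [hne 7 (by omega)]; exact fun _ => rfl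
    | 8 => trivial
  · rw [hne a (by omega)]
    obtain ⟨a, rfl⟩ := Nat.exists_eq_add_of_le' (show 6 ≤ a by omega)
    rfl

/-- The lower bound for solvers, applied to the dimensions of the product, shows that the size of
the product is at most twice the time of the solver. So `14` times this time pays for the tables as
well as for a logged run, which takes at most `13` times its original time. -/
theorem fits_numGame {p : Prog} {T : ℕ → ℕ → ℕ → ℕ} (hp : SolvesStreett p T) (hn : 0 < n)
    (hd : 0 < d) (he : IsEdgeList A e) :
    1 ≤ T ((numGame A e Γ Cst).K * (numGame A e Γ Cst).N)
      ((numGame A e Γ Cst).K * (numGame A e Γ Cst).M) (2 * (numGame A e Γ Cst).d) ∧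
    (numGame A e Γ Cst).Fits (14 * T ((numGame A e Γ Cst).K * (numGame A e Γ Cst).N)
      ((numGame A e Γ Cst).K * (numGame A e Γ Cst).M) (2 * (numGame A e Γ Cst).d)) := by
  have hm : m ≤ n * n := by simpa using Fintype.card_le_of_injective e he.1
  set G := numGame A e Γ Cst with hGdef
  have hG : G.Valid := numGame_valid Γ Cst he
  have hGn : G.n = n := rfl
  have hGm : G.m = m := rfl
  have hGd : G.d = d := rfl
  have hK : 2 ≤ G.K := two_le_K hd
  have hN : 1 ≤ G.N := hn.trans_le (n_le_N G)
  have hKN : 2 ≤ G.K * G.N := hK.trans (Nat.le_mul_of_pos_right _ hN)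
  have hKM : G.K * G.N ≤ G.K * G.M := Nat.mul_le_mul_left _ (N_le_M hG)
  have hMN : G.M ≤ G.N * G.N := by
    unfold M N
    rw [hGn, hGm]
    nlinarith [Nat.zero_le G.s]
  obtain ⟨P, hP⟩ := Nat.exists_eq_add_of_le' (show 1 ≤ G.K * G.N by omega)
  have h2N : 2 * G.N ≤ P + 1 := hP ▸ Nat.mul_le_mul_right _ hK
  -- From `M ≤ N * N` and `2 ≤ K`, twice the number of edges is at most the square of `K * N`. With
  -- `K * N = P + 1`, it remains to use `(P + 1) ^ 2 ≤ 2 * (P ^ 2 + 1)`, which is `0 ≤ (P - 1) ^ 2`.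
  have hbound : G.K * G.M ≤ (G.K * G.N - 1) * (G.K * G.N - 1) + 1 := by
    rw [hP, Nat.add_sub_cancel]
    have h1 : G.K * G.M ≤ (P + 1) * G.N := by
      rw [← hP, Nat.mul_assoc]
      exact Nat.mul_le_mul_left _ hMN
    have h2 : (P + 1) * (2 * G.N) ≤ (P + 1) * (P + 1) := Nat.mul_le_mul_left _ h2N
    have h3 : (P + 1) * (P + 1) ≤ 2 * (P * P + 1) := by
      zify
      nlinarith [sq_nonneg ((P : ℤ) - 1)]
    have h4 : (P + 1) * (2 * G.N) = 2 * ((P + 1) * G.N) := by ring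
    omega
  have hle := le_time_of_solvesStreett hp hKN (show 1 ≤ 2 * G.d by omega) hKM hbound
  generalize T (G.K * G.N) (G.K * G.M) (2 * G.d) = t at hle
  -- The lower bound has `K * N - 1` and `K * M - 1` in place of `K * N` and `K * M`; as both
  -- products are at least `2`, this loses at most a factor of `2`.
  have hs : G.size ≤ 2 * t := by
    unfold size
    have h1 : 2 * G.d * (G.K * G.N) ≤ 2 * G.d * (2 * (G.K * G.N - 1)) :=
      Nat.mul_le_mul_left _ (by omega)
    have h2 : 2 * G.d * (2 * (G.K * G.N - 1)) = 2 * (2 * G.d * (G.K * G.N - 1)) := by ring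
    omega
  exact ⟨by omega, hG, hn, hd, by omega⟩

/-- The solver fills array `7` with the vertices that are won after `β` iterations. -/
theorem exists_run_costSolver_costInput {p : Prog} {T : ℕ → ℕ → ℕ → ℕ} (hp : SolvesStreett p T)
    (hn : 0 < n) (hd : 0 < d) (he : IsEdgeList A e) {B : Exp} {β : ℕ} (hβ : 1 ≤ β)
    (hB : ∀ μ, (numGame A e Γ Cst).Known 36 μ → B.val μ = β) :
    ∃ t τ sel, Run (costSolver p B) (costInput A e Γ Cst) t τ ∧
      t ≤ 28 * (costSolver p B).weight *
        (β * T (2 ^ d * (n + A.subdivisions Cst)) (2 ^ d * (m + A.subdivisions Cst)) (2 * d)) ∧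
      (numGame A e Γ Cst).Selects sel ∧
        ∀ v : Fin n, τ 7 v = 1 - ind (v ∈ won he Γ Cst sel β) := by
  obtain ⟨h1, h2⟩ := fits_numGame (Γ := Γ) (Cst := Cst) hp hn hd he
  obtain ⟨t, τ, sel, r, ht, hsel, hτ⟩ := exists_run_costSolver hp (upto_costInput A e Γ Cst) h2
    (by omega) hβ hB
  refine ⟨t, τ, sel, r, ht.trans (le_of_eq ?_), hsel, fun v => hτ v v.2⟩
  rw [← numGame_s Γ Cst he]
  change _ = 28 * (costSolver p B).weight * (β * T ((numGame A e Γ Cst).K * (numGame A e Γ Cst).N)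
    ((numGame A e Γ Cst).K * (numGame A e Γ Cst).M) (2 * (numGame A e Γ Cst).d))
  ring

theorem isSolution_of_won {Win : Set (ℕ → Fin n)} {W : Set (Fin n)} {τ : Mem}
    (hτ : ∀ v : Fin n, τ 7 v = 1 - ind (v ∈ W))
    (h : ∀ v, (v ∈ W → v ∈ A.winningRegion Win 0) ∧ (v ∉ W → v ∈ A.winningRegion Win 1)) :
    IsSolution A Win τ := by
  intro v
  rw [hτ]
  by_cases hv : v ∈ W
  · exact ⟨0, by rw [ind_pos hv]; rfl, (h v).1 hv⟩
  · exact ⟨1, by rw [ind_neg hv]; rfl, (h v).2 hv⟩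

/-- Without pairs, Player `0` wins everywhere. -/
theorem exists_run_costSolver_of_isEmpty {p : Prog} {T : ℕ → ℕ → ℕ → ℕ} (hp : SolvesStreett p T)
    (hn : 0 < n) {A : Arena (Fin n)} (he : IsEdgeList A e) (Γ : StreettPairs 0 (Fin n))
    (Cst : CostFunctions 0 (Fin n)) (B : Exp) :
    ∃ t τ, Run (costSolver p B) (costInput A e Γ Cst) t τ ∧
      t ≤ 28 * (costSolver p B).weight *
        T (2 ^ 0 * (n + A.subdivisions Cst)) (2 ^ 0 * (m + A.subdivisions Cst)) (2 * 0) ∧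
      IsSolution A (Γ.bndCostStreett Cst) τ ∧ IsSolution A (Γ.costStreett Cst) τ := by
  have hs : A.subdivisions Cst = 0 := by
    rw [Arena.subdivisions, Set.ncard_eq_zero (Set.toFinite _)]
    ext x
    simp
  obtain ⟨t, τ, r, ht, -⟩ := hp n m 0 hn A e Γ he
  have h1 := r.one_le
  have hval : dE.val (costInput A e Γ Cst) = 0 :=
    (upto_costInput A e Γ Cst).1.val_dE (by omega)
  have hlim : ∀ ρ, Γ.stCor Cst ρ = fun _ => 0 := fun ρ => by
    funext k
    simp [StreettPairs.stCor]
  have hcost : ∀ ρ, ρ ∈ Γ.costStreett Cst := fun ρ => by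
    simp [StreettPairs.costStreett, hlim]
  have hbnd : ∀ ρ, ρ ∈ Γ.bndCostStreett Cst := fun ρ => ⟨hcost ρ, fun c => c.elim0⟩
  have hsol : ∀ Win : Set (ℕ → Fin n), (∀ ρ, ρ ∈ Win) → IsSolution A Win (costInput A e Γ Cst) := by
    intro Win hWin v
    obtain ⟨σ⟩ := A.nonempty_strategy 0
    exact ⟨0, rfl, σ, fun ρ _ _ _ => hWin ρ⟩
  -- Without pairs there is only one copy, so redirected and ordinary edges could coincide. The
  -- product is avoided; the zeros already in array `7` name Player `0` as the winner everywhere.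
  refine ⟨_, _, Run.ite_neg hval (Run.skip _), ?_, hsol _ hbnd, hsol _ hcost⟩
  rw [hs, pow_zero, Nat.one_mul, Nat.one_mul, Nat.add_zero, Nat.add_zero, Nat.mul_zero]
  have hw : dE.cost + 1 + 1 ≤ (costSolver p B).weight := by
    change _ ≤ dE.cost + 1 + _ + 1
    omega
  calc dE.cost + 1 + 1 ≤ (costSolver p B).weight * 1 := by omega
    _ ≤ 28 * (costSolver p B).weight * T n m 0 := Nat.mul_le_mul (by omega) (h1.trans ht)

end GameIO

/-- Both solvers are the same program with a different number of iterations: a single one decides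
the bounded game, and `n` of them reach the stable set of the game with costs. -/
theorem mainTheorem4 (T : ℕ → ℕ → ℕ → ℕ) (p : RAM.Prog) (hp : GameIO.SolvesStreett p T) :
    (∃ (q : RAM.Prog) (C : ℕ), GameIO.SolvesBndCostStreett q
      fun n m d s => C * T (2 ^ d * (n + s)) (2 ^ d * (m + s)) (2 * d)) ∧
    (∃ (q : RAM.Prog) (C : ℕ), GameIO.SolvesCostStreett q
      fun n m d s => C * (n * T (2 ^ d * (n + s)) (2 ^ d * (m + s)) (2 * d))) := by
  refine ⟨⟨NumGame.costSolver p (.lit 1), 28 * (NumGame.costSolver p (.lit 1)).weight, ?_⟩,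
    ⟨NumGame.costSolver p NumGame.nE, 28 * (NumGame.costSolver p NumGame.nE).weight, ?_⟩⟩
  · intro n m d hn A e Γ Cst he
    rcases Nat.eq_zero_or_pos d with rfl | hd
    · obtain ⟨t, τ, r, ht, h, -⟩ := GameIO.exists_run_costSolver_of_isEmpty hp hn he Γ Cst (.lit 1)
      exact ⟨t, τ, r, ht, h⟩
    · obtain ⟨t, τ, sel, r, ht, hsel, hτ⟩ := GameIO.exists_run_costSolver_costInput (Γ := Γ)
        (Cst := Cst) hp hn hd he (B := .lit 1) le_rfl fun _ _ => rfl
      rw [Nat.one_mul] at ht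
      exact ⟨t, τ, r, ht, GameIO.isSolution_of_won hτ
        (GameIO.mem_winningRegion_bndCostStreett hp he hd hsel)⟩
  · intro n m d hn A e Γ Cst he
    rcases Nat.eq_zero_or_pos d with rfl | hd
    · obtain ⟨t, τ, r, ht, -, h⟩ := GameIO.exists_run_costSolver_of_isEmpty hp hn he Γ Cst
        NumGame.nE
      exact ⟨t, τ, r, ht.trans (Nat.mul_le_mul_left _ (Nat.le_mul_of_pos_left _ hn)), h⟩
    · obtain ⟨t, τ, sel, r, ht, hsel, hτ⟩ := GameIO.exists_run_costSolver_costInput (Γ := Γ)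
        (Cst := Cst) hp hn hd he (B := NumGame.nE) hn fun μ hμ => hμ.val_nE (by omega)
      exact ⟨t, τ, r, ht, GameIO.isSolution_of_won hτ
        (GameIO.mem_winningRegion_costStreett hp he hd hsel)⟩
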